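/- **Proposition 6 (Local Markov properties of summary graphs).** *Edge matrices.* Let $\mathcal A$ be the edge matrix of a directed acyclic graph with node set $V=\{1,\dots,d\}$ in a compatible ordering: a binary unit upper-triangular matrix, with $\mathcal A_{ik}=1$ for $i<k$ if and only if $i\leftarrow k$. Write $\mathrm{In}[\cdot]$ for the operator replacing each non-zero entry of a matrix by $1$. For a binary matrix $\mathcal F$, a node set $a$ and its complement $b$, let $\mathcal F_{aa}^-=\mathrm{In}[((|a|+1)I-\mathcal F_{aa})^{-1}]$, $\mathcal F_{bb.a}=\mathrm{In}[\mathcal F_{bb}+\mathcal F_{ba}\mathcal F_{aa}^-\mathcal F_{ab}]$, and let $\mathrm{zer}_a\mathcal F$ be $\mathrm{In}$ of the matrix with blocks $\mathcal F_{aa}^-$, $\mathcal F_{aa}^-\mathcal F_{ab}$, $\mathcal F_{ba}\mathcal F_{aa}^-$, $\mathcal F_{bb.a}$. Where an operator is applied to a matrix on fewer nodes, entries outside are zero. *Summary graphs.* A summary graph has node set $N=u\cup v$ (disjoint), edge matrices $\mathcal H_{uN}=(\mathcal H_{uu},\mathcal H_{uv})$ (arrows), $\mathcal W_{uu}$ (dashed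 lines) and $\mathcal S^{vv.uM}$ (full lines). An ancestor of $i$ is the start of a directed path (of arrows) to $i$. Given disjoint $C,M\subseteq V$, the summary graph obtained from $\mathcal A$ by conditioning on $C$ and marginalising over $M$ is given as follows. Let $F$ be the set of ancestors of nodes of $C$ that are not in $C$, $R=C\cup F$, $O=V\setminus R$, $p=M\cap O$, $q=M\cap F$, $u=O\setminus p$, $v=F\setminus q$, $\mathcal D=\mathrm{zer}_p(\mathcal A_{OO},\mathcal A_{OF})$, and let $\mathcal Z=\mathrm{zer}_q(\mathrm{In}[\mathcal A_{RR}^T\mathcal A_{RR}]_{FF})$. Then $$\mathcal H_{uu}=\mathcal D_{uu},\quad \mathcal H_{uv}=\mathrm{In}[\mathcal D_{uv}+\mathcal D_{uq}\mathcal Z_{qv}],\quad \mathcal S^{vv.uM}=\mathcal Z_{vv},\quad \mathcal W_{uu}=\mathrm{In}[I_{uu}+\mathcal D_{up}\mathcal D_{up}^T+\mathcal D_{uq}\mathcal Z_{qq}\mathcal D_{uq}^T].$$ From a summary graph with node sets $(\mu,\nu)$ and edge matrices $\mathcal B_{\mu\mu},\mathcal B_{\mu\nu},\mathcal W',\mathcal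 S'$, the summary graph after additionally conditioning on $c'$ and marginalising over $m'$ (disjoint subsets of $\mu\cup\nu$) is given as follows. Let $c_\mu=c'\cap\mu$, let $r$ consist of $c_\mu$ and its ancestors within $\mu$, $o=\mu\setminus r$, $\psi=r\cup\nu$, $\phi=\psi\setminus c'$, $h=m'\cap o$, $l=m'\setminus h$, $u=o\setminus h$, $v=\phi\setminus l$, $\mathcal Q=\mathrm{zer}_r\mathcal W'$, $\mathcal C_{o\psi}=\mathrm{In}[\mathcal B_{o\psi}+\mathcal Q_{or}\mathcal B_{r\psi}]$, $\mathcal S^{\psi\psi}=\mathrm{In}[\mathcal B_{r\psi}^T\mathcal Q_{rr}\mathcal B_{r\psi}+\mathcal S'_{\nu\nu}]$, $\mathcal K=\mathrm{zer}_{h\cup l}\begin{pmatrix}\mathcal B_{oo}&\mathcal C_{o\phi}\\0&\mathcal S^{\phi\phi}\end{pmatrix}$ and $\mathcal Z=\mathrm{zer}_l\mathcal S^{\phi\phi}$. Then $$\mathcal H_{uu}=\mathcal K_{uu},\quad \mathcal H_{uv}=\mathcal K_{uv},\quad \mathcal S^{vv.uM}=\mathcal Z_{vv},$$ $$\mathcal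 W_{uu}=\mathrm{In}[\mathcal Q_{uu}+\mathcal Q_{uh}\mathcal K_{uh}^T+\mathcal K_{uh}\mathcal Q_{hu}+\mathcal K_{uh}\mathcal Q_{hh}\mathcal K_{uh}^T+\mathcal K_{ul}\mathcal Z_{ll}\mathcal K_{ul}^T].$$ Let the summary graph $G=G^{V\setminus[C,M]}_{\mathrm{sum}}$ be obtained from $\mathcal A$ by conditioning in total on $C$ and marginalising in total over $M$, directly or through any finite sequence of intermediate summary graphs. *Distributions.* A distribution of a real random vector $Y=(Y_1,\dots,Y_d)$ is called generated over the graph if, for every $i$ with parent set $\mathrm{par}_i$, $Y_i$ is conditionally independent of $Y_{\{i+1,\dots,d\}\setminus \mathrm{par}_i}$ given $Y_{\mathrm{par}_i}$, and, for every $l\in\mathrm{par}_i$, $Y_i$ and $Y_l$ are conditionally dependent given $Y_{\mathrm{par}_i\setminus\{l\}}$ (edge-minimality). The Gaussian triangular systems over the graph are the distributions of $Y$ with $AY=\varepsilon$, where $A$ is a real unit upper-triangular matrix with $\mathrm{In}[A]=\mathcal A$ and $\varepsilon$ has independent mean-zero Gaussian components with positive variances. These are generated over the graph. Let $\mathcal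 P$ be any family of distributions that are generated over the graph which contains all these Gaussian triangular systems (for instance the family of all distributions generated over the graph, or the family of all Gaussian triangular systems). Write $\alpha\perp\!\!\!\perp\beta\mid\gamma$ if, for every member of $\mathcal P$, $Y_\alpha$ and $Y_\beta$ are conditionally independent given $Y_\gamma$. *Result.* Take any full ordering of the nodes in $u$ in which the ancestors within $u$ of each node lie in the past of the node. For $i\in u$ let $c=c_i$ be the set of ancestors of $i$ in $G$ within $u$, and let $\bar c=\bar c_i$ be the set of the other nodes of $u$ in the past of $i$; for $l\in\bar c$ let $e=c_i\cup c_l$. Then 1. for $i\in v$ and $\beta\subseteq v\setminus\{i\}$: $\; i\perp\!\!\!\perp\beta\mid C\cup(v\setminus(\{i\}\cup\beta)) \iff \mathcal S^{i\beta.uM}=0$; 2. for $i\in u$ and $\beta\subseteq v$: $\; i\perp\!\!\!\perp\beta\mid C\cup(v\setminus\beta)\iff \mathcal H_{i\beta.c}=0$, where $\mathcal H_{i\beta.c}=\mathrm{In}[\mathcal H_{i\beta}+\mathcal H_{ic}\mathcal H_{cc}^-\mathcal H_{c\beta}]$; 3. for $i\in u$ and $l\in\bar c$: $\; i\perp\!\!\!\perp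 l\mid C\cup v\cup e\iff \mathcal W_{il}=0$ and $\mathcal W_{ie}\mathcal W_{ee}^-\mathcal W_{el}=0$; 4. for $i\in u$ and $\beta\subseteq c$: $\; i\perp\!\!\!\perp\beta\mid C\cup v\cup(c\setminus\beta)\iff \mathcal H_{i\beta}=0$ and $\mathcal W_{ic}\mathcal W_{cc}^-\mathcal H_{c\beta}=0$. -/

import Mathlib

open MeasureTheory ProbabilityTheory
open scoped NNReal

noncomputable section

namespace SummaryGraph

/-! ### Edge matrices: indicator, blocks, partial closure -/

section EdgeMatrix

variable {V : Type*} [Fintype V] [DecidableEq V]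

/-- The indicator `In[F]`: every non-zero entry is changed into a one. -/
def ind {m n : Type*} (F : Matrix m n ℝ) : Matrix m n ℝ :=
  open Classical in fun i k => if F i k = 0 then 0 else 1

/-- The block `F_{ab}`, kept at its place in a `V × V` matrix, with zeros elsewhere.
Products and transposes of blocks are then products and transposes of `V × V` matrices. -/
def blk (a b : Finset V) (F : Matrix V V ℝ) : Matrix V V ℝ :=
  fun i k => if i ∈ a ∧ k ∈ b then F i k else 0

/-- `F_{aa}^- = In[(n I_{aa} - F_{aa})⁻¹]` with `n - 1 = |a|`, placed as a block. -/
def clo (a : Finset V) (F : Matrix V V ℝ) : Matrix V V ℝ :=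
  fun i k =>
    if h : i ∈ a ∧ k ∈ a then
      ind (((a.card : ℝ) + 1) • (1 : Matrix {x // x ∈ a} {x // x ∈ a} ℝ)
          - F.submatrix Subtype.val Subtype.val)⁻¹ ⟨i, h.1⟩ ⟨k, h.2⟩
    else 0

/-- `F_{bb.a} = In[F_{bb} + F_{ba} F_{aa}^- F_{ab}]` with `b` the complement of `a`. -/
def margin (a : Finset V) (F : Matrix V V ℝ) : Matrix V V ℝ :=
  ind (blk aᶜ aᶜ F + blk aᶜ a F * clo a F * blk a aᶜ F)

/-- Partial closure `zer_a F`. The four summands are its blocks `aa`, `ab`, `ba` and `bb`. -/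
def zer (a : Finset V) (F : Matrix V V ℝ) : Matrix V V ℝ :=
  ind (clo a F + clo a F * blk a aᶜ F + blk aᶜ a F * clo a F + margin a F)

/-- `i ← k` for an edge matrix of arrows. -/
def Arrow (F : Matrix V V ℝ) (i k : V) : Prop := i ≠ k ∧ F i k ≠ 0

/-- The ancestors of the node `i`: the starting nodes of directed paths to `i`. -/
def anc (F : Matrix V V ℝ) (i : V) : Finset V :=
  open Classical in Finset.univ.filter fun k => Relation.TransGen (Arrow F) i k

/-- The foster nodes of `s`: ancestors of a node in `s`, outside `s`. -/
def foster (F : Matrix V V ℝ) (s : Finset V) : Finset V := s.biUnion (anc F) \ s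

end EdgeMatrix

/-! ### Summary graphs -/

/-- The node sets `(u, v)` and edge matrix components of a summary graph with nodes among `V`:
`H` holds `H_{uN} = (H_{uu}, H_{uv})` (arrows), `W` holds `W_{uu}` (dashed lines) and
`S` holds `S^{vv.uM}` (full lines). -/
structure Graph (V : Type*) where
  u : Finset V
  v : Finset V
  H : Matrix V V ℝ
  W : Matrix V V ℝ
  S : Matrix V V ℝ

section Construction

variable {V : Type*} [Fintype V] [DecidableEq V]

/-- The summary graph obtained from the edge matrix `A` of a parent graph by conditioning on `C`
and marginalising over `M`. -/
def ofParent (A : Matrix V V ℝ) (C M : Finset V) : Graph V :=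
  let F := foster A C
  let R := C ∪ F
  let O := Rᶜ
  let p := M ∩ O
  let q := M ∩ F
  let u := O \ p
  let v := F \ q
  let D := zer p (blk O (O ∪ F) A)
  let SR := ind ((blk R R A).transpose * blk R R A)
  -- the blocks of `Z` are `S_{qq|vC}`, `P_{q|v.C}` and `S^{vv.qO}`
  let Z := zer q (blk F F SR)
  { u := u
    v := v
    H := ind (blk u u D + (blk u v D + blk u q D * blk q v Z))
    W := ind ((blk u u 1 + blk u p D * (blk u p D).transpose)
          + blk u q D * blk q q Z * (blk u q D).transpose)
    S := blk v v Z }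

/-- The summary graph obtained from the summary graph `G` by additional conditioning on `c` and
additional marginalising over `m`. -/
def Graph.condMarg (G : Graph V) (c m : Finset V) : Graph V :=
  let cμ := c ∩ G.u
  let fμ := foster G.H cμ ∩ G.u
  let r := cμ ∪ fμ
  let o := G.u \ r
  let ψ := r ∪ G.v
  let h := m ∩ o
  let l := m \ h
  let u := o \ h
  let φ := ψ \ c
  let v := φ \ l
  let Q := zer r G.W
  let Coψ := ind (blk o ψ G.H + blk o r Q * blk r ψ G.H)
  -- `S^{ψψ.om}`
  let Sψ := ind ((blk r ψ G.H).transpose * blk r r Q * blk r ψ G.H + blk G.v G.v G.S)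
  let K := zer (h ∪ l) (blk o o G.H + blk o φ Coψ + blk φ φ Sψ)
  -- the blocks of `Z` are `S_{ll|vC}`, `P_{l|v.C}` and `S^{vv.uM}`
  let Z := zer l (blk φ φ Sψ)
  { u := u
    v := v
    H := blk u u K + blk u v K
    -- structural non-zeros of the covariance matrix of `ξ_u - K_{uh} ξ_h - K_{ul} Σ_{ll|vC} ζ_l`
    W := ind ((blk u u Q + blk u h Q * (blk u h K).transpose + blk u h K * blk h u Q
            + blk u h K * blk h h Q * (blk u h K).transpose)
          + blk u l K * blk l l Z * (blk u l K).transpose)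
    S := blk v v Z }

/-- `Generated A C M G`: the summary graph `G` results from the parent graph with edge matrix `A`
by conditioning, in total, on `C` and marginalising, in total, over `M`, either directly or through
any sequence of intermediate summary graphs. -/
inductive Generated (A : Matrix V V ℝ) : Finset V → Finset V → Graph V → Prop
  | ofParent (C M : Finset V) (hCM : Disjoint C M) : Generated A C M (ofParent A C M)
  | condMarg (c m c' m' : Finset V) (G : Graph V) (hG : Generated A c m G)
      (hc : c' ⊆ G.u ∪ G.v) (hm : m' ⊆ G.u ∪ G.v) (hcm : Disjoint c' m') :
      Generated A (c ∪ c') (m ∪ m') (G.condMarg c' m')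

/-- The ancestors of `i` within `u`. -/
def Graph.ancU (G : Graph V) (i : V) : Finset V := anc G.H i ∩ G.u

/-- `pos` gives a full ordering of the nodes in `u` in which the ancestors within `u` of each node
are in the past of this node, that is, come later. -/
def Graph.IsCompatible (G : Graph V) (pos : V → ℕ) : Prop :=
  Set.InjOn pos G.u ∧ ∀ i ∈ G.u, ∀ k ∈ G.ancU i, pos i < pos k

/-- The nodes in the past of `i` within `u` that are not ancestors of `i`. -/
def Graph.nonAnc (G : Graph V) (pos : V → ℕ) (i : V) : Finset V :=
  (G.u.filter fun l => pos i < pos l) \ G.ancU i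

end Construction

/-! ### Distributions generated over a parent graph -/

section Distribution

variable {d : ℕ}

/-- `A` is the edge matrix of a directed acyclic graph with nodes `1, …, d` in a compatible
ordering: a binary unit upper-triangular matrix. -/
def IsParentMatrix (A : Matrix (Fin d) (Fin d) ℝ) : Prop :=
  (∀ i k, A i k = 0 ∨ A i k = 1) ∧ (∀ i, A i i = 1) ∧ ∀ i k, k < i → A i k = 0

/-- The parents of `i`. -/
def par (A : Matrix (Fin d) (Fin d) ℝ) (i : Fin d) : Finset (Fin d) :=
  open Classical in (Finset.Ioi i).filter fun k => A i k ≠ 0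

/-- `α ⊥⊥ β | γ` for the random vector `Y` with joint distribution `μ`: `Y_α` is conditionally
independent of `Y_β` given `Y_γ`. -/
def CondInd (μ : ProbabilityMeasure (Fin d → ℝ)) (α β γ : Finset (Fin d)) : Prop :=
  CondIndepFun (MeasurableSpace.comap (γ.restrict (π := fun _ => ℝ)) inferInstance)
    (Finset.measurable_restrict γ).comap_le
    (α.restrict (π := fun _ => ℝ)) (β.restrict (π := fun _ => ℝ)) (μ : Measure (Fin d → ℝ))

/-- The distributions generated over the parent graph with edge matrix `A`: each component depends
on its past `{i+1, …, d}` only through its parents, and the graph is edge-minimal. -/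
def generatedOver (A : Matrix (Fin d) (Fin d) ℝ) : Set (ProbabilityMeasure (Fin d → ℝ)) :=
  {μ | (∀ i, CondInd μ {i} (Finset.Ioi i \ par A i) (par A i)) ∧
    ∀ i, ∀ l ∈ par A i, ¬ CondInd μ {i} {l} (par A i \ {l})}

/-- The Gaussian triangular systems `B Y = ε` generated over the parent graph with edge matrix `A`:
`B` is unit triangular with `In[B] = A`, and the residuals are independent, mean-zero Gaussian
with positive variances. -/
def gaussianOver (A : Matrix (Fin d) (Fin d) ℝ) : Set (ProbabilityMeasure (Fin d → ℝ)) :=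
  {μ | ∃ (B : Matrix (Fin d) (Fin d) ℝ) (δ : Fin d → ℝ≥0),
    (∀ i, B i i = 1) ∧ ind B = A ∧ (∀ i, δ i ≠ 0) ∧
    (μ : Measure (Fin d → ℝ)).map B.mulVec = Measure.pi fun i => gaussianReal 0 (δ i)}

/-- `α ⊥⊥ β | γ` is implied for the family `P`: it holds for each of its members. -/
def Implied (P : Set (ProbabilityMeasure (Fin d → ℝ))) (α β γ : Finset (Fin d)) : Prop :=
  ∀ μ ∈ P, CondInd μ α β γ

end Distribution

end SummaryGraph

end

/-! The proof separates graph theory from probability, with connecting walks of the parent graph as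
the common language.

Edges of summary graphs are walks. All matrices involved are nonnegative, so sums and products never
cancel, and a zero pattern states which paths exist (`inv_ne_zero_iff`, `zer_ne_zero`). A graph
`Represents` the parent graph for `C` and `M` if its edges are exactly the walks whose inner
colliders are ancestors of `C` (or in `C`) and whose other inner nodes lie in `M`, sorted by the
marks at their ends. A further conditioning and marginalising step cuts longer walks into such
pieces and preserves this property (`StepData.condMarg`). The direct construction has the zero
patterns of one such step applied to the parent graph (`represents_ofParent`). Hence every generated
graph has the property, whatever the route (`Generated.represents`).

Connection in terms of edges. Given `C` and some nodes of `u ∪ v`, a connecting walk is a sequence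
of edges of `G` (`Represents.walk_iff`). For each of the four conditioning sets, ancestral closure
leaves only few shapes of sequences: one full line, a directed path followed by an arrow from `v`, a
path of dashed lines, or such a path that may end with an arrow. This gives `conn_full`,
`conn_arrow`, `conn_dashed` and `conn_ancestor`.

Connection and independence. Separation implies independence for every generated distribution: nodes
are added one at a time in front of the later ones, using weak union and contraction
(`condInd_of_not_conn`). Conversely, one Gaussian triangular system violates every independence that
separation does not give (`exists_gaussian_not_condInd`). Its covariances are inner products of
vectors `y i`. Conditioning is projection onto an orthogonal complement, and each new node receives
generic coefficients and a generic residual variance, so that none of the finitely many relevant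
partial covariances vanishes. Thus for any family between the Gaussian systems and all generated
distributions, implied independence is separation (`implied_iff_not_conn`). -/

noncomputable section

namespace SummaryGraph

/-! ### Zero patterns of the matrix operators -/

section Pattern

variable {V : Type*}

/-- All entries lie in the unit interval. -/
def UnitEntries (F : Matrix V V ℝ) : Prop := ∀ i k, 0 ≤ F i k ∧ F i k ≤ 1

lemma ind_ne_zero {F : Matrix V V ℝ} {i k : V} : ind F i k ≠ 0 ↔ F i k ≠ 0 := by
  unfold ind; split_ifs <;> simp_all

lemma unitEntries_ind (F : Matrix V V ℝ) : UnitEntries (ind F) := by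
  intro i k; unfold ind; split_ifs <;> simp

lemma UnitEntries.nonneg {F : Matrix V V ℝ} (h : UnitEntries F) (i k : V) : 0 ≤ F i k := (h i k).1

lemma add_ne_zero_iff_of_nonneg {a b : ℝ} (ha : 0 ≤ a) (hb : 0 ≤ b) :
    a + b ≠ 0 ↔ a ≠ 0 ∨ b ≠ 0 := by
  rw [Ne, add_eq_zero_iff_of_nonneg ha hb]; tauto

lemma matrix_add_ne_zero {F K : Matrix V V ℝ} (hF : ∀ i k, 0 ≤ F i k) (hK : ∀ i k, 0 ≤ K i k)
    {i k : V} : (F + K) i k ≠ 0 ↔ F i k ≠ 0 ∨ K i k ≠ 0 :=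
  add_ne_zero_iff_of_nonneg (hF i k) (hK i k)

lemma matrix_add_nonneg {F K : Matrix V V ℝ} (hF : ∀ i k, 0 ≤ F i k) (hK : ∀ i k, 0 ≤ K i k)
    (i k : V) : 0 ≤ (F + K) i k := add_nonneg (hF i k) (hK i k)

lemma matrix_mul_nonneg [Fintype V] {F K : Matrix V V ℝ} (hF : ∀ i k, 0 ≤ F i k)
    (hK : ∀ i k, 0 ≤ K i k) (i k : V) : 0 ≤ (F * K) i k :=
  Finset.sum_nonneg fun j _ => mul_nonneg (hF i j) (hK j k)

/-- Nonnegative terms cannot cancel. This turns every matrix formula below into a statement about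
the existence of paths. -/
lemma matrix_mul_ne_zero [Fintype V] {F K : Matrix V V ℝ} (hF : ∀ i k, 0 ≤ F i k)
    (hK : ∀ i k, 0 ≤ K i k) {i k : V} : (F * K) i k ≠ 0 ↔ ∃ j, F i j ≠ 0 ∧ K j k ≠ 0 := by
  rw [Matrix.mul_apply, Ne, Finset.sum_eq_zero_iff_of_nonneg
    fun j _ => mul_nonneg (hF i j) (hK j k)]
  simp

lemma matrix_transpose_nonneg {F : Matrix V V ℝ} (hF : ∀ i k, 0 ≤ F i k) (i k : V) :
    0 ≤ F.transpose i k := hF k i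

/-- A path of non-zero entries from `i` to `k` whose inner nodes lie in `a`. -/
inductive Via (a : Finset V) (F : Matrix V V ℝ) : V → V → Prop
  | single {i k} : F i k ≠ 0 → Via a F i k
  | cons {i j k} : F i j ≠ 0 → j ∈ a → Via a F j k → Via a F i k

lemma Via.trans {a : Finset V} {F : Matrix V V ℝ} {i j k : V} (h : Via a F i j) (hj : j ∈ a)
    (h' : Via a F j k) : Via a F i k := by
  induction h with
  | single h => exact .cons h hj h'
  | cons h hm _ ih => exact .cons h hm (ih hj h')

lemma Via.mono {a b : Finset V} {F K : Matrix V V ℝ} (hab : a ⊆ b)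
    (hFK : ∀ i k, F i k ≠ 0 → K i k ≠ 0) {i k : V} (h : Via a F i k) : Via b K i k := by
  induction h with
  | single h => exact .single (hFK _ _ h)
  | cons h hm _ ih => exact .cons (hFK _ _ h) (hab hm) ih

lemma Via.symm {a : Finset V} {F : Matrix V V ℝ} (hF : ∀ i k, F i k ≠ 0 → F k i ≠ 0) {i k : V}
    (h : Via a F i k) : Via a F k i := by
  induction h with
  | single h => exact .single (hF _ _ h)
  | cons h hm _ ih => exact ih.trans hm (.single (hF _ _ h))

lemma Via.of_reflTransGen {a : Finset V} {F : Matrix V V ℝ} {i j k : V}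
    (h : Relation.ReflTransGen (fun x y => y ∈ a ∧ F x y ≠ 0) i j) (hi : i ∈ a) (hk : F j k ≠ 0) :
    Via a F i k := by
  induction h using Relation.ReflTransGen.head_induction_on with
  | refl => exact .single hk
  | head h _ ih => exact .cons h.2 h.1 (ih h.1)

/-- The end node `k` need not lie in `a`. Splitting off the last step leaves a path of the kind
described by the closure, on which every node after the first is in `a`. -/
lemma Via.exists_tail {a : Finset V} {F : Matrix V V ℝ} {i k : V} (h : Via a F i k) :
    ∃ j, Relation.ReflTransGen (fun x y => y ∈ a ∧ F x y ≠ 0) i j ∧ F j k ≠ 0 := by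
  induction h with
  | single h => exact ⟨_, .refl, h⟩
  | cons h hm _ ih =>
    obtain ⟨j, h1, h2⟩ := ih
    exact ⟨j, .head ⟨hm, h⟩ h1, h2⟩

lemma Via.reflTransGen {a : Finset V} {F : Matrix V V ℝ} {i k : V} (h : Via a F i k)
    (hk : k ∈ a) : Relation.ReflTransGen (fun x y => y ∈ a ∧ F x y ≠ 0) i k := by
  obtain ⟨j, h1, h2⟩ := h.exists_tail
  exact h1.tail ⟨hk, h2⟩

/-- Every path through `a` splits at its first and last node in `a`. -/
lemma via_iff {a : Finset V} {F : Matrix V V ℝ} {i k : V} :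
    Via a F i k ↔ F i k ≠ 0 ∨ ∃ x y, F i x ≠ 0 ∧ x ∈ a ∧ y ∈ a ∧ (x = y ∨ Via a F x y) ∧
      F y k ≠ 0 := by
  constructor
  · intro h
    cases h with
    | single h => exact .inl h
    | @cons _ x _ h hx h' =>
      obtain ⟨y, h1, h2⟩ := h'.exists_tail
      rcases h1.cases_tail with e | ⟨z, h3, h4⟩
      · subst e; exact .inr ⟨_, _, h, hx, hx, .inl rfl, h2⟩
      · exact .inr ⟨x, y, h, hx, h4.1, .inr (.of_reflTransGen h3 hx h4.2), h2⟩
  · rintro (h | ⟨x, y, h1, hx, hy, rfl | h2, h3⟩)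
    · exact .single h
    · exact .cons h1 hx (.single h3)
    · exact .cons h1 hx (h2.trans hy (.single h3))

variable [DecidableEq V]

lemma blk_ne_zero {a b : Finset V} {F : Matrix V V ℝ} {i k : V} :
    blk a b F i k ≠ 0 ↔ i ∈ a ∧ k ∈ b ∧ F i k ≠ 0 := by
  unfold blk; split_ifs <;> simp_all

lemma blk_nonneg {F : Matrix V V ℝ} (hF : ∀ i k, 0 ≤ F i k) (a b : Finset V) (i k : V) :
    0 ≤ blk a b F i k := by
  unfold blk; split_ifs
  exacts [hF i k, le_rfl]

lemma UnitEntries.blk {F : Matrix V V ℝ} (hF : UnitEntries F) (a b : Finset V) :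
    UnitEntries (blk a b F) := by
  intro i k; unfold SummaryGraph.blk; split_ifs
  exacts [hF i k, by simp]

/-- The inverse of `(n + 1) I - F` has the zero pattern of the reflexive transitive closure. -/
lemma inv_ne_zero_iff {ι : Type*} [Fintype ι] [DecidableEq ι] (F : Matrix ι ι ℝ)
    (hF : UnitEntries F) (i k : ι) :
    (((Fintype.card ι : ℝ) + 1) • (1 : Matrix ι ι ℝ) - F)⁻¹ i k ≠ 0 ↔
      Relation.ReflTransGen (fun x y => F x y ≠ 0) i k := by
  classical
  let _ : NormedRing (Matrix ι ι ℝ) := Matrix.linftyOpNormedRing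
  let _ : NormedAlgebra ℝ (Matrix ι ι ℝ) := Matrix.linftyOpNormedAlgebra
  set n : ℝ := (Fintype.card ι : ℝ) with hn
  have hn0 : 0 < n + 1 := by positivity
  -- The row sums of `T` are at most `n / (n + 1) < 1`, so the inverse is a multiple of the Neumann
  -- series of `T`. Its terms are nonnegative, hence an entry vanishes only if it vanishes in every
  -- power, that is, if no path of any length exists.
  set T : Matrix ι ι ℝ := (n + 1)⁻¹ • F with hT
  have hTn : ∀ i k, 0 ≤ T i k := fun i k => by
    rw [hT, Matrix.smul_apply, smul_eq_mul]; exact mul_nonneg (by positivity) (hF i k).1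
  have hT0 : ∀ i k, T i k ≠ 0 ↔ F i k ≠ 0 := fun i k => by
    rw [hT, Matrix.smul_apply, smul_eq_mul]; simp [hn0.ne']
  have hnorm : ‖T‖ < 1 := by
    rw [Matrix.linfty_opNorm_def]
    have h2 : ∀ i, ∑ j, ‖T i j‖₊ ≤ Real.toNNReal (n / (n + 1)) := by
      intro i
      refine (Real.le_toNNReal_iff_coe_le (by positivity)).2 ?_
      refine (NNReal.coe_sum _ _).trans_le ?_
      calc ∑ j, ‖T i j‖ ≤ ∑ _j : ι, (n + 1)⁻¹ := by
            refine Finset.sum_le_sum fun j _ => ?_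
            rw [Real.norm_of_nonneg (hTn i j), hT, Matrix.smul_apply, smul_eq_mul]
            exact mul_le_of_le_one_right (by positivity) (hF i j).2
        _ = n / (n + 1) := by
            rw [Finset.sum_const, Finset.card_univ, nsmul_eq_mul, div_eq_mul_inv]
    refine lt_of_le_of_lt (NNReal.coe_le_coe.2 (Finset.sup_le fun i _ => h2 i)) ?_
    rw [Real.coe_toNNReal _ (by positivity)]
    rw [div_lt_one hn0]; linarith
  have hsum : Summable fun m : ℕ => T ^ m := summable_geometric_of_norm_lt_one hnorm
  have hinv : ((n + 1) • (1 : Matrix ι ι ℝ) - F)⁻¹ = (n + 1)⁻¹ • ∑' m : ℕ, T ^ m := by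
    apply Matrix.inv_eq_right_inv
    have : (n + 1) • (1 : Matrix ι ι ℝ) - F = (n + 1) • (1 - T) := by
      rw [smul_sub, hT, smul_smul, mul_inv_cancel₀ hn0.ne', one_smul]
    rw [this, smul_mul_smul_comm, mul_inv_cancel₀ hn0.ne', one_smul]
    exact mul_neg_geom_series T hnorm
  have hent : HasSum (fun m : ℕ => (T ^ m) i k) ((∑' m : ℕ, T ^ m) i k) := by
    have := hsum.hasSum
    exact (Pi.hasSum.1 ((Pi.hasSum.1 this) i)) k
  have hpow : ∀ m i k, 0 ≤ (T ^ m) i k := by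
    intro m
    induction m with
    | zero => intro i k; rw [pow_zero, Matrix.one_apply]; split_ifs <;> simp
    | succ m ih => rw [pow_succ]; exact matrix_mul_nonneg ih hTn
  rw [hinv, Matrix.smul_apply, smul_eq_mul, Ne, mul_eq_zero, not_or]
  have h1 : (∑' m : ℕ, T ^ m) i k = 0 ↔ ∀ m, (T ^ m) i k = 0 := by
    constructor
    · intro h m
      rw [h] at hent
      exact congrFun ((hasSum_zero_iff_of_nonneg fun m => hpow m i k).1 hent) m
    · intro h
      exact hent.unique (by simp [h, hasSum_zero])
  rw [h1]
  constructor
  · rintro ⟨-, h⟩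
    push Not at h
    obtain ⟨m, hm⟩ := h
    clear h1 hent
    induction m generalizing k with
    | zero =>
      rw [pow_zero, Matrix.one_apply] at hm
      split_ifs at hm with h
      · rw [h]
      · simp at hm
    | succ m ih =>
      rw [pow_succ, matrix_mul_ne_zero (hpow m) hTn] at hm
      obtain ⟨j, h1, h2⟩ := hm
      exact (ih j h1).tail ((hT0 _ _).1 h2)
  · intro h
    refine ⟨by simp [hn0.ne'], ?_⟩
    push Not
    clear h1 hent
    induction h with
    | refl => exact ⟨0, by simp⟩
    | tail _ hjk ih =>
      obtain ⟨m, hm⟩ := ih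
      exact ⟨m + 1, by
        rw [pow_succ, matrix_mul_ne_zero (hpow m) hTn]; exact ⟨_, hm, (hT0 _ _).2 hjk⟩⟩

/-- The relation asks only the target of each step to be in `a`, so membership of the starting node
is recorded separately. -/
lemma clo_ne_zero {a : Finset V} {F : Matrix V V ℝ} (hF : UnitEntries F) {i k : V} :
    clo a F i k ≠ 0 ↔
      i ∈ a ∧ Relation.ReflTransGen (fun x y => y ∈ a ∧ F x y ≠ 0) i k := by
  unfold clo
  have key := fun (i k : {x // x ∈ a}) => inv_ne_zero_iff
    (F.submatrix (Subtype.val : {x // x ∈ a} → V) Subtype.val) (fun i k => hF _ _) i k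
  rw [Fintype.card_coe] at key
  constructor
  · intro h
    split_ifs at h with hik
    · rw [ind_ne_zero, key] at h
      exact ⟨hik.1, h.lift Subtype.val fun x y hxy => ⟨y.2, hxy⟩⟩
    · simp at h
  · rintro ⟨hi, h⟩
    have hk : k ∈ a := by
      cases h with
      | refl => exact hi
      | tail _ h => exact h.1
    rw [dif_pos ⟨hi, hk⟩, ind_ne_zero, key]
    induction h with
    | refl => exact .refl
    | @tail b c hb hc ih =>
      have hb' : b ∈ a := by
        cases hb with
        | refl => exact hi
        | tail _ h => exact h.1
      exact (ih hb').tail hc.2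

lemma clo_nonneg (a : Finset V) (F : Matrix V V ℝ) (i k : V) : 0 ≤ clo a F i k := by
  unfold clo; split_ifs
  exacts [(unitEntries_ind _ _ _).1, le_rfl]

lemma clo_ne_zero' {a : Finset V} {F : Matrix V V ℝ} (hF : UnitEntries F) {i k : V} :
    clo a F i k ≠ 0 ↔ i ∈ a ∧ k ∈ a ∧ (i = k ∨ Via a F i k) := by
  rw [clo_ne_zero hF]
  constructor
  · rintro ⟨hi, h⟩
    rcases h.cases_tail with h | ⟨j, h1, h2⟩
    · subst h; exact ⟨hi, hi, .inl rfl⟩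
    · exact ⟨hi, h2.1, .inr (.of_reflTransGen h1 hi h2.2)⟩
  · rintro ⟨hi, hk, h | h⟩
    · subst h; exact ⟨hi, .refl⟩
    · exact ⟨hi, h.reflTransGen hk⟩

variable [Fintype V]

lemma margin_ne_zero {a : Finset V} {F : Matrix V V ℝ} (hF : UnitEntries F) {i k : V} :
    margin a F i k ≠ 0 ↔ i ∉ a ∧ k ∉ a ∧ Via a F i k := by
  have hb := fun a b => blk_nonneg hF.nonneg a b
  unfold margin
  rw [ind_ne_zero, matrix_add_ne_zero (hb _ _)
      (matrix_mul_nonneg (matrix_mul_nonneg (hb _ _) (clo_nonneg a F)) (hb _ _)),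
    matrix_mul_ne_zero (matrix_mul_nonneg (hb _ _) (clo_nonneg a F)) (hb _ _), via_iff]
  simp only [matrix_mul_ne_zero (hb _ _) (clo_nonneg a F), blk_ne_zero, clo_ne_zero' hF,
    Finset.mem_compl]
  constructor
  · rintro (⟨h1, h2, h3⟩ | ⟨y, ⟨x, ⟨hi, hx, h1⟩, _, hy, h2⟩, _, hk, h3⟩)
    · exact ⟨h1, h2, .inl h3⟩
    · exact ⟨hi, hk, .inr ⟨x, y, h1, hx, hy, h2, h3⟩⟩
  · rintro ⟨hi, hk, h | ⟨x, y, h1, hx, hy, h2, h3⟩⟩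
    · exact .inl ⟨hi, hk, h⟩
    · exact .inr ⟨y, ⟨x, ⟨hi, hx, h1⟩, hx, hy, h2⟩, hy, hk, h3⟩

lemma unitEntries_zer (a : Finset V) (F : Matrix V V ℝ) : UnitEntries (zer a F) :=
  unitEntries_ind _

/-- The zero pattern of the partial closure. -/
lemma zer_ne_zero {a : Finset V} {F : Matrix V V ℝ} (hF : UnitEntries F) {i k : V} :
    zer a F i k ≠ 0 ↔ (i = k ∧ i ∈ a) ∨ Via a F i k := by
  have hb := fun a b => blk_nonneg hF.nonneg a b
  have hc := clo_nonneg a F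
  have hm : ∀ i k, 0 ≤ margin a F i k := (unitEntries_ind _).nonneg
  unfold zer
  rw [ind_ne_zero, matrix_add_ne_zero (matrix_add_nonneg (matrix_add_nonneg hc
      (matrix_mul_nonneg hc (hb _ _))) (matrix_mul_nonneg (hb _ _) hc)) hm,
    matrix_add_ne_zero (matrix_add_nonneg hc
      (matrix_mul_nonneg hc (hb _ _))) (matrix_mul_nonneg (hb _ _) hc),
    matrix_add_ne_zero hc (matrix_mul_nonneg hc (hb _ _)),
    matrix_mul_ne_zero hc (hb _ _), matrix_mul_ne_zero (hb _ _) hc, margin_ne_zero hF]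
  simp only [blk_ne_zero, clo_ne_zero' hF, Finset.mem_compl]
  constructor
  · rintro (((⟨hi, hk, h⟩ | ⟨j, ⟨hi, hj, h⟩, _, hk, h'⟩) | ⟨j, ⟨hi, hj, h⟩, _, hk, h'⟩) |
      ⟨hi, hk, h⟩)
    · rcases h with h | h
      exacts [.inl ⟨h, hi⟩, .inr h]
    · rcases h with rfl | h
      exacts [.inr (.single h'), .inr (h.trans hj (.single h'))]
    · rcases h' with rfl | h'
      exacts [.inr (.single h), .inr (.cons h hj h')]
    · exact .inr h
  · rintro (⟨rfl, hi⟩ | h)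
    · exact .inl (.inl (.inl ⟨hi, hi, .inl rfl⟩))
    -- The positions of the two end nodes select one of the four blocks. A path is split at its last
    -- node in `a` when it ends outside `a`, and after its first step when it starts outside.
    by_cases hi : i ∈ a <;> by_cases hk : k ∈ a
    · exact .inl (.inl (.inl ⟨hi, hk, .inr h⟩))
    · refine .inl (.inl (.inr ?_))
      obtain ⟨j, h1, h2⟩ := h.exists_tail
      obtain ⟨-, hj, h3⟩ := (clo_ne_zero' hF).1 ((clo_ne_zero hF).2 ⟨hi, h1⟩)
      exact ⟨j, ⟨hi, hj, h3⟩, hj, hk, h2⟩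
    · refine .inl (.inr ?_)
      cases h with
      | single h => exact ⟨k, ⟨hi, hk, h⟩, hk, hk, .inl rfl⟩
      | cons h hj h' => exact ⟨_, ⟨hi, hj, h⟩, hj, hk, .inr h'⟩
    · exact .inr ⟨hi, hk, h⟩

end Pattern

/-! ### Walks with marks at their end nodes -/

section Walk

variable {V : Type*}

/-- Two pieces of a walk with marks `b` and `c` at their common node `y` (`true` for an arrowhead)
may be joined: a collider has to lie in `Y`, any other node in `X`. -/
def Joint (X Y : Set V) (y : V) : Bool → Bool → Prop
  | true, true => y ∈ Y
  | true, false => y ∈ X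
  | false, _ => y ∈ X

/-- Walks composed of pieces that are given by `base`; `GWalk base X Y i a j b` leads from `i` with
mark `a` to `j` with mark `b`. -/
inductive GWalk (base : V → Bool → V → Bool → Prop) (X Y : Set V) : V → Bool → V → Bool → Prop
  | single {i a j b} : base i a j b → GWalk base X Y i a j b
  | cons {i a y b c j d} : base i a y b → Joint X Y y b c → GWalk base X Y y c j d →
      GWalk base X Y i a j d

/-- A single arrow as a piece of a walk; `E x y` stands for `x ← y`. -/
def Edge (E : V → V → Prop) (i : V) (a : Bool) (j : V) (b : Bool) : Prop :=
  (a = true ∧ b = false ∧ E i j) ∨ (a = false ∧ b = true ∧ E j i)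

/-- Walks along arrows. -/
abbrev Walk (E : V → V → Prop) (X Y : Set V) := GWalk (Edge E) X Y

lemma Joint.symm {X Y : Set V} {y : V} {b c : Bool} (h : Joint X Y y b c) : Joint X Y y c b := by
  cases b <;> cases c <;> exact h

lemma Joint.mono {X Y X' Y' : Set V} (hX : X ⊆ X') (hY : Y ⊆ Y') {y : V} {b c : Bool}
    (h : Joint X Y y b c) : Joint X' Y' y b c := by
  cases b <;> cases c
  exacts [hX h, hX h, hX h, hY h]

lemma Joint.of_mem {X Y : Set V} {y : V} (hX : y ∈ X) (hY : y ∈ Y) (b c : Bool) :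
    Joint X Y y b c := by
  cases b <;> cases c
  exacts [hX, hX, hX, hY]

lemma Joint.union {X Y X' Y' : Set V} {y : V} {b c : Bool}
    (h : Joint (X ∪ X') (Y ∪ Y') y b c) : Joint X Y y b c ∨ Joint X' Y' y b c := by
  cases b <;> cases c <;> exact h

variable {base : V → Bool → V → Bool → Prop} {X Y : Set V}

lemma GWalk.trans {i y j : V} {a b c d : Bool} (h : GWalk base X Y i a y b)
    (hy : Joint X Y y b c) (h' : GWalk base X Y y c j d) : GWalk base X Y i a j d := by
  induction h with
  | single h => exact .cons h hy h'
  | cons h hm _ ih => exact .cons h hm (ih hy h')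

lemma GWalk.symm (hb : ∀ i a j b, base i a j b → base j b i a) {i j : V} {a b : Bool}
    (h : GWalk base X Y i a j b) : GWalk base X Y j b i a := by
  induction h with
  | single h => exact .single (hb _ _ _ _ h)
  | cons h hm _ ih => exact ih.trans hm.symm (.single (hb _ _ _ _ h))

lemma GWalk.mono {base' : V → Bool → V → Bool → Prop} {X' Y' : Set V}
    (hb : ∀ i a j b, base i a j b → base' i a j b) (hX : X ⊆ X') (hY : Y ⊆ Y') {i j : V}
    {a b : Bool} (h : GWalk base X Y i a j b) : GWalk base' X' Y' i a j b := by
  induction h with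
  | single h => exact .single (hb _ _ _ _ h)
  | cons h hm _ ih => exact .cons (hb _ _ _ _ h) (hm.mono hX hY) ih

/-- Together with `GWalk.group` this makes walks composed of walks the same as walks with a larger
supply of admissible joints, which is how successive marginalising and conditioning compose. -/
lemma GWalk.flatten {X' Y' : Set V} {i j : V} {a b : Bool}
    (h : GWalk (GWalk base X Y) X' Y' i a j b) : GWalk base (X ∪ X') (Y ∪ Y') i a j b := by
  induction h with
  | single h => exact h.mono (fun _ _ _ _ => id) Set.subset_union_left Set.subset_union_left
  | cons h hm _ ih =>
    exact GWalk.trans (h.mono (fun _ _ _ _ => id) Set.subset_union_left Set.subset_union_left)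
      (hm.mono Set.subset_union_right Set.subset_union_right) ih

/-- Each joint of the long walk is admissible for `X`, `Y` or for `X'`, `Y'`. Joints of the first
kind are absorbed into the current piece, and the walk is cut at the others. -/
lemma GWalk.group {X' Y' : Set V} {i j : V} {a b : Bool}
    (h : GWalk base (X ∪ X') (Y ∪ Y') i a j b) : GWalk (GWalk base X Y) X' Y' i a j b := by
  induction h with
  | single h => exact .single (.single h)
  | cons h hm _ ih =>
    rcases hm.union with hm | hm
    · cases ih with
      | single h' => exact .single (.cons h hm h')
      | cons h' hm' h'' => exact .cons (.cons h hm h') hm' h''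
    · exact .cons (.single h) hm ih

variable {E : V → V → Prop}

lemma Edge.symm {i j : V} {a b : Bool} (h : Edge E i a j b) : Edge E j b i a := by
  rcases h with ⟨rfl, rfl, h⟩ | ⟨rfl, rfl, h⟩
  exacts [.inr ⟨rfl, rfl, h⟩, .inl ⟨rfl, rfl, h⟩]

lemma Walk.symm {i j : V} {a b : Bool} (h : Walk E X Y i a j b) : Walk E X Y j b i a :=
  GWalk.symm (fun _ _ _ _ => Edge.symm) h

/-- The nodes in `s` and their ancestors. -/
def An (E : V → V → Prop) (s : Set V) : Set V := {x | ∃ c ∈ s, Relation.ReflTransGen E c x}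

lemma subset_An (s : Set V) : s ⊆ An E s := fun x hx => ⟨x, hx, .refl⟩

lemma An_mono {s t : Set V} (h : s ⊆ t) : An E s ⊆ An E t := fun _ ⟨c, hc, h'⟩ => ⟨c, h hc, h'⟩

lemma An_union (s t : Set V) : An E (s ∪ t) = An E s ∪ An E t := by
  ext x
  constructor
  · rintro ⟨c, hc | hc, h⟩
    exacts [.inl ⟨c, hc, h⟩, .inr ⟨c, hc, h⟩]
  · rintro (⟨c, hc, h⟩ | ⟨c, hc, h⟩)
    exacts [⟨c, .inl hc, h⟩, ⟨c, .inr hc, h⟩]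

lemma An_of_reflTransGen {s : Set V} {x y : V} (hx : x ∈ An E s)
    (h : Relation.ReflTransGen E x y) : y ∈ An E s := by
  obtain ⟨c, hc, h'⟩ := hx
  exact ⟨c, hc, h'.trans h⟩

/-- A directed path leads from the node through `X` into `Y`. -/
inductive Drop (E : V → V → Prop) (X Y : Set V) : V → Prop
  | base {y} : y ∈ Y → Drop E X Y y
  | step {y z} : y ∈ X → E z y → Drop E X Y z → Drop E X Y y

/-- The collider `y` is replaced by a detour: down the directed path into `Y` and back. The nodes
passed on the way are non-colliders in `X`, and the turning point is a collider in `Y`. -/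
lemma Drop.join {y : V} (hy : Drop E X Y y) {i j : V} {a b : Bool}
    (h : Walk E X Y i a y true) (h' : Walk E X Y y true j b) : Walk E X Y i a j b := by
  induction hy with
  | base hy => exact h.trans (c := true) hy h'
  | @step y z hy hz _ ih =>
    exact ih (h.trans (c := false) hy (.single (.inr ⟨rfl, rfl, hz⟩)))
      (.cons (.inl ⟨rfl, rfl, hz⟩) (c := true) hy h')

lemma Walk.reroute {Y' : Set V} (hY : ∀ y ∈ Y', Drop E X Y y) {i j : V} {a b : Bool}
    (h : Walk E X Y' i a j b) : Walk E X Y i a j b := by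
  induction h with
  | single h => exact .single h
  | @cons i a y b c j d h hm _ ih =>
    cases b with
    | false => exact .cons h (by cases c <;> exact hm) ih
    | true =>
      cases c with
      | false => exact .cons h (show Joint X Y y true false from hm) ih
      | true => exact (hY y hm).join (.single h) ih

/-- The directed path down to `s` is stopped at the first node of `s` that it meets, so that its
earlier nodes avoid `s`. -/
lemma drop_of_mem_An {s : Set V} {y : V} (h : y ∈ An E s) : Drop E sᶜ s y := by
  obtain ⟨c, hc, h⟩ := h
  induction h with
  | refl => exact .base hc
  | @tail z y _ hzy ih =>
    by_cases hy : y ∈ s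
    · exact .base hy
    · exact .step hy hzy ih

/-- Colliders of connecting walks may be taken in the conditioning set or among its ancestors. -/
lemma walk_iff_of_subset_An {s t : Set V} (hst : s ⊆ t) (ht : t ⊆ An E s) {i j : V} {a b : Bool} :
    Walk E sᶜ s i a j b ↔ Walk E sᶜ t i a j b :=
  ⟨GWalk.mono (fun _ _ _ _ => id) subset_rfl hst, Walk.reroute fun _ hy => drop_of_mem_An (ht hy)⟩

/-- A walk that leaves a node outside of the collider set against the direction of arrows is
directed. -/
lemma Walk.of_tail (hY : ∀ x y, E x y → x ∈ Y → y ∈ Y) {i j : V} {a b : Bool}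
    (h : Walk E X Y i a j b) (hi : i ∉ Y) (ha : a = false) :
    b = true ∧ Relation.TransGen E j i := by
  induction h with
  | single h =>
    rcases h with ⟨rfl, rfl, h⟩ | ⟨rfl, rfl, h⟩
    · simp at ha
    · exact ⟨rfl, .single h⟩
  | @cons i a y b c j d h hm _ ih =>
    rcases h with ⟨rfl, rfl, h⟩ | ⟨rfl, rfl, h⟩
    · simp at ha
    · have hy : y ∉ Y := fun hy => hi (hY _ _ h hy)
      have hc : c = false := by
        cases c with
        | false => rfl
        | true => exact absurd hm hy
      obtain ⟨h1, h2⟩ := ih hy hc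
      exact ⟨h1, h2.tail h⟩

/-- `i` and `j` are connected given `s`. -/
def Conn (E : V → V → Prop) (s : Set V) (i j : V) : Prop := ∃ a b, Walk E sᶜ s i a j b

lemma Conn.symm {s : Set V} {i j : V} (h : Conn E s i j) : Conn E s j i := by
  obtain ⟨a, b, h⟩ := h
  exact ⟨b, a, h.symm⟩

end Walk

/-! ### Summary graphs and walks of the parent graph -/

section Represents

variable {V : Type*}

/-- The walks that are summarised after conditioning on `C` and marginalising over `M`. -/
abbrev CWalk (E : V → V → Prop) (C M : Finset V) := Walk E (M : Set V) (An E (C : Set V))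

/-- The edges of the summary graph `G` are the walks of the parent graph whose inner nodes are
colliders among the ancestors of `C`, or else are in `M`. -/
structure Represents (E : V → V → Prop) (C M : Finset V) (G : Graph V) : Prop where
  disj : Disjoint C M
  mem_u : ∀ i, i ∈ G.u ↔ i ∉ An E (C : Set V) ∧ i ∉ M
  mem_v : ∀ i, i ∈ G.v ↔ i ∈ An E (C : Set V) ∧ i ∉ C ∧ i ∉ M
  unit_H : UnitEntries G.H
  unit_W : UnitEntries G.W
  unit_S : UnitEntries G.S
  H_ne : ∀ i j, G.H i j ≠ 0 ↔ i ∈ G.u ∧ ((j ∈ G.u ∧ (i = j ∨ CWalk E C M i true j false)) ∨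
    (j ∈ G.v ∧ ∃ b, CWalk E C M i true j b))
  W_ne : ∀ i j, G.W i j ≠ 0 ↔ i ∈ G.u ∧ j ∈ G.u ∧ (i = j ∨ CWalk E C M i true j true)
  S_ne : ∀ i j, G.S i j ≠ 0 ↔ i ∈ G.v ∧ j ∈ G.v ∧ (i = j ∨ ∃ a b, CWalk E C M i a j b)

variable {E : V → V → Prop} {C M : Finset V} {G : Graph V}

namespace Represents

lemma not_mem_v (s : Represents E C M G) {x : V} (hx : x ∈ G.u) : x ∉ G.v := fun h =>
  ((s.mem_u x).1 hx).1 ((s.mem_v x).1 h).1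

lemma An_parent {s : Set V} (x y : V) (h : E x y) (hx : x ∈ An E s) : y ∈ An E s :=
  An_of_reflTransGen hx (.single h)

lemma of_tail {x y : V} {b : Bool} (h : CWalk E C M x false y b)
    (hx : x ∉ An E (C : Set V)) : b = true ∧ Relation.TransGen E y x :=
  Walk.of_tail An_parent h hx rfl

lemma of_head_tail {x y : V} {a : Bool} (h : CWalk E C M x a y false)
    (hy : y ∉ An E (C : Set V)) : a = true ∧ Relation.TransGen E x y :=
  of_tail (Walk.symm h) hy

lemma An_of_transGen {s : Set V} {x y : V} (h : Relation.TransGen E x y) (hx : x ∈ An E s) :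
    y ∈ An E s :=
  An_of_reflTransGen hx h.to_reflTransGen

/-- Between nodes of the summary graph, the walks are its edges. -/
lemma edge_cases (s : Represents E C M G) {x y : V} {c b : Bool} (h : CWalk E C M x c y b)
    (hx : x ∈ G.u ∨ x ∈ G.v) (hy : y ∈ G.u ∨ y ∈ G.v) :
    (x ∈ G.u ∧ y ∈ G.u ∧ c = true ∧ b = true ∧ G.W x y ≠ 0) ∨
    (x ∈ G.u ∧ y ∈ G.u ∧ c = true ∧ b = false ∧ G.H x y ≠ 0) ∨
    (x ∈ G.u ∧ y ∈ G.u ∧ c = false ∧ b = true ∧ G.H y x ≠ 0) ∨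
    (x ∈ G.u ∧ y ∈ G.v ∧ c = true ∧ G.H x y ≠ 0) ∨
    (x ∈ G.v ∧ y ∈ G.u ∧ b = true ∧ G.H y x ≠ 0) ∨
    (x ∈ G.v ∧ y ∈ G.v ∧ G.S x y ≠ 0) := by
  rcases hx with hx | hx <;> rcases hy with hy | hy
  · have hx' := ((s.mem_u x).1 hx).1
    have hy' := ((s.mem_u y).1 hy).1
    cases c with
    | true =>
      cases b with
      | true => exact .inl ⟨hx, hy, rfl, rfl, (s.W_ne x y).2 ⟨hx, hy, .inr h⟩⟩
      | false => exact .inr (.inl ⟨hx, hy, rfl, rfl, (s.H_ne x y).2 ⟨hx, .inl ⟨hy, .inr h⟩⟩⟩)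
    | false =>
      obtain rfl := (of_tail h hx').1
      exact .inr (.inr (.inl
        ⟨hx, hy, rfl, rfl, (s.H_ne y x).2 ⟨hy, .inl ⟨hx, .inr (Walk.symm h)⟩⟩⟩))
  · refine .inr (.inr (.inr (.inl ?_)))
    cases c with
    | true => exact ⟨hx, hy, rfl, (s.H_ne x y).2 ⟨hx, .inr ⟨hy, b, h⟩⟩⟩
    | false =>
      exact absurd (An_of_transGen (of_tail h ((s.mem_u x).1 hx).1).2 ((s.mem_v y).1 hy).1)
        ((s.mem_u x).1 hx).1
  · refine .inr (.inr (.inr (.inr (.inl ?_))))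
    cases b with
    | true => exact ⟨hx, hy, rfl, (s.H_ne y x).2 ⟨hy, .inr ⟨hx, c, Walk.symm h⟩⟩⟩
    | false =>
      exact absurd (An_of_transGen (of_head_tail h ((s.mem_u y).1 hy).1).2 ((s.mem_v x).1 hx).1)
        ((s.mem_u y).1 hy).1
  · exact .inr (.inr (.inr (.inr (.inr ⟨hx, hy, (s.S_ne x y).2 ⟨hx, hy, .inr ⟨c, b, h⟩⟩⟩))))

lemma H_refl (s : Represents E C M G) {x : V} (hx : x ∈ G.u) : G.H x x ≠ 0 :=
  (s.H_ne x x).2 ⟨hx, .inl ⟨hx, .inl rfl⟩⟩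

lemma W_refl (s : Represents E C M G) {x : V} (hx : x ∈ G.u) : G.W x x ≠ 0 :=
  (s.W_ne x x).2 ⟨hx, hx, .inl rfl⟩

lemma S_refl (s : Represents E C M G) {x : V} (hx : x ∈ G.v) : G.S x x ≠ 0 :=
  (s.S_ne x x).2 ⟨hx, hx, .inl rfl⟩

lemma W_symm (s : Represents E C M G) (x y : V) (h : G.W x y ≠ 0) : G.W y x ≠ 0 := by
  obtain ⟨hx, hy, h⟩ := (s.W_ne x y).1 h
  exact (s.W_ne y x).2 ⟨hy, hx, h.imp Eq.symm Walk.symm⟩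

lemma S_symm (s : Represents E C M G) (x y : V) (h : G.S x y ≠ 0) : G.S y x ≠ 0 := by
  obtain ⟨hx, hy, h⟩ := (s.S_ne x y).1 h
  exact (s.S_ne y x).2 ⟨hy, hx, h.imp Eq.symm fun ⟨a, b, h⟩ => ⟨b, a, h.symm⟩⟩

/-- The tail node of an arrow within `u` is no ancestor of `C`, so by `of_head_tail` the represented
walk has no colliders and is a directed path. -/
lemma reflTransGen_of_H (s : Represents E C M G) {x y : V} (h : G.H x y ≠ 0) (hy : y ∈ G.u) :
    Relation.ReflTransGen E x y := by
  obtain ⟨-, ⟨-, h⟩ | ⟨h, -⟩⟩ := (s.H_ne x y).1 h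
  · rcases h with rfl | h
    · exact .refl
    · exact (of_head_tail h ((s.mem_u y).1 hy).1).2.to_reflTransGen
  · exact absurd h (s.not_mem_v hy)

variable [Fintype V]

/-- The ancestors within `u` are those of the parent graph. -/
lemma mem_anc (s : Represents E C M G) (hE : ∀ x, ¬ Relation.TransGen E x x) {x y : V}
    (hx : x ∈ G.u) (hy : y ∈ G.u) : y ∈ anc G.H x ↔ Relation.TransGen E x y := by
  simp only [anc, Finset.mem_filter, Finset.mem_univ, true_and]
  constructor
  · intro h
    induction h with
    | single h =>
      exact (Relation.reflTransGen_iff_eq_or_transGen.1 (s.reflTransGen_of_H h.2 hy)).resolve_left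
        (Ne.symm h.1)
    | tail _ h ih => exact (ih ((s.H_ne _ _).1 h.2).1).trans_left (s.reflTransGen_of_H h.2 hy)
  · intro h
    have step : ∀ {z w : V}, z ∈ G.u → w ∈ G.u → CWalk E C M z true w false →
        Arrow G.H z w := by
      intro z w hz hw h
      refine ⟨?_, (s.H_ne z w).2 ⟨hz, .inl ⟨hw, .inr h⟩⟩⟩
      rintro rfl
      exact hE _ (of_head_tail h ((s.mem_u _).1 hz).1).2
    -- While a directed path runs through `M`, its arrows are collected into one walk that starts at
    -- the last node `z` of `u`. On reaching a node outside `M`, which then belongs to `u`, this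
    -- walk becomes a single arrow of `G`.
    have key : ∀ y, Relation.TransGen E x y → y ∉ An E (C : Set V) →
        (y ∈ G.u → Relation.TransGen (Arrow G.H) x y) ∧
        (y ∈ M → ∃ z ∈ G.u, Relation.ReflTransGen (Arrow G.H) x z ∧
          CWalk E C M z true y false) := by
      intro y h
      induction h with
      | single h =>
        intro _
        have hw : CWalk E C M x true _ false := .single (.inl ⟨rfl, rfl, h⟩)
        exact ⟨fun hy => .single (step hx hy hw), fun _ => ⟨x, hx, .refl, hw⟩⟩
      | @tail b y _ h ih =>
        intro hy
        have hb : b ∉ An E (C : Set V) := fun hb => hy (An_parent _ _ h hb)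
        obtain ⟨ih1, ih2⟩ := ih hb
        have hw : CWalk E C M b true y false := .single (.inl ⟨rfl, rfl, h⟩)
        have : ∃ z ∈ G.u, Relation.ReflTransGen (Arrow G.H) x z ∧
            CWalk E C M z true y false := by
          by_cases hbM : b ∈ M
          · obtain ⟨z, hz, h1, h2⟩ := ih2 hbM
            exact ⟨z, hz, h1, h2.trans (c := true) (by exact hbM) hw⟩
          · exact ⟨b, (s.mem_u b).2 ⟨hb, hbM⟩,
              (ih1 ((s.mem_u b).2 ⟨hb, hbM⟩)).to_reflTransGen, hw⟩
        obtain ⟨z, hz, h1, h2⟩ := this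
        exact ⟨fun hyu => Relation.TransGen.tail' h1 (step hz hyu h2), fun _ => ⟨z, hz, h1, h2⟩⟩
    exact (key y h ((s.mem_u y).1 hy).1).1 hy

end Represents

end Represents

/-! ### Additional conditioning and marginalising -/

section Step

variable {V : Type*} [Fintype V] [DecidableEq V]

namespace Graph

/-- The nodes in `c ∩ u` and their ancestors within `u`. -/
def newAn (G : Graph V) (c : Finset V) : Finset V := c ∩ G.u ∪ foster G.H (c ∩ G.u) ∩ G.u

/-- The nodes of `u` that remain in `u` or are marginalised over. -/
def rest (G : Graph V) (c : Finset V) : Finset V := G.u \ G.newAn c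

/-- The nodes to which full lines may be attached before marginalising. -/
def full (G : Graph V) (c : Finset V) : Finset V := (G.newAn c ∪ G.v) \ c

/-- Dashed lines after closing paths with inner collider nodes in `newAn`. -/
def dashed (G : Graph V) (c : Finset V) : Matrix V V ℝ := zer (G.newAn c) G.W

/-- Arrows into `rest` from `newAn ∪ v`. -/
def arrows (G : Graph V) (c : Finset V) : Matrix V V ℝ :=
  ind (blk (G.rest c) (G.newAn c ∪ G.v) G.H
    + blk (G.rest c) (G.newAn c) (G.dashed c) * blk (G.newAn c) (G.newAn c ∪ G.v) G.H)

/-- Full lines within `newAn ∪ v`. -/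
def lines (G : Graph V) (c : Finset V) : Matrix V V ℝ :=
  ind ((blk (G.newAn c) (G.newAn c ∪ G.v) G.H).transpose *
    blk (G.newAn c) (G.newAn c) (G.dashed c) * blk (G.newAn c) (G.newAn c ∪ G.v) G.H
      + blk G.v G.v G.S)

/-- Arrows and full lines before marginalising. -/
def joined (G : Graph V) (c : Finset V) : Matrix V V ℝ :=
  blk (G.rest c) (G.rest c) G.H + blk (G.rest c) (G.full c) (G.arrows c)
    + blk (G.full c) (G.full c) (G.lines c)

/-- Gives the local sets and matrices of the construction names of their own, so that their zero
patterns can be determined one at a time. -/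
lemma condMarg_eq (G : Graph V) (c m : Finset V) :
    G.condMarg c m =
      let o := G.rest c
      let h := m ∩ o
      let l := m \ h
      let u := o \ h
      let φ := G.full c
      let v := φ \ l
      let Q := G.dashed c
      let K := zer (h ∪ l) (G.joined c)
      let Z := zer l (blk φ φ (G.lines c))
      { u := u
        v := v
        H := blk u u K + blk u v K
        W := ind ((blk u u Q + blk u h Q * (blk u h K).transpose + blk u h K * blk h u Q
                + blk u h K * blk h h Q * (blk u h K).transpose)
              + blk u l K * blk l l Z * (blk u l K).transpose)
        S := blk v v Z } := rfl

end Graph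

variable {E : V → V → Prop} {C M : Finset V} {G : Graph V}

namespace Represents

/-- The data of an additional conditioning and marginalising step. -/
structure StepData (E : V → V → Prop) (C M : Finset V) (G : Graph V) (c m : Finset V) : Prop where
  rep : Represents E C M G
  acyclic : ∀ x, ¬ Relation.TransGen E x x
  hc : c ⊆ G.u ∪ G.v
  hm : m ⊆ G.u ∪ G.v
  hcm : Disjoint c m

variable {c m : Finset V}

namespace StepData

/-- A node of `c` in `v` is an ancestor of `C` already, hence so are all its own ancestors, and none
of them is in `u`. Only `c ∩ u` contributes. -/
lemma mem_newAn (s : StepData E C M G c m) {x : V} :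
    x ∈ G.newAn c ↔ x ∈ G.u ∧ x ∈ An E (c : Set V) := by
  simp only [Graph.newAn, foster, Finset.mem_union, Finset.mem_inter, Finset.mem_sdiff,
    Finset.mem_biUnion]
  constructor
  · rintro (⟨h1, h2⟩ | ⟨⟨⟨k, ⟨hk, hk'⟩, h⟩, -⟩, hx⟩)
    · exact ⟨h2, subset_An _ h1⟩
    · exact ⟨hx, k, hk, ((s.rep.mem_anc s.acyclic hk' hx).1 h).to_reflTransGen⟩
  · rintro ⟨hx, k, hk, h⟩
    by_cases hxc : x ∈ c
    · exact .inl ⟨hxc, hx⟩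
    · refine .inr ⟨⟨⟨k, ?_, ?_⟩, fun h => hxc h.1⟩, hx⟩
      · refine ⟨hk, (Finset.mem_union.1 (s.hc hk)).resolve_right fun hkv => ?_⟩
        exact ((s.rep.mem_u x).1 hx).1 (An_of_reflTransGen ((s.rep.mem_v k).1 hkv).1 h)
      · have hk' : k ∈ G.u := (Finset.mem_union.1 (s.hc hk)).resolve_right fun hkv =>
          ((s.rep.mem_u x).1 hx).1 (An_of_reflTransGen ((s.rep.mem_v k).1 hkv).1 h)
        refine (s.rep.mem_anc s.acyclic hk' hx).2 ?_
        rcases Relation.reflTransGen_iff_eq_or_transGen.1 h with rfl | h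
        · exact absurd hk hxc
        · exact h

lemma newAn_subset (s : StepData E C M G c m) {x : V} (h : x ∈ G.newAn c) : x ∈ G.u :=
  (s.mem_newAn.1 h).1

lemma mem_rest {x : V} : x ∈ G.rest c ↔ x ∈ G.u ∧ x ∉ G.newAn c := Finset.mem_sdiff

lemma mem_full {x : V} : x ∈ G.full c ↔ (x ∈ G.newAn c ∨ x ∈ G.v) ∧ x ∉ c := by
  simp [Graph.full]

lemma rest_disj (s : StepData E C M G c m) {x : V} (h : x ∈ G.rest c) :
    ¬ (x ∈ G.newAn c ∨ x ∈ G.v) := by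
  rintro (h' | h')
  · exact (mem_rest.1 h).2 h'
  · exact s.rep.not_mem_v (mem_rest.1 h).1 h'

/-- The three blocks have disjoint supports because `rest` and `full` are disjoint, so adding them
does not produce entries above one. The bound is what the Neumann series behind `zer` requires. -/
lemma unitEntries_joined (s : StepData E C M G c m) : UnitEntries (G.joined c) := by
  intro i k
  have h1 := s.rep.unit_H i k
  have h2 := unitEntries_ind (blk (G.rest c) (G.newAn c ∪ G.v) G.H
    + blk (G.rest c) (G.newAn c) (G.dashed c) * blk (G.newAn c) (G.newAn c ∪ G.v) G.H) i k
  have h3 : UnitEntries (G.lines c) := unitEntries_ind _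
  have h3 := h3 i k
  have d1 : i ∈ G.rest c → i ∉ G.full c := fun h h' => s.rest_disj h (mem_full.1 h').1
  have d2 : k ∈ G.rest c → k ∉ G.full c := fun h h' => s.rest_disj h (mem_full.1 h').1
  simp only [Graph.joined, Matrix.add_apply, blk]
  change 0 ≤ G.arrows c i k ∧ G.arrows c i k ≤ 1 at h2
  by_cases a : i ∈ G.rest c <;> by_cases b : k ∈ G.rest c <;> by_cases e : i ∈ G.full c <;>
    by_cases f : k ∈ G.full c <;> simp_all

/-- The diagonal of `W` is non-zero on `u`, which absorbs the identity added by the closure. -/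
lemma dashed_ne (s : StepData E C M G c m) {x y : V} :
    G.dashed c x y ≠ 0 ↔ Via (G.newAn c) G.W x y := by
  rw [Graph.dashed, zer_ne_zero s.rep.unit_W, or_iff_right_of_imp]
  rintro ⟨rfl, h⟩
  exact .single (s.rep.W_refl (s.newAn_subset h))

lemma dashed_nonneg (i k : V) : 0 ≤ G.dashed c i k := (unitEntries_zer _ _ _ _).1

lemma arrows_ne (s : StepData E C M G c m) {i z : V} :
    G.arrows c i z ≠ 0 ↔ i ∈ G.rest c ∧ (z ∈ G.newAn c ∨ z ∈ G.v) ∧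
      (G.H i z ≠ 0 ∨ ∃ w ∈ G.newAn c, G.dashed c i w ≠ 0 ∧ G.H w z ≠ 0) := by
  have hH := fun a b => blk_nonneg s.rep.unit_H.nonneg a b
  have hQ := fun a b => blk_nonneg (dashed_nonneg (G := G) (c := c)) a b
  rw [Graph.arrows, ind_ne_zero, matrix_add_ne_zero (hH _ _) (matrix_mul_nonneg (hQ _ _) (hH _ _)),
    matrix_mul_ne_zero (hQ _ _) (hH _ _)]
  simp only [blk_ne_zero, Finset.mem_union]
  constructor
  · rintro (⟨h1, h2, h3⟩ | ⟨w, ⟨h1, h2, h3⟩, -, h4, h5⟩)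
    exacts [⟨h1, h2, .inl h3⟩, ⟨h1, h4, .inr ⟨w, h2, h3, h5⟩⟩]
  · rintro ⟨h1, h2, h3 | ⟨w, hw, h4, h5⟩⟩
    exacts [.inl ⟨h1, h2, h3⟩, .inr ⟨w, ⟨h1, hw, h4⟩, hw, h2, h5⟩]

lemma lines_ne (s : StepData E C M G c m) {x y : V} :
    G.lines c x y ≠ 0 ↔ (x ∈ G.newAn c ∨ x ∈ G.v) ∧ (y ∈ G.newAn c ∨ y ∈ G.v) ∧
      ((∃ w ∈ G.newAn c, ∃ w' ∈ G.newAn c, G.H w x ≠ 0 ∧ G.dashed c w w' ≠ 0 ∧ G.H w' y ≠ 0) ∨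
        G.S x y ≠ 0) := by
  have hH := fun a b => blk_nonneg s.rep.unit_H.nonneg a b
  have hQ := fun a b => blk_nonneg (dashed_nonneg (G := G) (c := c)) a b
  have hT := matrix_transpose_nonneg (hH (G.newAn c) (G.newAn c ∪ G.v))
  rw [Graph.lines, ind_ne_zero, matrix_add_ne_zero (matrix_mul_nonneg
    (matrix_mul_nonneg hT (hQ _ _)) (hH _ _)) (blk_nonneg s.rep.unit_S.nonneg _ _),
    matrix_mul_ne_zero (matrix_mul_nonneg hT (hQ _ _)) (hH _ _)]
  simp only [matrix_mul_ne_zero hT (hQ _ _), Matrix.transpose_apply, blk_ne_zero, Finset.mem_union]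
  constructor
  · rintro (⟨w', ⟨w, ⟨h1, h2, h3⟩, -, h4, h5⟩, -, h6, h7⟩ | ⟨h1, h2, h3⟩)
    · exact ⟨h2, h6, .inl ⟨w, h1, w', h4, h3, h5, h7⟩⟩
    · exact ⟨.inr h1, .inr h2, .inr h3⟩
  · rintro ⟨h1, h2, ⟨w, hw, w', hw', h3, h4, h5⟩ | h3⟩
    · exact .inl ⟨w', ⟨w, ⟨hw, h1, h3⟩, hw, hw', h4⟩, hw', h2, h5⟩
    · obtain ⟨h4, h5, -⟩ := (s.rep.S_ne x y).1 h3
      exact .inr ⟨h4, h5, h3⟩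

lemma joined_ne (s : StepData E C M G c m) {x y : V} :
    G.joined c x y ≠ 0 ↔ (x ∈ G.rest c ∧ y ∈ G.rest c ∧ G.H x y ≠ 0) ∨
      (x ∈ G.rest c ∧ y ∈ G.full c ∧ G.arrows c x y ≠ 0) ∨
      (x ∈ G.full c ∧ y ∈ G.full c ∧ G.lines c x y ≠ 0) := by
  have h1 := blk_nonneg s.rep.unit_H.nonneg (G.rest c) (G.rest c)
  have h2 : ∀ i k, 0 ≤ G.arrows c i k := (unitEntries_ind _).nonneg
  have h3 : ∀ i k, 0 ≤ G.lines c i k := (unitEntries_ind _).nonneg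
  rw [Graph.joined, matrix_add_ne_zero (matrix_add_nonneg h1 (blk_nonneg h2 _ _))
    (blk_nonneg h3 _ _), matrix_add_ne_zero h1 (blk_nonneg h2 _ _)]
  simp only [blk_ne_zero, or_assoc]

lemma dashed_symm (s : StepData E C M G c m) {x y : V} (h : G.dashed c x y ≠ 0) :
    G.dashed c y x ≠ 0 :=
  s.dashed_ne.2 ((s.dashed_ne.1 h).symm s.rep.W_symm)

lemma lines_symm (s : StepData E C M G c m) {x y : V} (h : G.lines c x y ≠ 0) :
    G.lines c y x ≠ 0 := by
  obtain ⟨h1, h2, ⟨w, hw, w', hw', h3, h4, h5⟩ | h3⟩ := s.lines_ne.1 h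
  · exact s.lines_ne.2 ⟨h2, h1, .inl ⟨w', hw', w, hw, h5, s.dashed_symm h4, h3⟩⟩
  · exact s.lines_ne.2 ⟨h2, h1, .inr (s.rep.S_symm _ _ h3)⟩

lemma dashed_refl (s : StepData E C M G c m) {x : V} (h : x ∈ G.u) : G.dashed c x x ≠ 0 :=
  s.dashed_ne.2 (.single (s.rep.W_refl h))

lemma dashed_cons (s : StepData E C M G c m) {x y z : V} (h : G.W x y ≠ 0) (hy : y ∈ G.newAn c)
    (h' : G.dashed c y z ≠ 0) : G.dashed c x z ≠ 0 :=
  s.dashed_ne.2 (.cons h hy (s.dashed_ne.1 h'))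

lemma lines_refl (s : StepData E C M G c m) {x : V} (h : x ∈ G.newAn c ∨ x ∈ G.v) :
    G.lines c x x ≠ 0 := by
  refine s.lines_ne.2 ⟨h, h, ?_⟩
  rcases h with h | h
  · have hx := s.newAn_subset h
    exact .inl ⟨x, h, x, h, s.rep.H_refl hx, s.dashed_refl hx, s.rep.H_refl hx⟩
  · exact .inr (s.rep.S_refl h)

lemma joined_refl (s : StepData E C M G c m) {x : V} (h : x ∈ G.rest c ∨ x ∈ G.full c) :
    G.joined c x x ≠ 0 := by
  rcases h with h | h
  · exact s.joined_ne.2 (.inl ⟨h, h, s.rep.H_refl (mem_rest.1 h).1⟩)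
  · exact s.joined_ne.2 (.inr (.inr ⟨h, h, s.lines_refl (mem_full.1 h).1⟩))

lemma newAn_of_H (s : StepData E C M G c m) {x y : V} (h : G.H x y ≠ 0) (hx : x ∈ G.newAn c)
    (hy : y ∈ G.u) : y ∈ G.newAn c :=
  s.mem_newAn.2 ⟨hy, An_of_reflTransGen (s.mem_newAn.1 hx).2 (s.rep.reflTransGen_of_H h hy)⟩

/-- The set `newAn` contains the ancestors within `u` of its members, so no arrow points from `rest`
into `newAn`. -/
lemma rest_of_H (s : StepData E C M G c m) {x y : V} (h : G.H x y ≠ 0) (hy : y ∈ G.rest c) :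
    x ∈ G.rest c :=
  mem_rest.2 ⟨((s.rep.H_ne x y).1 h).1, fun hx =>
    (mem_rest.1 hy).2 (s.newAn_of_H h hx (mem_rest.1 hy).1)⟩

lemma mem_marg (s : StepData E C M G c m) {x : V} (h : x ∈ m) :
    x ∈ G.rest c ∨ x ∈ G.full c := by
  have hxc : x ∉ c := fun hxc => Finset.disjoint_left.1 s.hcm hxc h
  rcases Finset.mem_union.1 (s.hm h) with hu | hv
  · by_cases hr : x ∈ G.newAn c
    · exact .inr (mem_full.2 ⟨.inl hr, hxc⟩)
    · exact .inl (mem_rest.2 ⟨hu, hr⟩)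
  · exact .inr (mem_full.2 ⟨.inr hv, hxc⟩)

lemma zer_joined_ne (s : StepData E C M G c m) {x y : V} :
    zer m (G.joined c) x y ≠ 0 ↔ Via m (G.joined c) x y := by
  rw [zer_ne_zero s.unitEntries_joined, or_iff_right_of_imp]
  rintro ⟨rfl, h⟩
  exact .single (s.joined_refl (s.mem_marg h))

end StepData

end Represents

end Step

/-! ### Edges after the additional step and walks of the parent graph -/

section Step

variable {V : Type*} [Fintype V] [DecidableEq V]
variable {E : V → V → Prop} {C M : Finset V} {G : Graph V}

namespace Represents
variable {c m : Finset V}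

namespace StepData

/-! From edges to walks. -/

omit [Fintype V] in
lemma walk_mono {i j : V} {a b : Bool} (h : CWalk E C M i a j b) :
    CWalk E (C ∪ c) (M ∪ m) i a j b :=
  GWalk.mono (fun _ _ _ _ => id) (by simp) (An_mono (by simp)) h

lemma joint_newAn (s : StepData E C M G c m) {x : V} (h : x ∈ G.newAn c) :
    Joint (↑(M ∪ m)) (An E ↑(C ∪ c)) x true true := by
  show x ∈ An E ↑(C ∪ c)
  exact An_mono (by simp) (s.mem_newAn.1 h).2

/-- A marginalised node of `full` is both in the marginalising set and an ancestor of the total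
conditioning set, so it may be passed as a collider as well as a non-collider. -/
lemma joint_full (s : StepData E C M G c m) {x : V} (h : x ∈ G.full c) (hm : x ∈ m) (a b : Bool) :
    Joint (↑(M ∪ m)) (An E ↑(C ∪ c)) x a b := by
  refine Joint.of_mem (by simp [hm]) ?_ a b
  rcases (mem_full.1 h).1 with h | h
  · exact s.joint_newAn h
  · exact An_mono (by simp) ((s.rep.mem_v x).1 h).1

lemma dashed_walk (s : StepData E C M G c m) {i j : V} (h : G.dashed c i j ≠ 0) :
    i = j ∨ CWalk E (C ∪ c) (M ∪ m) i true j true := by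
  replace h := s.dashed_ne.1 h
  induction h with
  | single h => exact ((s.rep.W_ne _ _).1 h).2.2.imp id walk_mono
  | cons h hm _ ih =>
    rcases ((s.rep.W_ne _ _).1 h).2.2 with rfl | h
    · exact ih
    · rcases ih with rfl | ih
      · exact .inr (walk_mono h)
      · exact .inr (GWalk.trans (walk_mono h) (s.joint_newAn hm) ih)

omit [Fintype V] in
lemma H_walk (s : StepData E C M G c m) {i j : V} (h : G.H i j ≠ 0) :
    i = j ∨ ∃ b, CWalk E (C ∪ c) (M ∪ m) i true j b := by
  obtain ⟨-, ⟨-, h | h⟩ | ⟨-, b, h⟩⟩ := (s.rep.H_ne i j).1 h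
  exacts [.inl h, .inr ⟨_, walk_mono h⟩, .inr ⟨b, walk_mono h⟩]

lemma dashed_H_walk (s : StepData E C M G c m) {i w j : V} (h : G.dashed c i w ≠ 0)
    (hw : w ∈ G.newAn c) (h' : G.H w j ≠ 0) :
    i = j ∨ ∃ b, CWalk E (C ∪ c) (M ∪ m) i true j b := by
  rcases s.dashed_walk h with rfl | h
  · exact s.H_walk h'
  · rcases s.H_walk h' with rfl | ⟨b, h'⟩
    · exact .inr ⟨_, h⟩
    · exact .inr ⟨b, h.trans (s.joint_newAn hw) h'⟩

lemma lines_walk (s : StepData E C M G c m) {x y : V} (h : G.lines c x y ≠ 0) :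
    x = y ∨ ∃ a b, CWalk E (C ∪ c) (M ∪ m) x a y b := by
  obtain ⟨-, -, ⟨w, hw, w', hw', h1, h2, h3⟩ | h⟩ := s.lines_ne.1 h
  · rcases s.dashed_H_walk h2 hw' h3 with rfl | ⟨b, h4⟩
    · exact (s.H_walk h1).imp Eq.symm fun ⟨b, h⟩ => ⟨b, _, Walk.symm h⟩
    · rcases s.H_walk h1 with rfl | ⟨a, h5⟩
      · exact .inr ⟨_, _, h4⟩
      · exact .inr ⟨_, _, GWalk.trans (Walk.symm h5) (s.joint_newAn hw) h4⟩
  · exact ((s.rep.S_ne x y).1 h).2.2.imp id fun ⟨a, b, h⟩ => ⟨a, b, walk_mono h⟩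

/-- The conditions on marks make concatenation possible: a node of `rest` between two edges of
`joined` is entered by a tail and left by a head, so it is a non-collider, as it must be. -/
lemma joined_walk (s : StepData E C M G c m) {x y : V} (h : G.joined c x y ≠ 0) :
    (y ∈ G.rest c → x ∈ G.rest c) ∧ (x = y ∨ ∃ a b, CWalk E (C ∪ c) (M ∪ m) x a y b ∧
      (x ∈ G.rest c → a = true) ∧ (y ∈ G.rest c → b = false)) := by
  rcases s.joined_ne.1 h with ⟨hx, hy, h⟩ | ⟨hx, hy, h⟩ | ⟨hx, hy, h⟩
  · refine ⟨fun _ => hx, ?_⟩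
    obtain ⟨-, ⟨-, h | h⟩ | ⟨h, -⟩⟩ := (s.rep.H_ne x y).1 h
    · exact .inl h
    · exact .inr ⟨_, _, walk_mono h, fun _ => rfl, fun _ => rfl⟩
    · exact absurd h (s.rep.not_mem_v (mem_rest.1 hy).1)
  · refine ⟨fun _ => hx, .inr ?_⟩
    have hne : x ≠ y := by
      rintro rfl
      exact s.rest_disj hx (mem_full.1 hy).1
    have hy' : y ∉ G.rest c := fun h => s.rest_disj h (mem_full.1 hy).1
    obtain ⟨-, -, h | ⟨w, hw, h1, h2⟩⟩ := s.arrows_ne.1 h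
    · obtain ⟨b, h⟩ := (s.H_walk h).resolve_left hne
      exact ⟨_, b, h, fun _ => rfl, fun h => absurd h hy'⟩
    · obtain ⟨b, h⟩ := (s.dashed_H_walk h1 hw h2).resolve_left hne
      exact ⟨_, b, h, fun _ => rfl, fun h => absurd h hy'⟩
  · have hx' : x ∉ G.rest c := fun h => s.rest_disj h (mem_full.1 hx).1
    have hy' : y ∉ G.rest c := fun h => s.rest_disj h (mem_full.1 hy).1
    refine ⟨fun h => absurd h hy', (s.lines_walk h).imp id ?_⟩
    rintro ⟨a, b, h⟩
    exact ⟨a, b, h, fun h => absurd h hx', fun h => absurd h hy'⟩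

lemma via_walk (s : StepData E C M G c m) {x y : V} (h : Via m (G.joined c) x y) :
    (y ∈ G.rest c → x ∈ G.rest c) ∧ (x = y ∨ ∃ a b, CWalk E (C ∪ c) (M ∪ m) x a y b ∧
      (x ∈ G.rest c → a = true) ∧ (y ∈ G.rest c → b = false)) := by
  induction h with
  | single h => exact s.joined_walk h
  | @cons i j k h hj _ ih =>
    obtain ⟨h1, h2⟩ := s.joined_walk h
    refine ⟨fun hk => h1 (ih.1 hk), ?_⟩
    rcases h2 with rfl | ⟨a, b, h2, ha, hb⟩
    · exact ih.2
    rcases ih.2 with rfl | ⟨a', b', h3, ha', hb'⟩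
    · exact .inr ⟨a, b, h2, ha, hb⟩
    refine .inr ⟨a, b', h2.trans ?_ h3, ha, hb'⟩
    rcases s.mem_marg hj with hr | hf
    · rw [hb hr]
      show j ∈ ((M ∪ m : Finset V) : Set V)
      simp [hj]
    · exact s.joint_full hf hj _ _

/-! From walks to edges. -/

/-- Walks between nodes of the summary graph as sequences of its edges. -/
lemma walk_group (s : StepData E C M G c m) {i j : V} {a b : Bool}
    (h : CWalk E (C ∪ c) (M ∪ m) i a j b) :
    GWalk (CWalk E C M) m (G.newAn c) i a j b := by
  -- A collider among the ancestors of `C ∪ c` is replaced by a descent through nodes of `M` only,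
  -- which stops at the first node outside `M` or in `An E C`. In the former case this node is in
  -- `newAn`, unless it is itself an ancestor of `C`.
  refine GWalk.group (Y := An E ↑C) (Y' := (G.newAn c : Set V)) (X := (M : Set V))
    (Walk.reroute (Y' := An E ↑(C ∪ c)) ?_ (by rwa [CWalk, Finset.coe_union M m] at h))
  rintro y ⟨k, hk, h⟩
  induction h with
  | refl =>
    rcases Finset.mem_union.1 (Finset.mem_coe.1 hk) with hk | hk
    · exact .base (.inl (subset_An _ hk))
    · rcases Finset.mem_union.1 (s.hc hk) with h | h
      · exact .base (.inr (s.mem_newAn.2 ⟨h, subset_An _ hk⟩))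
      · exact .base (.inl ((s.rep.mem_v _).1 h).1)
  | @tail z y hkz hzy ih =>
    by_cases hy : y ∈ An E (C : Set V)
    · exact .base (.inl hy)
    by_cases hyM : y ∈ M
    · exact .step (.inl hyM) hzy ih
    · refine .base (.inr (s.mem_newAn.2 ⟨(s.rep.mem_u y).2 ⟨hy, hyM⟩, k, ?_, hkz.tail hzy⟩))
      refine (Finset.mem_union.1 (Finset.mem_coe.1 hk)).resolve_left fun hkC => ?_
      exact hy ⟨k, hkC, hkz.tail hzy⟩

/-- The edges of a piece, by the position of its end nodes. -/
lemma piece_cases (s : StepData E C M G c m) {x y : V} {a b : Bool} (h : CWalk E C M x a y b)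
    (hx : x ∈ G.u ∨ x ∈ G.v) (hy : y ∈ G.u ∨ y ∈ G.v) :
    (x ∈ G.rest c ∧ a = true ∧ y ∈ G.rest c ∧ b = true ∧ G.W x y ≠ 0) ∨
    (x ∈ G.rest c ∧ a = true ∧ y ∈ G.newAn c ∧ b = true ∧ G.W x y ≠ 0) ∨
    (x ∈ G.newAn c ∧ a = true ∧ y ∈ G.rest c ∧ b = true ∧ G.W x y ≠ 0) ∨
    (x ∈ G.newAn c ∧ a = true ∧ y ∈ G.newAn c ∧ b = true ∧ G.W x y ≠ 0) ∨
    (x ∈ G.rest c ∧ a = true ∧ y ∈ G.rest c ∧ b = false ∧ G.H x y ≠ 0) ∨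
    (x ∈ G.rest c ∧ a = true ∧ ((y ∈ G.newAn c ∧ b = false) ∨ y ∈ G.v) ∧ G.H x y ≠ 0) ∨
    (x ∈ G.newAn c ∧ a = true ∧ ((y ∈ G.newAn c ∧ b = false) ∨ y ∈ G.v) ∧ G.H x y ≠ 0) ∨
    (x ∈ G.rest c ∧ a = false ∧ y ∈ G.rest c ∧ b = true ∧ G.H y x ≠ 0) ∨
    (((x ∈ G.newAn c ∧ a = false) ∨ x ∈ G.v) ∧ y ∈ G.rest c ∧ b = true ∧ G.H y x ≠ 0) ∨
    (((x ∈ G.newAn c ∧ a = false) ∨ x ∈ G.v) ∧ y ∈ G.newAn c ∧ b = true ∧ G.H y x ≠ 0) ∨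
    (x ∈ G.v ∧ y ∈ G.v ∧ G.S x y ≠ 0) := by
  have split : ∀ z ∈ G.u, z ∈ G.rest c ∨ z ∈ G.newAn c := fun z hz => by
    by_cases h : z ∈ G.newAn c
    exacts [.inr h, .inl (mem_rest.2 ⟨hz, h⟩)]
  have anti : ∀ z, z ∈ G.rest c → z ∉ G.newAn c := fun z hz => (mem_rest.1 hz).2
  rcases s.rep.edge_cases h hx hy with ⟨h1, h2, h3, h4, h5⟩ | ⟨h1, h2, h3, h4, h5⟩ |
    ⟨h1, h2, h3, h4, h5⟩ | ⟨h1, h2, h3, h4⟩ | ⟨h1, h2, h3, h4⟩ | ⟨h1, h2, h3⟩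
  · rcases split x h1 with h1 | h1 <;> rcases split y h2 with h2 | h2 <;> simp [*]
  · rcases split y h2 with h2 | h2
    · have := s.rest_of_H h5 h2
      simp [*]
    · rcases split x h1 with h1 | h1 <;> simp [*]
  · rcases split x h1 with h1 | h1
    · have := s.rest_of_H h5 h1
      simp [*]
    · rcases split y h2 with h2 | h2 <;> simp [*]
  · rcases split x h1 with h1 | h1 <;> simp [*]
  · rcases split y h2 with h2 | h2 <;> simp [*]
  · simp [*]

end StepData

end Represents

end Step

/-! ### Paths of `joined` read off from walks -/

section Step

variable {V : Type*} [Fintype V] [DecidableEq V]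
variable {E : V → V → Prop} {C M : Finset V} {G : Graph V}

namespace Represents
variable {c m : Finset V}

namespace StepData

lemma joined_of_H (s : StepData E C M G c m) {x y : V} (hx : x ∈ G.rest c) (hy : y ∈ G.rest c)
    (h : G.H x y ≠ 0) : G.joined c x y ≠ 0 :=
  s.joined_ne.2 (.inl ⟨hx, hy, h⟩)

lemma joined_of_arrow (s : StepData E C M G c m) {x y : V} (hx : x ∈ G.rest c)
    (hy : y ∈ G.full c) (h : G.H x y ≠ 0) : G.joined c x y ≠ 0 :=
  s.joined_ne.2 (.inr (.inl ⟨hx, hy, s.arrows_ne.2 ⟨hx, (mem_full.1 hy).1, .inl h⟩⟩))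

lemma joined_of_dashed (s : StepData E C M G c m) {x w y : V} (hx : x ∈ G.rest c)
    (hy : y ∈ G.full c) (hw : w ∈ G.newAn c) (h : G.dashed c x w ≠ 0) (h' : G.H w y ≠ 0) :
    G.joined c x y ≠ 0 :=
  s.joined_ne.2 (.inr (.inl ⟨hx, hy, s.arrows_ne.2
    ⟨hx, (mem_full.1 hy).1, .inr ⟨w, hw, h, h'⟩⟩⟩))

lemma joined_of_lines (s : StepData E C M G c m) {x w w' y : V} (hx : x ∈ G.full c)
    (hy : y ∈ G.full c) (hw : w ∈ G.newAn c) (hw' : w' ∈ G.newAn c) (h1 : G.H w x ≠ 0)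
    (h2 : G.dashed c w w' ≠ 0) (h3 : G.H w' y ≠ 0) : G.joined c x y ≠ 0 :=
  s.joined_ne.2 (.inr (.inr ⟨hx, hy, s.lines_ne.2
    ⟨(mem_full.1 hx).1, (mem_full.1 hy).1, .inl ⟨w, hw, w', hw', h1, h2, h3⟩⟩⟩))

lemma joined_of_S (s : StepData E C M G c m) {x y : V} (hx : x ∈ G.full c) (hy : y ∈ G.full c)
    (h : G.S x y ≠ 0) : G.joined c x y ≠ 0 :=
  s.joined_ne.2 (.inr (.inr ⟨hx, hy, s.lines_ne.2
    ⟨(mem_full.1 hx).1, (mem_full.1 hy).1, .inr h⟩⟩))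

lemma full_not_rest (s : StepData E C M G c m) {x : V} (h : x ∈ G.full c) : x ∉ G.rest c :=
  fun h' => s.rest_disj h' (mem_full.1 h).1

/-- The paths in `joined` that belong to a walk which starts at `x` with mark `a` and ends at a
node `j` in `full`. -/
structure ToFull (G : Graph V) (c m : Finset V) (j x : V) (a : Bool) : Prop where
  rest : x ∈ G.rest c → a = true ∧ Via m (G.joined c) x j
  full : x ∈ G.full c → Via m (G.joined c) x j
  newAn : x ∈ G.newAn c → a = true → ∃ w ∈ G.newAn c, G.dashed c x w ≠ 0 ∧ ∃ z ∈ G.full c,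
    G.H w z ≠ 0 ∧ (z = j ∨ z ∈ m) ∧ Via m (G.joined c) z j

/-- The induction step that prepends one piece to a walk. The hypotheses record what the remaining
walk provides at `y`, according to the position of `y` and the mark with which the piece arrives
there. -/
lemma toFull_of_piece (s : StepData E C M G c m) {j x y : V} {a b : Bool}
    (h : CWalk E C M x a y b) (hx : x ∈ G.u ∨ x ∈ G.v) (hy : y ∈ G.u ∨ y ∈ G.v)
    (h1 : y ∈ G.rest c → b = true → False)
    (h2 : y ∈ G.rest c → b = false → y ∈ m ∧ Via m (G.joined c) y j)
    (h3 : y ∈ G.newAn c → b = true → ∃ w ∈ G.newAn c, G.dashed c y w ≠ 0 ∧ ∃ z ∈ G.full c,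
      G.H w z ≠ 0 ∧ (z = j ∨ z ∈ m) ∧ Via m (G.joined c) z j)
    (h4 : (y ∈ G.newAn c ∧ b = false) ∨ y ∈ G.v →
      y ∈ G.full c ∧ (y = j ∨ y ∈ m) ∧ Via m (G.joined c) y j) :
    ToFull G c m j x a := by
  have ext : ∀ {x z}, G.joined c x z ≠ 0 → (z = j ∨ z ∈ m) → Via m (G.joined c) z j →
      Via m (G.joined c) x j := by
    rintro x z h (rfl | hz) hv
    exacts [.single h, .cons h hz hv]
  have p := s.piece_cases h hx hy
  have t3 : x ∈ G.newAn c → a = true → ∃ w ∈ G.newAn c, G.dashed c x w ≠ 0 ∧ ∃ z ∈ G.full c,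
      G.H w z ≠ 0 ∧ (z = j ∨ z ∈ m) ∧ Via m (G.joined c) z j := by
    intro hx ha
    have hxr : x ∉ G.rest c := fun h => (mem_rest.1 h).2 hx
    have hxv : x ∉ G.v := s.rep.not_mem_v (s.newAn_subset hx)
    rcases p with p | p | p | p | p | p | p | p | p | p | p
    · exact absurd p.1 hxr
    · exact absurd p.1 hxr
    · exact (h1 p.2.2.1 p.2.2.2.1).elim
    · obtain ⟨w, hw, hq, h⟩ := h3 p.2.2.1 p.2.2.2.1
      exact ⟨w, hw, s.dashed_cons p.2.2.2.2 p.2.2.1 hq, h⟩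
    · exact absurd p.1 hxr
    · exact absurd p.1 hxr
    · obtain ⟨h5, h6, h7⟩ := h4 p.2.2.1
      exact ⟨x, hx, s.dashed_refl (s.newAn_subset hx), y, h5, p.2.2.2, h6, h7⟩
    · exact absurd p.1 hxr
    · rcases p.1 with p | p
      · rw [ha] at p; simp at p
      · exact absurd p hxv
    · rcases p.1 with p | p
      · rw [ha] at p; simp at p
      · exact absurd p hxv
    · exact absurd p.1 hxv
  refine ⟨fun hx => ?_, fun hx => ?_, t3⟩
  · have hxr : x ∉ G.newAn c := (mem_rest.1 hx).2
    have hxv : x ∉ G.v := s.rep.not_mem_v (mem_rest.1 hx).1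
    rcases p with p | p | p | p | p | p | p | p | p | p | p
    · exact (h1 p.2.2.1 p.2.2.2.1).elim
    · obtain ⟨w, hw, hq, z, hz, h5, h6, h7⟩ := h3 p.2.2.1 p.2.2.2.1
      exact ⟨p.2.1, ext (s.joined_of_dashed hx hz hw
        (s.dashed_cons p.2.2.2.2 p.2.2.1 hq) h5) h6 h7⟩
    · exact absurd p.1 hxr
    · exact absurd p.1 hxr
    · obtain ⟨h5, h6⟩ := h2 p.2.2.1 p.2.2.2.1
      exact ⟨p.2.1, .cons (s.joined_of_H hx p.2.2.1 p.2.2.2.2) h5 h6⟩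
    · obtain ⟨h5, h6, h7⟩ := h4 p.2.2.1
      exact ⟨p.2.1, ext (s.joined_of_arrow hx h5 p.2.2.2) h6 h7⟩
    · exact absurd p.1 hxr
    · exact (h1 p.2.2.1 p.2.2.2.1).elim
    · rcases p.1 with p | p
      exacts [absurd p.1 hxr, absurd p hxv]
    · rcases p.1 with p | p
      exacts [absurd p.1 hxr, absurd p hxv]
    · exact absurd p.1 hxv
  · have hxr := s.full_not_rest hx
    by_cases hxa : x ∈ G.newAn c ∧ a = true
    · obtain ⟨w, hw, hq, z, hz, h5, h6, h7⟩ := t3 hxa.1 hxa.2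
      -- The diagonal entry of `H` at `x` takes the place of an arrow, so that a dashed path
      -- starting at `x` itself also yields a full line at `x`.
      exact ext (s.joined_of_lines hx hz hxa.1 hw (s.rep.H_refl (s.newAn_subset hxa.1)) hq h5) h6 h7
    rcases p with p | p | p | p | p | p | p | p | p | p | p
    · exact absurd p.1 hxr
    · exact absurd p.1 hxr
    · exact absurd ⟨p.1, p.2.1⟩ hxa
    · exact absurd ⟨p.1, p.2.1⟩ hxa
    · exact absurd p.1 hxr
    · exact absurd p.1 hxr
    · exact absurd ⟨p.1, p.2.1⟩ hxa
    · exact absurd p.1 hxr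
    · exact (h1 p.2.1 p.2.2.1).elim
    · obtain ⟨w, hw, hq, z, hz, h5, h6, h7⟩ := h3 p.2.1 p.2.2.1
      exact ext (s.joined_of_lines hx hz p.2.1 hw p.2.2.2 hq h5) h6 h7
    · obtain ⟨h5, h6, h7⟩ := h4 (.inr p.2.1)
      exact ext (s.joined_of_S hx h5 p.2.2) h6 h7

lemma joint_mem (s : StepData E C M G c m) {y : V} {a b : Bool}
    (h : Joint (m : Set V) (G.newAn c) y a b) : y ∈ G.u ∨ y ∈ G.v := by
  have h1 : y ∈ m → y ∈ G.u ∨ y ∈ G.v := fun h => Finset.mem_union.1 (s.hm h)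
  cases a <;> cases b
  exacts [h1 h, h1 h, h1 h, .inl (s.newAn_subset h)]

lemma toFull (s : StepData E C M G c m) {j x : V} {a b : Bool}
    (h : GWalk (CWalk E C M) m (G.newAn c) x a j b) (hx : x ∈ G.u ∨ x ∈ G.v)
    (hj : j ∈ G.full c) : ToFull G c m j x a := by
  have hjr := s.full_not_rest hj
  induction h with
  | @single x a j b h =>
    have hj' : j ∈ G.u ∨ j ∈ G.v := (mem_full.1 hj).1.imp s.newAn_subset id
    have hK : Via m (G.joined c) j j := .single (s.joined_refl (.inr hj))
    refine s.toFull_of_piece h hx hj' (fun h => absurd h hjr) (fun h => absurd h hjr)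
      (fun h _ => ?_) (fun _ => ⟨hj, .inl rfl, hK⟩)
    have hu := s.newAn_subset h
    exact ⟨j, h, s.dashed_refl hu, j, hj, s.rep.H_refl hu, .inl rfl, hK⟩
  | @cons x a y b a' j d h hm _ ih =>
    have hy := s.joint_mem hm
    have ih := ih hy hj hjr
    refine s.toFull_of_piece h hx hy ?_ ?_ ?_ ?_
    · rintro hr rfl
      -- A walk that leaves a node of `rest` by a tail never gets to `full`. So `y` would have to be
      -- a collider, but it is not in `newAn`.
      obtain rfl := (ih.rest hr).1
      exact (mem_rest.1 hr).2 hm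
    · rintro hr rfl
      exact ⟨hm, (ih.rest hr).2⟩
    · rintro hr rfl
      cases a' with
      | true => exact ih.newAn hr rfl
      | false =>
        have hu := s.newAn_subset hr
        have hf := (s.mem_marg hm).resolve_left fun h => (mem_rest.1 h).2 hr
        exact ⟨y, hr, s.dashed_refl hu, y, hf, s.rep.H_refl hu, .inr hm, ih.full hf⟩
    · intro hr
      have hym : y ∈ m := by
        rcases hr with ⟨-, rfl⟩ | hr
        · exact hm
        · cases b <;> cases a'
          exacts [hm, hm, hm, absurd hr (s.rep.not_mem_v (s.newAn_subset hm))]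
      have hf : y ∈ G.full c := (s.mem_marg hym).resolve_left fun h =>
        s.rest_disj h (hr.imp And.left id)
      exact ⟨hf, .inr hym, ih.full hf⟩

/-- The paths in `joined` that belong to a walk which starts at `x` with mark `a` and ends at a
node `j` of `rest` with an arrowhead. -/
structure ToHead (G : Graph V) (c m : Finset V) (j x : V) (a : Bool) : Prop where
  tail : x ∈ G.rest c → a = false → Via m (G.joined c) j x
  full : x ∈ G.full c → Via m (G.joined c) j x
  newAn : x ∈ G.newAn c → a = true → ∃ w, G.dashed c x w ≠ 0 ∧
    ((w ∈ G.rest c ∧ (w = j ∨ w ∈ m) ∧ Via m (G.joined c) j w) ∨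
      (w ∈ G.newAn c ∧ ∃ z ∈ G.full c, z ∈ m ∧ G.H w z ≠ 0 ∧ Via m (G.joined c) j z))
  head : x ∈ G.rest c → a = true →
    (∃ x' ∈ G.rest c, (x' = x ∨ x' ∈ m) ∧ Via m (G.joined c) x x' ∧ ∃ w ∈ G.rest c,
      G.dashed c x' w ≠ 0 ∧ (w = j ∨ w ∈ m) ∧ Via m (G.joined c) j w) ∨
    ∃ z ∈ G.full c, z ∈ m ∧ Via m (G.joined c) x z ∧ Via m (G.joined c) j z

/-- With an arrowhead at the far end `j`, the paths of `joined` at that side are read backwards,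
starting from `j`. Coming from both ends, a walk climbs along arrows until the two branches are
linked by a dashed path within `rest` and `newAn`, or meet in a marginalised node of `full`. -/
lemma toHead_of_piece (s : StepData E C M G c m) {j x y : V} {a b : Bool}
    (h : CWalk E C M x a y b) (hx : x ∈ G.u ∨ x ∈ G.v) (hy : y ∈ G.u ∨ y ∈ G.v)
    (h1 : y ∈ G.rest c → b = true → (y = j ∨ y ∈ m) ∧ Via m (G.joined c) j y)
    (h2 : y ∈ G.rest c → b = false → y ∈ m ∧ 
      ((∃ x' ∈ G.rest c, (x' = y ∨ x' ∈ m) ∧ Via m (G.joined c) y x' ∧ ∃ w ∈ G.rest c,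
        G.dashed c x' w ≠ 0 ∧ (w = j ∨ w ∈ m) ∧ Via m (G.joined c) j w) ∨
      ∃ z ∈ G.full c, z ∈ m ∧ Via m (G.joined c) y z ∧ Via m (G.joined c) j z))
    (h3 : y ∈ G.newAn c → b = true → ∃ w, G.dashed c y w ≠ 0 ∧
      ((w ∈ G.rest c ∧ (w = j ∨ w ∈ m) ∧ Via m (G.joined c) j w) ∨
      (w ∈ G.newAn c ∧ ∃ z ∈ G.full c, z ∈ m ∧ G.H w z ≠ 0 ∧ Via m (G.joined c) j z)))
    (h4 : (y ∈ G.newAn c ∧ b = false) ∨ y ∈ G.v →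
      y ∈ G.full c ∧ y ∈ m ∧ Via m (G.joined c) j y) :
    ToHead G c m j x a := by
  have ext : ∀ {x z}, G.joined c z x ≠ 0 → (z = j ∨ z ∈ m) → Via m (G.joined c) j z →
      Via m (G.joined c) j x := by
    rintro x z h (rfl | hz) hv
    exacts [.single h, hv.trans hz (.single h)]
  have p := s.piece_cases h hx hy
  have t3 : x ∈ G.newAn c → a = true → ∃ w, G.dashed c x w ≠ 0 ∧
      ((w ∈ G.rest c ∧ (w = j ∨ w ∈ m) ∧ Via m (G.joined c) j w) ∨
      (w ∈ G.newAn c ∧ ∃ z ∈ G.full c, z ∈ m ∧ G.H w z ≠ 0 ∧ Via m (G.joined c) j z)) := by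
    intro hx ha
    have hxr : x ∉ G.rest c := fun h => (mem_rest.1 h).2 hx
    have hxv : x ∉ G.v := s.rep.not_mem_v (s.newAn_subset hx)
    rcases p with p | p | p | p | p | p | p | p | p | p | p
    · exact absurd p.1 hxr
    · exact absurd p.1 hxr
    · exact ⟨y, s.dashed_ne.2 (.single p.2.2.2.2), .inl ⟨p.2.2.1, h1 p.2.2.1 p.2.2.2.1⟩⟩
    · obtain ⟨w, hw, h⟩ := h3 p.2.2.1 p.2.2.2.1
      exact ⟨w, s.dashed_cons p.2.2.2.2 p.2.2.1 hw, h⟩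
    · exact absurd p.1 hxr
    · exact absurd p.1 hxr
    · obtain ⟨h5, h6, h7⟩ := h4 p.2.2.1
      exact ⟨x, s.dashed_refl (s.newAn_subset hx), .inr ⟨hx, y, h5, h6, p.2.2.2, h7⟩⟩
    · exact absurd p.1 hxr
    · rcases p.1 with p | p
      · rw [ha] at p; simp at p
      · exact absurd p hxv
    · rcases p.1 with p | p
      · rw [ha] at p; simp at p
      · exact absurd p hxv
    · exact absurd p.1 hxv
  refine ⟨fun hx ha => ?_, fun hx => ?_, t3, fun hx ha => ?_⟩
  · have hxr : x ∉ G.newAn c := (mem_rest.1 hx).2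
    have hxv : x ∉ G.v := s.rep.not_mem_v (mem_rest.1 hx).1
    subst ha
    simp only [hxr, hxv, hx, true_and, false_and, false_or, or_false, Bool.false_eq_true] at p
    obtain ⟨h5, h6⟩ := h1 p.1 p.2.1
    exact ext (s.joined_of_H p.1 hx p.2.2) h5 h6
  · have hxr := s.full_not_rest hx
    by_cases hxa : x ∈ G.newAn c ∧ a = true
    · have hH := s.rep.H_refl (s.newAn_subset hxa.1)
      obtain ⟨w, hq, ⟨h5, h6, h7⟩ | ⟨h5, z, h6, h7, h8, h9⟩⟩ := t3 hxa.1 hxa.2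
      · exact ext (s.joined_of_dashed h5 hx hxa.1 (s.dashed_symm hq) hH) h6 h7
      · exact ext (s.joined_of_lines h6 hx h5 hxa.1 h8 (s.dashed_symm hq) hH) (.inr h7) h9
    rcases p with p | p | p | p | p | p | p | p | p | p | p
    · exact absurd p.1 hxr
    · exact absurd p.1 hxr
    · exact absurd ⟨p.1, p.2.1⟩ hxa
    · exact absurd ⟨p.1, p.2.1⟩ hxa
    · exact absurd p.1 hxr
    · exact absurd p.1 hxr
    · exact absurd ⟨p.1, p.2.1⟩ hxa
    · exact absurd p.1 hxr
    · obtain ⟨h5, h6⟩ := h1 p.2.1 p.2.2.1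
      exact ext (s.joined_of_arrow p.2.1 hx p.2.2.2) h5 h6
    · obtain ⟨w, hq, ⟨h5, h6, h7⟩ | ⟨h5, z, h6, h7, h8, h9⟩⟩ := h3 p.2.1 p.2.2.1
      · exact ext (s.joined_of_dashed h5 hx p.2.1 (s.dashed_symm hq) p.2.2.2) h6 h7
      · exact ext (s.joined_of_lines h6 hx h5 p.2.1 h8 (s.dashed_symm hq) p.2.2.2) (.inr h7) h9
    · obtain ⟨h5, h6, h7⟩ := h4 (.inr p.2.1)
      exact ext (s.joined_of_S h5 hx (s.rep.S_symm _ _ p.2.2)) (.inr h6) h7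
  · have hxr : x ∉ G.newAn c := (mem_rest.1 hx).2
    have hxv : x ∉ G.v := s.rep.not_mem_v (mem_rest.1 hx).1
    have hxx : Via m (G.joined c) x x := .single (s.joined_refl (.inl hx))
    subst ha
    simp only [hxr, hxv, hx, true_and, false_and, false_or, or_false, Bool.true_eq_false] at p
    rcases p with p | p | p | p
    · exact .inl ⟨x, hx, .inl rfl, hxx, y, p.1, s.dashed_ne.2 (.single p.2.2), h1 p.1 p.2.1⟩
    · obtain ⟨w, hq, h5⟩ := h3 p.1 p.2.1
      have hq' := s.dashed_cons p.2.2 p.1 hq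
      obtain h5 | ⟨h5, z, h6, h7, h8, h9⟩ := h5
      · exact .inl ⟨x, hx, .inl rfl, hxx, w, h5.1, hq', h5.2⟩
      · exact .inr ⟨z, h6, h7, .single (s.joined_of_dashed hx h6 h5 hq' h8), h9⟩
    · have hB := s.joined_of_H hx p.1 p.2.2
      obtain ⟨hm, ⟨x', h5, h6, h7, h8⟩ | ⟨z, h5, h6, h7, h8⟩⟩ := h2 p.1 p.2.1
      · refine .inl ⟨x', h5, .inr ?_, .cons hB hm h7, h8⟩
        rcases h6 with rfl | h6
        exacts [hm, h6]
      · exact .inr ⟨z, h5, h6, .cons hB hm h7, h8⟩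
    · obtain ⟨h5, h6, h7⟩ := h4 p.1
      exact .inr ⟨y, h5, h6, .single (s.joined_of_arrow hx h5 p.2), h7⟩

lemma toHead (s : StepData E C M G c m) {j x : V} {a b : Bool}
    (h : GWalk (CWalk E C M) m (G.newAn c) x a j b) (hb : b = true) (hx : x ∈ G.u ∨ x ∈ G.v)
    (hj : j ∈ G.rest c) : ToHead G c m j x a := by
  have hjr := s.rest_disj hj
  induction h with
  | @single x a j b h =>
    subst hb
    have hj' := (mem_rest.1 hj).1
    have hK : Via m (G.joined c) j j := .single (s.joined_refl (.inl hj))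
    refine s.toHead_of_piece h hx (.inl hj') (fun _ _ => ⟨.inl rfl, hK⟩) (fun _ h => by simp at h)
      (fun h _ => absurd (.inl h) hjr) (fun h => absurd (h.imp And.left id) hjr)
  | @cons x a y b a' j d h hm _ ih =>
    have hy := s.joint_mem hm
    have ih := ih hb hy hj hjr
    refine s.toHead_of_piece h hx hy ?_ ?_ ?_ ?_
    · rintro hr rfl
      cases a' with
      -- A collider has to lie in `newAn`, which is disjoint from `rest`.
      | true => exact absurd hm (mem_rest.1 hr).2
      | false => exact ⟨.inr hm, ih.tail hr rfl⟩
    · rintro hr rfl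
      refine ⟨hm, ?_⟩
      cases a' with
      | true => exact ih.head hr rfl
      | false =>
        exact .inl ⟨y, hr, .inl rfl, .single (s.joined_refl (.inl hr)), y, hr,
          s.dashed_refl (mem_rest.1 hr).1, .inr hm, ih.tail hr rfl⟩
    · rintro hr rfl
      cases a' with
      | true => exact ih.newAn hr rfl
      | false =>
        have hu := s.newAn_subset hr
        have hf := (s.mem_marg hm).resolve_left fun h => (mem_rest.1 h).2 hr
        exact ⟨y, s.dashed_refl hu, .inr ⟨hr, y, hf, hm, s.rep.H_refl hu, ih.full hf⟩⟩
    · intro hr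
      have hym : y ∈ m := by
        rcases hr with ⟨-, rfl⟩ | hr
        · exact hm
        · cases b <;> cases a'
          exacts [hm, hm, hm, absurd hr (s.rep.not_mem_v (s.newAn_subset hm))]
      have hf : y ∈ G.full c := (s.mem_marg hym).resolve_left fun h =>
        s.rest_disj h (hr.imp And.left id)
      exact ⟨hf, hym, ih.full hf⟩

/-- A walk that ends at a node of `rest` with a tail is directed. -/
lemma toTail (s : StepData E C M G c m) {j x : V} {a b : Bool}
    (h : GWalk (CWalk E C M) m (G.newAn c) x a j b) (hb : b = false) (hx : x ∈ G.u ∨ x ∈ G.v)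
    (hj : j ∈ G.rest c) : x ∈ G.rest c ∧ a = true ∧ Via m (G.joined c) x j := by
  have hjr := s.rest_disj hj
  induction h with
  | @single x a j b h =>
    subst hb
    have hjn : j ∉ G.newAn c := fun h => hjr (.inl h)
    have hjv : j ∉ G.v := fun h => hjr (.inr h)
    have p := s.piece_cases h hx (.inl (mem_rest.1 hj).1)
    simp only [hjn, hjv, hj, true_and, false_and, and_false, false_or, or_false,
      Bool.false_eq_true] at p
    exact ⟨p.1, p.2.1, .single (s.joined_of_H p.1 hj p.2.2)⟩
  | @cons x a y b a' j d h hm _ ih =>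
    have hy := s.joint_mem hm
    obtain ⟨hr, rfl, hK⟩ := ih hb hy hj hjr
    have hyn : y ∉ G.newAn c := (mem_rest.1 hr).2
    have hyv : y ∉ G.v := s.rep.not_mem_v (mem_rest.1 hr).1
    cases b with
    | true => exact absurd hm hyn
    | false =>
      have p := s.piece_cases h hx hy
      simp only [hyn, hyv, hr, true_and, false_and, and_false, false_or, or_false,
        Bool.false_eq_true] at p
      exact ⟨p.1, p.2.1, .cons (s.joined_of_H p.1 hr p.2.2) hm hK⟩

end StepData

end Represents

end Step

/-! ### Zero patterns of the new edge matrices -/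

section Step

variable {V : Type*} [Fintype V] [DecidableEq V]
variable {E : V → V → Prop} {C M : Finset V} {G : Graph V}

namespace Represents
variable {c m : Finset V}

namespace StepData

/-- In `joined` no edge leads from a row in `full` to a column in `rest`. A path that starts in
`full` stays there and uses full lines only. -/
lemma via_lines (s : StepData E C M G c m) {i j : V} (h : Via m (G.joined c) i j)
    (hi : i ∈ G.full c) :
    Via (m \ (m ∩ G.rest c)) (blk (G.full c) (G.full c) (G.lines c)) i j := by
  have key : ∀ {x y}, G.joined c x y ≠ 0 → x ∈ G.full c →
      y ∈ G.full c ∧ blk (G.full c) (G.full c) (G.lines c) x y ≠ 0 := by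
    intro x y h hx
    rcases s.joined_ne.1 h with ⟨h, -⟩ | ⟨h, -⟩ | h
    · exact absurd h (s.full_not_rest hx)
    · exact absurd h (s.full_not_rest hx)
    · exact ⟨h.2.1, blk_ne_zero.2 h⟩
  induction h with
  | single h => exact .single (key h hi).2
  | cons h hm _ ih =>
    have hf := (key h hi).1
    refine .cons (key h hi).2 ?_ (ih hf)
    simp only [Finset.mem_sdiff, Finset.mem_inter, not_and]
    exact ⟨hm, fun _ => s.full_not_rest hf⟩

lemma mem_u_iff (_s : StepData E C M G c m) (i : V) :
    i ∈ (G.condMarg c m).u ↔ i ∈ G.rest c ∧ i ∉ m := by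
  rw [Graph.condMarg_eq]
  simp only [Finset.mem_sdiff, Finset.mem_inter]
  tauto

lemma mem_v_iff (s : StepData E C M G c m) (i : V) :
    i ∈ (G.condMarg c m).v ↔ i ∈ G.full c ∧ i ∉ m := by
  rw [Graph.condMarg_eq]
  simp only [Finset.mem_sdiff, Finset.mem_inter]
  constructor
  · rintro ⟨h, h'⟩
    exact ⟨h, fun hm => h' ⟨hm, fun h'' => s.full_not_rest h h''.2⟩⟩
  · rintro ⟨h, h'⟩
    exact ⟨h, fun hm => h' hm.1⟩

lemma zer_eq (G : Graph V) (c m : Finset V) :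
    zer (m ∩ G.rest c ∪ m \ (m ∩ G.rest c)) (G.joined c) = zer m (G.joined c) := by
  rw [Finset.union_sdiff_of_subset Finset.inter_subset_left]

lemma condMarg_H_ne (s : StepData E C M G c m) (i j : V) :
    (G.condMarg c m).H i j ≠ 0 ↔ i ∈ (G.condMarg c m).u ∧
      (j ∈ (G.condMarg c m).u ∨ j ∈ (G.condMarg c m).v) ∧ Via m (G.joined c) i j := by
  have h : (G.condMarg c m).H = blk (G.condMarg c m).u (G.condMarg c m).u (zer m (G.joined c)) +
      blk (G.condMarg c m).u (G.condMarg c m).v (zer m (G.joined c)) := by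
    rw [← zer_eq]; rfl
  rw [h, matrix_add_ne_zero (blk_nonneg (unitEntries_zer _ _).nonneg _ _)
    (blk_nonneg (unitEntries_zer _ _).nonneg _ _), blk_ne_zero, blk_ne_zero, s.zer_joined_ne]
  tauto

lemma condMarg_S_ne (s : StepData E C M G c m) (i j : V) :
    (G.condMarg c m).S i j ≠ 0 ↔ i ∈ (G.condMarg c m).v ∧ j ∈ (G.condMarg c m).v ∧
      Via m (G.joined c) i j := by
  have h : (G.condMarg c m).S = blk (G.condMarg c m).v (G.condMarg c m).v
      (zer (m \ (m ∩ G.rest c)) (blk (G.full c) (G.full c) (G.lines c))) := rfl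
  have hl : UnitEntries (G.lines c) := unitEntries_ind _
  rw [h, blk_ne_zero]
  refine and_congr_right fun hi => and_congr_right fun hj => ?_
  have hi := (s.mem_v_iff i).1 hi
  rw [zer_ne_zero (hl.blk _ _)]
  constructor
  · rintro (⟨-, h⟩ | h)
    · exact absurd (Finset.mem_sdiff.1 h).1 hi.2
    · exact h.mono Finset.sdiff_subset fun x y h =>
        s.joined_ne.2 (.inr (.inr (blk_ne_zero.1 h)))
  · exact fun h => .inr (s.via_lines h hi.1)

/-- The first four products differ only in whether each end of the dashed line is the node itself or
is reached through marginalised nodes of `rest`. In the fifth, the middle factor is absorbed into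
the path from `i`, so that one common node `z` is enough. -/
lemma condMarg_W_ne (s : StepData E C M G c m) (i j : V) :
    (G.condMarg c m).W i j ≠ 0 ↔ i ∈ (G.condMarg c m).u ∧ j ∈ (G.condMarg c m).u ∧
      ((∃ x ∈ G.rest c, (x = i ∨ (x ∈ m ∧ Via m (G.joined c) i x)) ∧ ∃ w ∈ G.rest c,
        G.dashed c x w ≠ 0 ∧ (w = j ∨ (w ∈ m ∧ Via m (G.joined c) j w))) ∨
      ∃ z ∈ G.full c, z ∈ m ∧ Via m (G.joined c) i z ∧ Via m (G.joined c) j z) := by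
  set u := (G.condMarg c m).u with hu
  have hl : UnitEntries (G.lines c) := unitEntries_ind _
  have h : (G.condMarg c m).W = 
    let h := m ∩ G.rest c
    let l := m \ h
    let Q := G.dashed c
    let K := zer m (G.joined c)
    let Z := zer l (blk (G.full c) (G.full c) (G.lines c))
    ind ((blk u u Q + blk u h Q * (blk u h K).transpose + blk u h K * blk h u Q
            + blk u h K * blk h h Q * (blk u h K).transpose)
          + blk u l K * blk l l Z * (blk u l K).transpose) := by
    rw [← zer_eq]; rfl
  rw [h]
  have hQ := fun a b => blk_nonneg (dashed_nonneg (G := G) (c := c)) a b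
  have hK := fun a b => blk_nonneg (unitEntries_zer m (G.joined c)).nonneg a b
  have hT := fun a b => matrix_transpose_nonneg (hK a b)
  have hZ := fun a b => blk_nonneg (unitEntries_zer (m \ (m ∩ G.rest c))
    (blk (G.full c) (G.full c) (G.lines c))).nonneg a b
  have n1 := fun a b a' b' => matrix_mul_nonneg (hQ a b) (hT a' b')
  have n2 := fun a b a' b' => matrix_mul_nonneg (hK a b) (hQ a' b')
  have n3 := fun a b a' b' a'' b'' => matrix_mul_nonneg (n2 a b a' b') (hT a'' b'')
  have n4 := fun a b a' b' => matrix_mul_nonneg (hK a b) (hZ a' b')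
  have n5 := fun a b a' b' a'' b'' => matrix_mul_nonneg (n4 a b a' b') (hT a'' b'')
  have s1 := matrix_add_nonneg (hQ u u) (n1 u (m ∩ G.rest c) u (m ∩ G.rest c))
  have s2 := matrix_add_nonneg s1 (n2 u (m ∩ G.rest c) (m ∩ G.rest c) u)
  have s3 := matrix_add_nonneg s2
    (n3 u (m ∩ G.rest c) (m ∩ G.rest c) (m ∩ G.rest c) u (m ∩ G.rest c))
  simp only [ind_ne_zero]
  rw [matrix_add_ne_zero s3 (n5 _ _ _ _ _ _), matrix_add_ne_zero s2 (n3 _ _ _ _ _ _),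
    matrix_add_ne_zero s1 (n2 _ _ _ _), matrix_add_ne_zero (hQ _ _) (n1 _ _ _ _),
    matrix_mul_ne_zero (hQ _ _) (hT _ _), matrix_mul_ne_zero (hK _ _) (hQ _ _),
    matrix_mul_ne_zero (n2 _ _ _ _) (hT _ _), matrix_mul_ne_zero (n4 _ _ _ _) (hT _ _)]
  simp only [matrix_mul_ne_zero (hK _ _) (hQ _ _), matrix_mul_ne_zero (hK _ _) (hZ _ _),
    Matrix.transpose_apply, blk_ne_zero, s.zer_joined_ne, zer_ne_zero (hl.blk _ _)]
  have hur : ∀ {x}, x ∈ u → x ∈ G.rest c := fun h => ((s.mem_u_iff _).1 h).1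
  have hml : ∀ {x}, x ∈ m → x ∉ m ∩ G.rest c → x ∈ G.full c := fun h h' =>
    (s.mem_marg h).resolve_left fun h'' => h' (Finset.mem_inter.2 ⟨h, h''⟩)
  constructor
  · rintro ((((⟨hi, hj, hq⟩ | ⟨w, ⟨hi, hw, hq⟩, hj, -, hk⟩) | ⟨x, ⟨hi, hx, hk⟩, -, hj, hq⟩) |
      ⟨w, ⟨x, ⟨hi, hx, hk⟩, -, hw, hq⟩, hj, -, hk'⟩) | ⟨w, ⟨x, ⟨hi, hx, hk⟩, -, hw, hz⟩, hj, -, hk'⟩)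
    · exact ⟨hi, hj, .inl ⟨i, hur hi, .inl rfl, j, hur hj, hq, .inl rfl⟩⟩
    · rw [Finset.mem_inter] at hw
      exact ⟨hi, hj, .inl ⟨i, hur hi, .inl rfl, w, hw.2, hq, .inr ⟨hw.1, hk⟩⟩⟩
    · rw [Finset.mem_inter] at hx
      exact ⟨hi, hj, .inl ⟨x, hx.2, .inr ⟨hx.1, hk⟩, j, hur hj, hq, .inl rfl⟩⟩
    · rw [Finset.mem_inter] at hx hw
      exact ⟨hi, hj, .inl ⟨x, hx.2, .inr ⟨hx.1, hk⟩, w, hw.2, hq, .inr ⟨hw.1, hk'⟩⟩⟩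
    · rw [Finset.mem_sdiff] at hx hw
      refine ⟨hi, hj, .inr ⟨w, hml hw.1 hw.2, hw.1, ?_, hk'⟩⟩
      rcases hz with ⟨rfl, -⟩ | hz
      · exact hk
      · exact hk.trans hx.1 (hz.mono Finset.sdiff_subset fun x y h =>
          s.joined_ne.2 (.inr (.inr (blk_ne_zero.1 h))))
  · rintro ⟨hi, hj, ⟨x, hx, rfl | ⟨hxm, hk⟩, w, hw, hq, rfl | ⟨hwm, hk'⟩⟩ | ⟨z, hz, hzm, hk, hk'⟩⟩
    · exact .inl (.inl (.inl (.inl ⟨hi, hj, hq⟩)))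
    · have hw' := Finset.mem_inter.2 ⟨hwm, hw⟩
      exact .inl (.inl (.inl (.inr ⟨w, ⟨hi, hw', hq⟩, hj, hw', hk'⟩)))
    · have hx' := Finset.mem_inter.2 ⟨hxm, hx⟩
      exact .inl (.inl (.inr ⟨x, ⟨hi, hx', hk⟩, hx', hj, hq⟩))
    · have hw' := Finset.mem_inter.2 ⟨hwm, hw⟩
      have hx' := Finset.mem_inter.2 ⟨hxm, hx⟩
      exact .inl (.inr ⟨w, ⟨x, ⟨hi, hx', hk⟩, hx', hw', hq⟩, hj, hw', hk'⟩)
    · have hz' : z ∈ m \ (m ∩ G.rest c) := Finset.mem_sdiff.2 ⟨hzm, fun h =>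
        s.full_not_rest hz (Finset.mem_inter.1 h).2⟩
      exact .inr ⟨z, ⟨z, ⟨hi, hz', hk⟩, hz', hz', .inl ⟨rfl, hz'⟩⟩, hj, hz', hk'⟩

/-- An additional conditioning and marginalising step leads from a summary graph to the one of
the joint conditioning and marginalising sets. -/
theorem condMarg (s : StepData E C M G c m) :
    Represents E (C ∪ c) (M ∪ m) (G.condMarg c m) := by
  have hfu : ∀ {x}, x ∈ G.full c → x ∈ G.u ∨ x ∈ G.v := fun h =>
    (mem_full.1 h).1.imp s.newAn_subset id
  constructor
  · have h1 : ∀ x ∈ G.u ∪ G.v, x ∉ C ∧ x ∉ M := fun x hx => by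
      rcases Finset.mem_union.1 hx with h | h
      · exact ⟨fun hC => ((s.rep.mem_u x).1 h).1 (subset_An _ hC), ((s.rep.mem_u x).1 h).2⟩
      · exact ((s.rep.mem_v x).1 h).2
    rw [Finset.disjoint_left]
    intro x hx hx'
    rcases Finset.mem_union.1 hx with h | h <;> rcases Finset.mem_union.1 hx' with h' | h'
    · exact Finset.disjoint_left.1 s.rep.disj h h'
    · exact (h1 x (s.hm h')).1 h
    · exact (h1 x (s.hc h)).2 h'
    · exact Finset.disjoint_left.1 s.hcm h h'
  · intro i
    rw [s.mem_u_iff, mem_rest, s.mem_newAn, s.rep.mem_u, Finset.coe_union, An_union]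
    simp only [Finset.mem_union, Set.mem_union]
    tauto
  · intro i
    rw [s.mem_v_iff, mem_full, s.mem_newAn, s.rep.mem_u, s.rep.mem_v, Finset.coe_union, An_union]
    have := @subset_An V E C i
    have hd : i ∈ c → i ∉ M := fun h => by
      rcases Finset.mem_union.1 (s.hc h) with h | h
      · exact ((s.rep.mem_u i).1 h).2
      · exact ((s.rep.mem_v i).1 h).2.2
    have hd' : i ∈ m → i ∉ C := fun h => by
      rcases Finset.mem_union.1 (s.hm h) with h | h
      · exact fun hC => ((s.rep.mem_u i).1 h).1 (subset_An _ hC)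
      · exact ((s.rep.mem_v i).1 h).2.1
    simp only [Finset.mem_union, Set.mem_union]
    simp only [Finset.mem_coe] at this
    tauto
  -- Disjointness of the new `u` and `v` keeps the entries of the sum of the two blocks of `H` at
  -- most one.
  · have hd : ∀ i, i ∈ (G.condMarg c m).u → i ∉ (G.condMarg c m).v := fun i h h' =>
      s.full_not_rest ((s.mem_v_iff i).1 h').1 ((s.mem_u_iff i).1 h).1
    intro i k
    have h := unitEntries_zer (m ∩ G.rest c ∪ m \ (m ∩ G.rest c)) (G.joined c) i k
    have : (G.condMarg c m).H =
      blk (G.condMarg c m).u (G.condMarg c m).u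
        (zer (m ∩ G.rest c ∪ m \ (m ∩ G.rest c)) (G.joined c)) +
      blk (G.condMarg c m).u (G.condMarg c m).v
        (zer (m ∩ G.rest c ∪ m \ (m ∩ G.rest c)) (G.joined c)) := rfl
    rw [this, Matrix.add_apply]
    have hk := hd k
    unfold blk
    split_ifs <;> simp_all
  · exact unitEntries_ind _
  · exact (unitEntries_zer _ _).blk _ _
  · intro i j
    rw [s.condMarg_H_ne]
    refine and_congr_right fun hi => ?_
    have hi := ((s.mem_u_iff i).1 hi).1
    have hiu : i ∈ G.u ∨ i ∈ G.v := .inl (mem_rest.1 hi).1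
    constructor
    · rintro ⟨hj | hj, h⟩
      · refine .inl ⟨hj, ?_⟩
        have hj := ((s.mem_u_iff j).1 hj).1
        rcases (s.via_walk h).2 with rfl | ⟨a, b, h, ha, hb⟩
        · exact .inl rfl
        · rw [ha hi, hb hj] at h
          exact .inr h
      · refine .inr ⟨hj, ?_⟩
        have hj := ((s.mem_v_iff j).1 hj).1
        rcases (s.via_walk h).2 with rfl | ⟨a, b, h, ha, hb⟩
        · exact absurd hi (s.full_not_rest hj)
        · rw [ha hi] at h
          exact ⟨b, h⟩
    · rintro (⟨hj, h⟩ | ⟨hj, b, h⟩)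
      · refine ⟨.inl hj, ?_⟩
        rcases h with rfl | h
        · exact .single (s.joined_refl (.inl hi))
        · exact (s.toTail (s.walk_group h) rfl hiu ((s.mem_u_iff j).1 hj).1).2.2
      · exact ⟨.inr hj, ((s.toFull (s.walk_group h) hiu ((s.mem_v_iff j).1 hj).1).rest hi).2⟩
  · intro i j
    rw [s.condMarg_W_ne]
    refine and_congr_right fun hi => and_congr_right fun hj => ?_
    have hi := (s.mem_u_iff i).1 hi
    have hj := (s.mem_u_iff j).1 hj
    constructor
    · have hm : ∀ {x}, x ∈ m → Joint (↑(M ∪ m)) (An E ↑(C ∪ c)) x false true := fun {x} h => by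
        show x ∈ ((M ∪ m : Finset V) : Set V)
        simp [h]
      have hK : ∀ {i x}, i ∈ G.rest c → i ∉ m → x ∈ m → x ∈ G.rest c → Via m (G.joined c) i x →
          CWalk E (C ∪ c) (M ∪ m) i true x false := by
        intro i x hi hi' hx hx' h
        rcases (s.via_walk h).2 with rfl | ⟨a, b, h, ha, hb⟩
        · exact absurd hx hi'
        · rwa [ha hi, hb hx'] at h
      rintro (⟨x, hx, h1, w, hw, hq, h2⟩ | ⟨z, hz, hzm, h1, h2⟩)
      · have h3 : x = w ∨ CWalk E (C ∪ c) (M ∪ m) x true w true := s.dashed_walk hq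
        have h4 : i = w ∨ CWalk E (C ∪ c) (M ∪ m) i true w true ∨
            w ∈ m ∧ CWalk E (C ∪ c) (M ∪ m) i true w false := by
          rcases h1 with rfl | ⟨hxm, h1⟩
          · exact h3.imp id .inl
          · have h1 := hK hi.1 hi.2 hxm hx h1
            rcases h3 with rfl | h3
            · exact .inr (.inr ⟨hxm, h1⟩)
            · exact .inr (.inl (h1.trans (hm hxm) h3))
        rcases h2 with rfl | ⟨hwm, h2⟩
        · exact h4.imp id (Or.rec id fun h => absurd h.1 hj.2)
        · have h2 : CWalk E (C ∪ c) (M ∪ m) w false j true := Walk.symm (hK hj.1 hj.2 hwm hw h2)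
          rcases h4 with rfl | h4 | ⟨-, h4⟩
          · exact absurd hwm hi.2
          · exact .inr (h4.trans (hm hwm).symm h2)
          · exact .inr (h4.trans (c := false) (show w ∈ ((M ∪ m : Finset V) : Set V) by
              simp [hwm]) h2)
      -- The two branches may be joined at `z` whatever their marks are there, since `z` is a
      -- marginalised node of `full`.
      · rcases (s.via_walk h1).2 with rfl | ⟨a, b, h1, ha, -⟩
        · exact absurd hzm hi.2
        rcases (s.via_walk h2).2 with rfl | ⟨a', b', h2, ha', -⟩
        · exact absurd hzm hj.2
        rw [ha hi.1] at h1
        rw [ha' hj.1] at h2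
        exact .inr (h1.trans (s.joint_full hz hzm _ _) h2.symm)
    · rintro (rfl | h)
      · exact .inl ⟨i, hi.1, .inl rfl, i, hi.1, s.dashed_refl (mem_rest.1 hi.1).1, .inl rfl⟩
      · rcases (s.toHead (s.walk_group h) rfl (.inl (mem_rest.1 hi.1).1) hj.1).head hi.1 rfl with
          ⟨x, hx, h1, h2, w, hw, hq, h3, h4⟩ | h
        · exact .inl ⟨x, hx, h1.imp id fun h => ⟨h, h2⟩, w, hw, hq, h3.imp id fun h => ⟨h, h4⟩⟩
        · exact .inr h
  · intro i j
    rw [s.condMarg_S_ne]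
    refine and_congr_right fun hi => and_congr_right fun hj => ?_
    have hi := (s.mem_v_iff i).1 hi
    have hj := (s.mem_v_iff j).1 hj
    constructor
    · intro h
      exact (s.via_walk h).2.imp id fun ⟨a, b, h, _⟩ => ⟨a, b, h⟩
    · rintro (rfl | ⟨a, b, h⟩)
      · exact .single (s.joined_refl (.inr hi.1))
      · exact (s.toFull (s.walk_group h) (hfu hi.1) hj.1).full hi.1

end StepData

end Represents

end Step

/-! ### The summary graph of a parent graph -/

section Parent

variable {V : Type*}

/-- The property depends on zero patterns only, so the matrices of the direct construction may
replace those of a step applied to the parent graph. -/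
lemma Represents.congr {E : V → V → Prop} {C M : Finset V} {G G' : Graph V}
    (s : Represents E C M G) (hu : G'.u = G.u) (hv : G'.v = G.v) (uH : UnitEntries G'.H)
    (uW : UnitEntries G'.W) (uS : UnitEntries G'.S) (hH : ∀ i j, G'.H i j ≠ 0 ↔ G.H i j ≠ 0)
    (hW : ∀ i j, G'.W i j ≠ 0 ↔ G.W i j ≠ 0) (hS : ∀ i j, G'.S i j ≠ 0 ↔ G.S i j ≠ 0) :
    Represents E C M G' where
  disj := s.disj
  mem_u := hu ▸ s.mem_u
  mem_v := hv ▸ s.mem_v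
  unit_H := uH
  unit_W := uW
  unit_S := uS
  H_ne i j := by rw [hH, s.H_ne, hu, hv]
  W_ne i j := by rw [hW, s.W_ne, hu]
  S_ne i j := by rw [hS, s.S_ne, hv]

variable [Fintype V] [DecidableEq V]

/-- The parent graph as a summary graph. -/
def parentGraph (A : Matrix V V ℝ) : Graph V := ⟨Finset.univ, ∅, A, 1, 0⟩

/-- With nothing conditioned on and nothing marginalised over, no joint is admissible. Every walk is
then a single arrow, and dashed lines occur only on the diagonal. -/
lemma represents_parentGraph {A : Matrix V V ℝ} (hA : UnitEntries A) (hd : ∀ i, A i i ≠ 0) :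
    Represents (Arrow A) ∅ ∅ (parentGraph A) := by
  have hAn : An (Arrow A) ((∅ : Finset V) : Set V) = ∅ := by
    ext x; simp [An]
  have hw : ∀ {i j : V} {a b : Bool}, CWalk (Arrow A) ∅ ∅ i a j b → Edge (Arrow A) i a j b := by
    intro i j a b h
    cases h with
    | single h => exact h
    | @cons _ _ y b c _ _ _ h =>
      exfalso
      rw [hAn] at h
      cases b <;> cases c <;> simp [Joint] at h
  refine ⟨by simp, fun i => by rw [hAn]; simp [parentGraph],
    fun i => by rw [hAn]; simp [parentGraph], hA, fun i k => ?_, fun i k => by simp [parentGraph],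
    fun i j => ?_, fun i j => ?_, fun i j => by simp [parentGraph]⟩
  · simp only [parentGraph, Matrix.one_apply]
    split_ifs <;> simp
  · simp only [parentGraph, Finset.mem_univ, true_and, Finset.notMem_empty, false_and, or_false]
    constructor
    · intro h
      by_cases hij : i = j
      · exact .inl hij
      · exact .inr (.single (.inl ⟨rfl, rfl, hij, h⟩))
    · rintro (rfl | h)
      · exact hd i
      · rcases hw h with ⟨-, -, h⟩ | ⟨h, -⟩
        · exact h.2
        · simp at h
  · simp only [parentGraph, Finset.mem_univ, true_and, Matrix.one_apply]
    constructor
    · intro h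
      exact .inl (by_contra fun h' => by simp [h'] at h)
    · rintro (rfl | h)
      · simp
      · rcases hw h with ⟨-, h, -⟩ | ⟨h, -⟩ <;> simp at h

open Represents

/-- The summary graph of a parent graph represents its walks. -/
lemma represents_ofParent {A : Matrix V V ℝ} (hA : UnitEntries A) (hd : ∀ i, A i i ≠ 0)
    (hE : ∀ x, ¬ Relation.TransGen (Arrow A) x x) {C M : Finset V} (hCM : Disjoint C M) :
    Represents (Arrow A) C M (ofParent A C M) := by
  -- The parent graph is itself a summary graph with `v` empty, and a single step from it has the
  -- required conditioning and marginalising sets. What remains is to compare zero patterns.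
  have s : StepData (Arrow A) ∅ ∅ (parentGraph A) C M :=
    ⟨represents_parentGraph hA hd, hE, by simp [parentGraph], by simp [parentGraph], hCM⟩
  set G := parentGraph A with hG
  set F := foster A C with hF
  set R := C ∪ F with hR
  have eR : G.newAn C = R := by simp [Graph.newAn, hG, parentGraph, hR, hF]
  have eO : G.rest C = Rᶜ := by
    rw [Graph.rest, eR]; ext x; simp [hG, parentGraph]
  have eF : G.full C = F := by
    rw [Graph.full, eR]
    ext x
    have : x ∈ F → x ∉ C := fun h => (Finset.mem_sdiff.1 h).2
    simp only [hG, parentGraph, hR, Finset.mem_sdiff, Finset.mem_union, Finset.notMem_empty]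
    tauto
  set p := M ∩ Rᶜ with hp
  set q := M ∩ F with hq
  have eq : M \ (M ∩ G.rest C) = q := by
    rw [eO]
    ext x
    have : x ∈ C → x ∉ M := fun h => Finset.disjoint_left.1 hCM h
    simp only [hq, hR, Finset.mem_sdiff, Finset.mem_inter, Finset.mem_compl, Finset.mem_union]
    tauto
  -- Since `W` is the identity, closing dashed paths adds nothing.
  have hdash : ∀ {i j}, G.dashed C i j ≠ 0 ↔ i = j := by
    intro i j
    rw [s.dashed_ne]
    constructor
    · intro h
      have h1 : ∀ {i j : V}, G.W i j ≠ 0 → i = j := by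
        intro i j h
        by_contra h'
        exact h (Matrix.one_apply_ne h')
      induction h with
      | single h => exact h1 h
      | cons h _ _ ih => exact (h1 h).trans ih
    · rintro rfl
      exact .single (by simp [hG, parentGraph])
  set A1 := blk Rᶜ (Rᶜ ∪ F) A with hA1
  set SR := ind ((blk R R A).transpose * blk R R A) with hSR
  have hFR : ∀ {x}, x ∈ F → x ∈ R := fun h => Finset.mem_union_right _ h
  have hSR_ne : ∀ {i j}, i ∈ F → j ∈ F → (SR i j ≠ 0 ↔ G.lines C i j ≠ 0) := by
    intro i j hi hj
    have n := blk_nonneg hA.nonneg R R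
    rw [hSR, ind_ne_zero, matrix_mul_ne_zero (matrix_transpose_nonneg n) n, s.lines_ne, eR]
    simp only [Matrix.transpose_apply, blk_ne_zero, hdash]
    constructor
    · rintro ⟨w, ⟨hw, -, h1⟩, -, -, h2⟩
      exact ⟨.inl (hFR hi), .inl (hFR hj), .inl ⟨w, hw, w, hw, h1, rfl, h2⟩⟩
    · rintro ⟨-, -, ⟨w, hw, w', -, h1, rfl, h2⟩ | h⟩
      · exact ⟨w, ⟨hw, hFR hi, h1⟩, hw, hFR hj, h2⟩
      · simp [hG, parentGraph] at h
  have hB : ∀ {i j}, G.joined C i j ≠ 0 ↔ A1 i j ≠ 0 ∨ blk F F SR i j ≠ 0 := by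
    intro i j
    rw [s.joined_ne, s.arrows_ne, eO, eF, hA1, blk_ne_zero, blk_ne_zero, Finset.mem_union]
    constructor
    · rintro (⟨h1, h2, h3⟩ | ⟨h1, h2, -, -, h3 | ⟨w, hw, h3, -⟩⟩ | ⟨h1, h2, h3⟩)
      · exact .inl ⟨h1, .inl h2, h3⟩
      · exact .inl ⟨h1, .inr h2, h3⟩
      · rw [hdash] at h3
        subst h3
        rw [eR] at hw
        exact absurd hw (Finset.mem_compl.1 h1)
      · exact .inr ⟨h1, h2, (hSR_ne h1 h2).2 h3⟩
    · rintro (⟨h1, h2 | h2, h3⟩ | ⟨h1, h2, h3⟩)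
      · exact .inl ⟨h1, h2, h3⟩
      · exact .inr (.inl ⟨h1, h2, h1, .inl (by rw [eR]; exact hFR h2), .inl h3⟩)
      · exact .inr (.inr ⟨h1, h2, (hSR_ne h1 h2).1 h3⟩)
  have uA1 : UnitEntries A1 := hA.blk _ _
  have uSF : UnitEntries (blk F F SR) := (unitEntries_ind _).blk _ _
  have hpM : p ⊆ M := Finset.inter_subset_left
  have hqM : q ⊆ M := Finset.inter_subset_left
  have toF : ∀ {i j}, i ∈ F → (Via M (G.joined C) i j ↔ Via q (blk F F SR) i j) := by
    intro i j hi
    constructor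
    · intro h
      have := s.via_lines h (by rwa [eF])
      rw [eq, eF] at this
      refine this.mono subset_rfl fun x y h => ?_
      rw [blk_ne_zero] at h ⊢
      exact ⟨h.1, h.2.1, (hSR_ne h.1 h.2.1).2 h.2.2⟩
    · exact fun h => h.mono hqM fun x y h => hB.2 (.inr h)
  have toO : ∀ {i j}, i ∈ Rᶜ → j ∈ Rᶜ → (Via M (G.joined C) i j ↔ Via p A1 i j) := by
    intro i j _ hj
    have hl : ∀ {i x}, x ∈ Rᶜ → G.joined C i x ≠ 0 → A1 i x ≠ 0 := by
      intro i x hx h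
      refine (hB.1 h).resolve_right fun h => ?_
      exact Finset.mem_compl.1 hx (hFR (blk_ne_zero.1 h).2.1)
    constructor
    · intro h
      induction h with
      | single h => exact .single (hl hj h)
      | @cons i x j h hx h' ih =>
        have hxO : x ∈ Rᶜ := by
          have := (s.via_walk h').1
          rw [eO] at this
          exact this hj
        exact .cons (hl hxO h) (Finset.mem_inter.2 ⟨hx, hxO⟩) (ih hxO hj)
    · exact fun h => h.mono hpM fun x y h => hB.2 (.inl h)
  -- The path is split at its first node in `F`, from where it never returns to the complement of
  -- `R`. The direct construction multiplies the matrices of the two parts instead of closing over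
  -- `p` and `q` at once.
  have toOF : ∀ {i j}, i ∈ Rᶜ → j ∈ F → (Via M (G.joined C) i j ↔ Via p A1 i j ∨
      ∃ x ∈ q, Via p A1 i x ∧ Via q (blk F F SR) x j) := by
    intro i j hi hj
    constructor
    · intro h
      induction h with
      | single h =>
        refine .inl (.single ((hB.1 h).resolve_right fun h => ?_))
        exact Finset.mem_compl.1 hi (hFR (blk_ne_zero.1 h).1)
      | @cons i x j h hx h' ih =>
        have h := (hB.1 h).resolve_right fun h =>
          Finset.mem_compl.1 hi (hFR (blk_ne_zero.1 h).1)
        rcases Finset.mem_union.1 (blk_ne_zero.1 h).2.1 with hxO | hxF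
        · have hxp : x ∈ p := Finset.mem_inter.2 ⟨hx, hxO⟩
          rcases ih hxO hj with h' | ⟨z, hz, h1, h2⟩
          · exact .inl (.cons h hxp h')
          · exact .inr ⟨z, hz, .cons h hxp h1, h2⟩
        · exact .inr ⟨x, Finset.mem_inter.2 ⟨hx, hxF⟩, .single h, (toF hxF).1 h'⟩
    · rintro (h | ⟨x, hx, h1, h2⟩)
      · exact h.mono hpM fun x y h => hB.2 (.inl h)
      · exact (h1.mono hpM fun x y h => hB.2 (.inl h)).trans (hqM hx)
          (h2.mono hqM fun x y h => hB.2 (.inr h))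
  set u := Rᶜ \ p with hu
  set v := F \ q with hv
  have eu : (G.condMarg C M).u = u := by
    rw [Graph.condMarg_eq, eO]
  have ev : (G.condMarg C M).v = v := by
    have : (G.condMarg C M).v = G.full C \ (M \ (M ∩ G.rest C)) := rfl
    rw [this, eq, eF]
  set D := zer p A1 with hD
  set Z := zer q (blk F F SR) with hZ
  have hD_ne : ∀ {i j}, i ∈ u → (D i j ≠ 0 ↔ Via p A1 i j) := by
    intro i j hi
    rw [hD, zer_ne_zero uA1, or_iff_right_of_imp]
    exact fun h => absurd h.2 (Finset.mem_sdiff.1 hi).2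
  have hZ_ne : ∀ {i j}, Z i j ≠ 0 ↔ (i = j ∧ i ∈ q) ∨ Via q (blk F F SR) i j := zer_ne_zero uSF
  have huO : ∀ {x}, x ∈ u → x ∈ Rᶜ := fun h => (Finset.mem_sdiff.1 h).1
  have hvF : ∀ {x}, x ∈ v → x ∈ F := fun h => (Finset.mem_sdiff.1 h).1
  have hqF : ∀ {x}, x ∈ q → x ∈ F := fun h => (Finset.mem_inter.1 h).2
  have huM : ∀ {x}, x ∈ u → x ∉ M := fun h hM =>
    (Finset.mem_sdiff.1 h).2 (Finset.mem_inter.2 ⟨hM, huO h⟩)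
  have nD := fun a b => blk_nonneg (unitEntries_zer p A1).nonneg a b
  have nZ := fun a b => blk_nonneg (unitEntries_zer q (blk F F SR)).nonneg a b
  have nT := fun a b => matrix_transpose_nonneg (nD a b)
  have n1 : ∀ i j : V, 0 ≤ (blk u u 1 : Matrix V V ℝ) i j := blk_nonneg (fun i j => by
    rw [Matrix.one_apply]; split_ifs <;> simp) _ _
  have s' := s.condMarg
  rw [Finset.empty_union, Finset.empty_union] at s'
  refine s'.congr (by rw [eu]; rfl) (by rw [ev]; rfl) (unitEntries_ind _) (unitEntries_ind _)
    ((unitEntries_zer _ _).blk _ _) ?_ ?_ ?_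
  · intro i j
    have e : (ofParent A C M).H = ind (blk u u D + (blk u v D + blk u q D * blk q v Z)) := rfl
    rw [s.condMarg_H_ne, eu, ev, e, ind_ne_zero, matrix_add_ne_zero (nD _ _)
      (matrix_add_nonneg (nD _ _) (matrix_mul_nonneg (nD _ _) (nZ _ _))),
      matrix_add_ne_zero (nD _ _) (matrix_mul_nonneg (nD _ _) (nZ _ _)),
      matrix_mul_ne_zero (nD _ _) (nZ _ _)]
    simp only [blk_ne_zero]
    constructor
    · rintro (⟨hi, hj, h⟩ | ⟨hi, hj, h⟩ | ⟨x, ⟨hi, hx, h⟩, -, hj, h'⟩)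
      · exact ⟨hi, .inl hj, (toO (huO hi) (huO hj)).2 ((hD_ne hi).1 h)⟩
      · exact ⟨hi, .inr hj, (toOF (huO hi) (hvF hj)).2 (.inl ((hD_ne hi).1 h))⟩
      · refine ⟨hi, .inr hj, (toOF (huO hi) (hvF hj)).2 ?_⟩
        rcases hZ_ne.1 h' with ⟨rfl, -⟩ | h'
        · exact .inl ((hD_ne hi).1 h)
        · exact .inr ⟨x, hx, (hD_ne hi).1 h, h'⟩
    · rintro ⟨hi, hj | hj, h⟩
      · exact .inl ⟨hi, hj, (hD_ne hi).2 ((toO (huO hi) (huO hj)).1 h)⟩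
      · rcases (toOF (huO hi) (hvF hj)).1 h with h | ⟨x, hx, h, h'⟩
        · exact .inr (.inl ⟨hi, hj, (hD_ne hi).2 h⟩)
        · exact .inr (.inr ⟨x, ⟨hi, hx, (hD_ne hi).2 h⟩, hx, hj, hZ_ne.2 (.inr h')⟩)
  · intro i j
    have e : (ofParent A C M).W = ind ((blk u u 1 + blk u p D * (blk u p D).transpose)
          + blk u q D * blk q q Z * (blk u q D).transpose) := rfl
    rw [s.condMarg_W_ne, eu, e, ind_ne_zero, matrix_add_ne_zero (matrix_add_nonneg n1
      (matrix_mul_nonneg (nD _ _) (nT _ _)))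
      (matrix_mul_nonneg (matrix_mul_nonneg (nD _ _) (nZ _ _)) (nT _ _)),
      matrix_add_ne_zero n1 (matrix_mul_nonneg (nD _ _) (nT _ _)),
      matrix_mul_ne_zero (nD _ _) (nT _ _),
      matrix_mul_ne_zero (matrix_mul_nonneg (nD _ _) (nZ _ _)) (nT _ _)]
    simp only [matrix_mul_ne_zero (nD _ _) (nZ _ _), Matrix.transpose_apply, blk_ne_zero, hdash,
      eO, eF]
    constructor
    · rintro ((⟨hi, hj, h⟩ | ⟨x, ⟨hi, hx, h⟩, hj, -, h'⟩) |
        ⟨y, ⟨x, ⟨hi, hx, h⟩, -, hy, h'⟩, hj, -, h''⟩)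
      · refine ⟨hi, hj, .inl ⟨i, huO hi, .inl rfl, i, huO hi, rfl, .inl ?_⟩⟩
        by_contra hij
        exact h (Matrix.one_apply_ne hij)
      · obtain ⟨hxM, hxO⟩ := Finset.mem_inter.1 hx
        exact ⟨hi, hj, .inl ⟨x, hxO, .inr ⟨hxM, (toO (huO hi) hxO).2 ((hD_ne hi).1 h)⟩, x, hxO, rfl,
          .inr ⟨hxM, (toO (huO hj) hxO).2 ((hD_ne hj).1 h')⟩⟩⟩
      · refine ⟨hi, hj, .inr ⟨y, hqF hy, hqM hy, (toOF (huO hi) (hqF hy)).2 ?_,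
          (toOF (huO hj) (hqF hy)).2 (.inl ((hD_ne hj).1 h''))⟩⟩
        rcases hZ_ne.1 h' with ⟨rfl, -⟩ | h'
        · exact .inl ((hD_ne hi).1 h)
        · exact .inr ⟨x, hx, (hD_ne hi).1 h, h'⟩
    · rintro ⟨hi, hj, ⟨x, hx, h, w, hw, rfl, h'⟩ | ⟨z, hz, hzM, h, h'⟩⟩
      · rcases h with rfl | ⟨hxM, h⟩ <;> rcases h' with rfl | ⟨hwM, h'⟩
        · exact .inl (.inl ⟨hi, hj, by simp⟩)
        · exact absurd hwM (huM hi)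
        · exact absurd hxM (huM hj)
        · have hxp : x ∈ p := Finset.mem_inter.2 ⟨hxM, hx⟩
          exact .inl (.inr ⟨x, ⟨hi, hxp, (hD_ne hi).2 ((toO (huO hi) hx).1 h)⟩, hj, hxp,
            (hD_ne hj).2 ((toO (huO hj) hx).1 h')⟩)
      · have hzq : z ∈ q := Finset.mem_inter.2 ⟨hzM, hz⟩
        -- The paths from `i` and from `j` to the common node `z` enter `F` at nodes `x` and `y` of
        -- `q`. As the full lines are symmetric, `x` and `y` are linked through `z`, which yields
        -- the entry of `Z` between them.
        have key : ∀ {i}, i ∈ u → Via M (G.joined C) i z → ∃ x ∈ q, Via p A1 i x ∧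
            (x = z ∨ Via q (blk F F SR) x z) := by
          intro i hi h
          rcases (toOF (huO hi) hz).1 h with h | ⟨x, hx, h, h'⟩
          · exact ⟨z, hzq, h, .inl rfl⟩
          · exact ⟨x, hx, h, .inr h'⟩
        obtain ⟨x, hx, h1, h2⟩ := key hi h
        obtain ⟨y, hy, h3, h4⟩ := key hj h'
        have hsym : ∀ x y, blk F F SR x y ≠ 0 → blk F F SR y x ≠ 0 := by
          intro x y h
          rw [blk_ne_zero] at h ⊢
          exact ⟨h.2.1, h.1, (hSR_ne h.2.1 h.1).2 (s.lines_symm ((hSR_ne h.1 h.2.1).1 h.2.2))⟩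
        refine .inr ⟨y, ⟨x, ⟨hi, hx, (hD_ne hi).2 h1⟩, hx, hy, hZ_ne.2 ?_⟩, hj, hy,
          (hD_ne hj).2 h3⟩
        rcases h2 with rfl | h2 <;> rcases h4 with rfl | h4
        · exact .inl ⟨rfl, hx⟩
        · exact .inr (h4.symm hsym)
        · exact .inr h2
        · exact .inr (h2.trans hzq (h4.symm hsym))
  · intro i j
    have e : (ofParent A C M).S = blk v v Z := rfl
    rw [s.condMarg_S_ne, ev, e, blk_ne_zero, hZ_ne]
    refine and_congr_right fun hi => and_congr_right fun hj => ?_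
    rw [toF (hvF hi), or_iff_right_of_imp]
    exact fun h => absurd h.2 (Finset.mem_sdiff.1 hi).2

/-- Every generated summary graph represents the walks of the parent graph. -/
theorem Generated.represents {A : Matrix V V ℝ} (hA : UnitEntries A) (hd : ∀ i, A i i ≠ 0)
    (hE : ∀ x, ¬ Relation.TransGen (Arrow A) x x) {C M : Finset V} {G : Graph V}
    (h : Generated A C M G) : Represents (Arrow A) C M G := by
  induction h with
  | ofParent C M hCM => exact represents_ofParent hA hd hE hCM
  | condMarg c m c' m' G _ hc hm hcm ih =>
    exact StepData.condMarg ⟨ih, hE, hc, hm, hcm⟩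

end Parent

/-! ### Connecting walks and the edges of a summary graph -/

section Connect

variable {V : Type*} {E : V → V → Prop} {C M : Finset V} {G : Graph V}

namespace Represents

lemma edge_of_v (s : Represents E C M G) {x y : V} {a b : Bool} (h : CWalk E C M x a y b)
    (hx : x ∈ G.v) (hy : y ∈ G.u ∨ y ∈ G.v) :
    (y ∈ G.u ∧ b = true) ∨ (y ∈ G.v ∧ G.S x y ≠ 0) := by
  have hxu : x ∉ G.u := fun h => s.not_mem_v h hx
  have := s.edge_cases h (.inr hx) hy
  simp only [hxu, hx, false_and, true_and, false_or] at this
  tauto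

lemma edge_of_tail (s : Represents E C M G) {x y : V} {b : Bool} (h : CWalk E C M x false y b)
    (hx : x ∈ G.u) (hy : y ∈ G.u ∨ y ∈ G.v) :
    y ∈ G.u ∧ b = true ∧ Relation.TransGen E y x := by
  obtain ⟨h1, h2⟩ := of_tail h ((s.mem_u x).1 hx).1
  refine ⟨hy.resolve_right fun hy => ?_, h1, h2⟩
  exact ((s.mem_u x).1 hx).1 (An_of_transGen h2 ((s.mem_v y).1 hy).1)

lemma edge_of_head (s : Represents E C M G) {x y : V} {b : Bool} (h : CWalk E C M x true y b)
    (hx : x ∈ G.u) (hy : y ∈ G.u ∨ y ∈ G.v) :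
    (y ∈ G.u ∧ b = true ∧ G.W x y ≠ 0) ∨
    (y ∈ G.u ∧ b = false ∧ G.H x y ≠ 0 ∧ Relation.TransGen E x y) ∨
    (y ∈ G.v ∧ G.H x y ≠ 0) := by
  have hxv := s.not_mem_v hx
  rcases s.edge_cases h (.inl hx) hy with h1 | h1 | h1 | h1 | h1 | h1
  · exact .inl ⟨h1.2.1, h1.2.2.2⟩
  · obtain ⟨-, hy, -, rfl, h2⟩ := h1
    exact .inr (.inl ⟨hy, rfl, h2, (of_head_tail h ((s.mem_u y).1 hy).1).2⟩)
  · exact absurd h1.2.2.1 (by simp)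
  · exact .inr (.inr ⟨h1.2.1, h1.2.2.2⟩)
  · exact absurd h1.1 hxv
  · exact absurd h1.1 hxv

/-- Connecting walks as sequences of edges of the summary graph. -/
lemma walk_iff {γ X Y : Set V} (h1 : γᶜ = ↑M ∪ X)
    (h2 : γ ⊆ An E (C : Set V) ∪ Y) (h3 : An E (C : Set V) ∪ Y ⊆ An E γ) {i j : V} {a b : Bool} :
    Walk E γᶜ γ i a j b ↔ GWalk (CWalk E C M) X Y i a j b := by
  rw [walk_iff_of_subset_An h2 h3, h1]
  exact ⟨GWalk.group, GWalk.flatten⟩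

variable [DecidableEq V]

/-- Every node belongs to exactly one of `C`, `M`, `u` and `v`, so the nodes not conditioned on are
those of `M` and the remaining ones of the summary graph. -/
lemma compl_union_coe (s : Represents E C M G) {T X : Finset V} (hT : T ⊆ G.u ∪ G.v)
    (hX : (G.u ∪ G.v) \ T = X) : (↑(C ∪ T) : Set V)ᶜ = ↑M ∪ ↑X := by
  subst hX
  ext x
  have h1 := s.mem_u x
  have h2 := s.mem_v x
  have h3 : x ∈ C → x ∉ M := fun h => Finset.disjoint_left.1 s.disj h
  have h4 : x ∈ C → x ∈ An E (C : Set V) := fun h => subset_An _ h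
  have h5 := @hT x
  simp only [Set.mem_compl_iff, Finset.mem_coe, Finset.mem_union, Finset.mem_sdiff,
    Set.mem_union] at *
  by_cases a : x ∈ C <;> by_cases b : x ∈ M <;> by_cases c : x ∈ T <;>
    by_cases d : x ∈ An E (C : Set V) <;> simp_all

/-- Full lines. -/
theorem conn_full (s : Represents E C M G) {i : V} (hi : i ∈ G.v) {β : Finset V} (hβ : β ⊆ G.v)
    (hiβ : i ∉ β) :
    (∃ k ∈ β, Conn E ↑(C ∪ (G.v \ ({i} ∪ β))) i k) ↔ ∃ k ∈ β, G.S i k ≠ 0 := by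
  have hw : ∀ {j k a b}, Walk E (↑(C ∪ (G.v \ ({i} ∪ β))))ᶜ ↑(C ∪ (G.v \ ({i} ∪ β))) j a k b ↔
      GWalk (CWalk E C M) (↑(G.u ∪ ({i} ∪ β))) ∅ j a k b := by
    refine walk_iff ?_ ?_ ?_
    · refine s.compl_union_coe (Finset.sdiff_subset.trans Finset.subset_union_right) ?_
      ext x
      have h1 := @hβ x
      have h2 : x ∈ G.u → x ∉ G.v := s.not_mem_v
      simp only [Finset.mem_union, Finset.mem_sdiff, Finset.mem_singleton]
      by_cases x = i <;> grind
    · intro x hx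
      rcases Finset.mem_union.1 (Finset.mem_coe.1 hx) with h | h
      · exact .inl (subset_An _ h)
      · exact .inl ((s.mem_v x).1 (Finset.mem_sdiff.1 h).1).1
    · rw [Set.union_empty]
      exact An_mono (by simp)
  have hX : ∀ {y : V}, y ∈ G.u ∪ ({i} ∪ β) → y ∈ G.u ∨ y = i ∨ y ∈ β := by
    intro y hy
    simpa only [Finset.mem_union, Finset.mem_singleton] using hy
  constructor
  · rintro ⟨k, hk, a, b, h0⟩
    rw [hw] at h0
    -- No joint may be a collider here. An edge from `v` into `u` arrives with an arrowhead, so the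
    -- walk goes on by a tail and descends within `u` for ever, never to return to `v`. Hence it
    -- moves within `{i} ∪ β`, and its first step into `β` after the last visit of `i` is a full
    -- line. That node need not be the end of the walk.
    have key : ∀ {x a k b}, GWalk (CWalk E C M) (↑(G.u ∪ ({i} ∪ β))) ∅ x a k b → k ∈ β →
        (x = i → ∃ k ∈ β, G.S i k ≠ 0) ∧ (x ∈ G.u → a = false → False) := by
      intro x a k b h hk
      induction h with
      | @single x a k b h =>
        have hkv := hβ hk
        have hku : k ∉ G.u := fun h => s.not_mem_v h hkv
        constructor
        · rintro rfl
          rcases s.edge_of_v h hi (.inr hkv) with h | h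
          exacts [absurd h.1 hku, ⟨k, hk, h.2⟩]
        · rintro hx rfl
          exact hku (s.edge_of_tail h hx (.inr hkv)).1
      | @cons x a y b c k d h hm _ ih =>
        have hmX : y ∈ G.u ∪ ({i} ∪ β) := by
          cases b <;> cases c
          exacts [hm, hm, hm, absurd hm (by simp [Joint])]
        have hc : b = true → c = false := by
          rintro rfl
          cases c
          exacts [rfl, absurd hm (by simp [Joint])]
        have ih := ih hk
        have hy : y ∈ G.u ∨ y ∈ G.v := (hX hmX).imp id fun h => by
          rcases h with rfl | h
          exacts [hi, hβ h]
        constructor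
        · rintro rfl
          rcases s.edge_of_v h hi hy with ⟨hyu, hb⟩ | ⟨hyv, hS⟩
          · exact (ih.2 hyu (hc hb)).elim
          · rcases hX hmX with h | h | h
            · exact absurd hyv (s.not_mem_v h)
            · exact ih.1 h
            · exact ⟨y, h, hS⟩
        · rintro hx rfl
          obtain ⟨h1, h2, -⟩ := s.edge_of_tail h hx hy
          exact ih.2 h1 (hc h2)
    exact (key h0 hk).1 rfl
  · rintro ⟨k, hk, h⟩
    obtain ⟨-, -, rfl | ⟨a, b, h⟩⟩ := (s.S_ne i k).1 h
    · exact absurd hk hiβ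
    · exact ⟨k, hk, a, b, hw.2 (.single h)⟩

variable [Fintype V]

lemma mem_ancU (s : Represents E C M G) (hE : ∀ x, ¬ Relation.TransGen E x x) {i x : V}
    (hi : i ∈ G.u) : x ∈ G.ancU i ↔ x ∈ G.u ∧ Relation.TransGen E i x := by
  rw [Graph.ancU, Finset.mem_inter, and_comm]
  exact and_congr_right fun hx => s.mem_anc hE hi hx

/-- Arrows from full line nodes. -/
theorem conn_arrow (s : Represents E C M G) (hE : ∀ x, ¬ Relation.TransGen E x x) {i : V}
    (hi : i ∈ G.u) {β : Finset V} (hβ : β ⊆ G.v) :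
    (∃ k ∈ β, Conn E ↑(C ∪ (G.v \ β)) i k) ↔ ∃ k ∈ β, margin (G.ancU i) G.H i k ≠ 0 := by
  have hmem := fun x => s.mem_ancU hE hi (x := x)
  have hw : ∀ {j k a b}, Walk E (↑(C ∪ (G.v \ β)))ᶜ ↑(C ∪ (G.v \ β)) j a k b ↔
      GWalk (CWalk E C M) (↑(G.u ∪ β)) ∅ j a k b := by
    refine walk_iff ?_ ?_ ?_
    · refine s.compl_union_coe (Finset.sdiff_subset.trans Finset.subset_union_right) ?_
      ext x
      have h1 := @hβ x
      have h2 : x ∈ G.u → x ∉ G.v := s.not_mem_v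
      simp only [Finset.mem_union, Finset.mem_sdiff]
      grind
    · intro x hx
      rcases Finset.mem_union.1 (Finset.mem_coe.1 hx) with h | h
      · exact .inl (subset_An _ h)
      · exact .inl ((s.mem_v x).1 (Finset.mem_sdiff.1 h).1).1
    · rw [Set.union_empty]
      exact An_mono (by simp)
  have hia : i ∉ G.ancU i := fun h => hE i ((hmem i).1 h).2
  constructor
  · rintro ⟨k, hk, a, b, h0⟩
    rw [hw] at h0
    -- Without colliders, an edge that arrives at `u` with an arrowhead would have to be followed by
    -- a tail, and descending never leads to `v`. So the walk climbs by arrows only, up to its first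
    -- node in `β`.
    have key : ∀ {x a k b}, GWalk (CWalk E C M) (↑(G.u ∪ β)) ∅ x a k b → k ∈ β → x ∈ G.u →
        a = true ∧ ∃ k ∈ β, Via G.u G.H x k := by
      intro x a k b h hk hx
      induction h with
      | @single x a k b h =>
        have hkv := hβ hk
        have hku : k ∉ G.u := fun h => s.not_mem_v h hkv
        cases a with
        | false => exact absurd (s.edge_of_tail h hx (.inr hkv)).1 hku
        | true =>
          rcases s.edge_of_head h hx (.inr hkv) with h | h | h
          exacts [absurd h.1 hku, absurd h.1 hku, ⟨rfl, k, hk, .single h.2⟩]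
      | @cons x a y b c k d h hm _ ih =>
        have hmX : y ∈ G.u ∨ y ∈ β := by
          rw [← Finset.mem_union]
          cases b <;> cases c
          exacts [hm, hm, hm, absurd hm (by simp [Joint])]
        have hc : b = true → c ≠ true := by
          rintro rfl rfl
          exact absurd hm (by simp [Joint])
        have hy : y ∈ G.u ∨ y ∈ G.v := hmX.imp id fun h => hβ h
        cases a with
        | false =>
          obtain ⟨h1, h2, -⟩ := s.edge_of_tail h hx hy
          exact absurd (ih hk h1).1 (hc h2)
        | true =>
          refine ⟨rfl, ?_⟩
          rcases s.edge_of_head h hx hy with ⟨h1, h2, -⟩ | ⟨h1, h2, h3, -⟩ | ⟨h1, h2⟩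
          · exact absurd (ih hk h1).1 (hc h2)
          · obtain ⟨-, k, hk, h4⟩ := ih hk h1
            exact ⟨k, hk, .cons h3 h1 h4⟩
          · exact ⟨y, hmX.resolve_left fun h => s.not_mem_v h h1, .single h2⟩
    obtain ⟨-, k, hk, h1⟩ := key h0 hk hi
    refine ⟨k, hk, (margin_ne_zero s.unit_H).2 ⟨hia, fun h => ?_, ?_⟩⟩
    · exact s.not_mem_v ((hmem k).1 h).1 (hβ hk)
    -- A nontrivial step of `H` within `u` leads to an ancestor, so the inner nodes of the path are
    -- ancestors of `i`. Diagonal steps are dropped.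
    · have key2 : ∀ {x}, Via G.u G.H x k → (x = i ∨ x ∈ G.ancU i) → Via (G.ancU i) G.H x k := by
        intro x h hx
        clear hk h1
        induction h with
        | single h => exact .single h
        | @cons x y k h hy _ ih =>
          have hxy := s.reflTransGen_of_H h hy
          rcases Relation.reflTransGen_iff_eq_or_transGen.1 hxy with rfl | hxy
          · exact ih hx
          · have hyc : y ∈ G.ancU i := by
              refine (hmem y).2 ⟨hy, ?_⟩
              rcases hx with rfl | hx
              exacts [hxy, ((hmem x).1 hx).2.trans hxy]
            exact .cons h hyc (ih (.inr hyc))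
      exact key2 h1 (.inl rfl)
  · rintro ⟨k, hk, h⟩
    obtain ⟨-, -, h⟩ := (margin_ne_zero s.unit_H).1 h
    have key : ∀ {x k}, Via (G.ancU i) G.H x k → k ∈ G.v →
        ∃ b, GWalk (CWalk E C M) (↑(G.u ∪ β)) ∅ x true k b := by
      intro x k h hk
      induction h with
      | single h =>
        obtain ⟨-, ⟨h, -⟩ | ⟨-, b, h⟩⟩ := (s.H_ne _ _).1 h
        · exact absurd hk (s.not_mem_v h)
        · exact ⟨b, .single h⟩
      | @cons x y k h hy _ ih =>
        obtain ⟨b, ih⟩ := ih hk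
        have hyu := ((hmem y).1 hy).1
        obtain ⟨-, ⟨-, rfl | h⟩ | ⟨h, -⟩⟩ := (s.H_ne _ _).1 h
        · exact ⟨b, ih⟩
        · refine ⟨b, .cons h ?_ ih⟩
          show y ∈ (↑(G.u ∪ β) : Set V)
          simp [hyu]
        · exact absurd h (s.not_mem_v hyu)
    obtain ⟨b, h⟩ := key h (hβ hk)
    exact ⟨k, hk, true, b, hw.2 h⟩

omit [Fintype V] in
/-- Dashed lines. -/
theorem conn_dashed (s : Represents E C M G) {i l : V}
    (hi : i ∈ G.u) (hl : l ∈ G.u) (hil : i ≠ l) {e : Finset V} (he : e ⊆ G.u) (hie : i ∉ e)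
    (hle : l ∉ e) (hcl : ∀ x y, (x = i ∨ x = l ∨ x ∈ e) → y ∈ G.u → Relation.TransGen E x y →
      y ∈ e) :
    Conn E ↑(C ∪ G.v ∪ e) i l ↔ Via e G.W i l := by
  have hw : ∀ {j k a b}, Walk E (↑(C ∪ G.v ∪ e))ᶜ ↑(C ∪ G.v ∪ e) j a k b ↔
      GWalk (CWalk E C M) (↑(G.u \ e)) ↑e j a k b := by
    refine walk_iff ?_ ?_ ?_
    · rw [Finset.union_assoc]
      refine s.compl_union_coe (Finset.union_subset Finset.subset_union_right
        (he.trans Finset.subset_union_left)) ?_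
      ext x
      have h2 : x ∈ G.u → x ∉ G.v := s.not_mem_v
      simp only [Finset.mem_union, Finset.mem_sdiff]
      grind
    · intro x hx
      simp only [Finset.mem_coe, Finset.mem_union] at hx
      rcases hx with (h | h) | h
      · exact .inl (subset_An _ h)
      · exact .inl ((s.mem_v x).1 h).1
      · exact .inr h
    · refine Set.union_subset (An_mono (by intro x; simp +contextual)) ?_
      refine Set.Subset.trans ?_ (subset_An _)
      intro x; simp +contextual
  constructor
  · rintro ⟨a, b, h⟩
    rw [hw] at h
    -- Leaving a node outside `e` by a tail would lead down to `l` or to a collider in `e`, which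
    -- would make that node an ancestor and put it in `e`. Leaving `i` or a node of `e` by an arrow
    -- would lead to a non-collider in `e`, which is conditioned on. Only dashed lines between
    -- colliders in `e` remain.
    have key : ∀ {x a j b}, GWalk (CWalk E C M) (↑(G.u \ e)) ↑e x a j b → j = l →
        (x ∈ G.u → x ∉ e → a = true) ∧ (x = i ∨ x ∈ e → a = true → Via e G.W x j) := by
      intro x a j b h hj
      induction h with
      | @single x a j b h =>
        subst hj
        constructor
        · intro hx hxe
          cases a with
          | true => rfl
          | false =>
            exact absurd (hcl j x (.inr (.inl rfl)) hx (s.edge_of_tail h hx (.inl hl)).2.2) hxe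
        · rintro hx rfl
          have hxu : x ∈ G.u := by
            rcases hx with rfl | hx
            exacts [hi, he hx]
          rcases s.edge_of_head h hxu (.inl hl) with h | h | h
          · exact .single h.2.2
          · exact absurd (hcl x j (hx.imp id .inr) hl h.2.2.2) hle
          · exact absurd h.1 (s.not_mem_v hl)
      | @cons x a y b c j d h hm _ ih =>
        have ih := ih hj
        have hyu : y ∈ G.u := by
          cases b <;> cases c
          exacts [(Finset.mem_sdiff.1 hm).1, (Finset.mem_sdiff.1 hm).1,
            (Finset.mem_sdiff.1 hm).1, he hm]
        have hbc : b = true → y ∉ e → False := by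
          rintro rfl hye
          obtain rfl := ih.1 hyu hye
          exact hye hm
        constructor
        · intro hx hxe
          cases a with
          | true => rfl
          | false =>
            obtain ⟨-, h2, h3⟩ := s.edge_of_tail h hx (.inl hyu)
            exact (hbc h2 fun hye => hxe (hcl y x (.inr (.inr hye)) hx h3)).elim
        · rintro hx rfl
          have hxu : x ∈ G.u := by
            rcases hx with rfl | hx
            exacts [hi, he hx]
          rcases s.edge_of_head h hxu (.inl hyu) with ⟨-, rfl, h2⟩ | ⟨-, rfl, -, h2⟩ | h
          · have hye : y ∈ e := by_contra (hbc rfl)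
            cases c with
            | true => exact .cons h2 hye (ih.2 (.inr hye) rfl)
            | false => exact absurd hye (Finset.mem_sdiff.1 hm).2
          · have hye : y ∈ e := hcl x y (hx.imp id .inr) hyu h2
            exact absurd hye (Finset.mem_sdiff.1 hm).2
          · exact absurd h.1 (s.not_mem_v hyu)
    have h' := key h rfl
    exact h'.2 (.inl rfl) (h'.1 hi hie)
  · intro h
    have key : ∀ {x j}, Via e G.W x j → x = j ∨
        GWalk (CWalk E C M) (↑(G.u \ e)) ↑e x true j true := by
      intro x j h
      induction h with
      | single h => exact ((s.W_ne _ _).1 h).2.2.imp id .single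
      | @cons x y j h hy _ ih =>
        rcases ((s.W_ne _ _).1 h).2.2 with rfl | h
        · exact ih
        · rcases ih with rfl | ih
          · exact .inr (.single h)
          · exact .inr (.cons h (c := true) (by exact hy) ih)
    exact ⟨true, true, hw.2 ((key h).resolve_left hil)⟩

omit [Fintype V] in
/-- Arrows from ancestors. -/
theorem conn_ancestor (s : Represents E C M G) {i : V} (hi : i ∈ G.u) {c β : Finset V}
    (hc : c ⊆ G.u) (hic : i ∉ c) (hβ : β ⊆ c)
    (hcl : ∀ x y, (x = i ∨ x ∈ c) → y ∈ G.u → Relation.TransGen E x y → y ∈ c) :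
    (∃ k ∈ β, Conn E ↑(C ∪ G.v ∪ (c \ β)) i k) ↔
      ∃ k ∈ β, G.H i k ≠ 0 ∨ ∃ w ∈ c, Via c G.W i w ∧ G.H w k ≠ 0 := by
  have hw : ∀ {j k a b}, Walk E (↑(C ∪ G.v ∪ (c \ β)))ᶜ ↑(C ∪ G.v ∪ (c \ β)) j a k b ↔
      GWalk (CWalk E C M) (↑((G.u \ c) ∪ β)) ↑(c \ β) j a k b := by
    refine walk_iff ?_ ?_ ?_
    · rw [Finset.union_assoc]
      refine s.compl_union_coe (Finset.union_subset Finset.subset_union_right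
        ((Finset.sdiff_subset.trans hc).trans Finset.subset_union_left)) ?_
      ext x
      have h1 := @hβ x
      have h2 : x ∈ G.u → x ∉ G.v := s.not_mem_v
      have h3 := @hc x
      simp only [Finset.mem_union, Finset.mem_sdiff]
      grind
    · intro x hx
      simp only [Finset.mem_coe, Finset.mem_union] at hx
      rcases hx with (h | h) | h
      · exact .inl (subset_An _ h)
      · exact .inl ((s.mem_v x).1 h).1
      · exact .inr h
    · refine Set.union_subset (An_mono (by intro x; simp +contextual)) ?_
      refine Set.Subset.trans ?_ (subset_An _)
      intro x; simp +contextual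
  constructor
  · rintro ⟨k, hk, a, b, h0⟩
    rw [hw] at h0
    set Q : Prop := ∃ k ∈ β, G.H i k ≠ 0 ∨ ∃ w ∈ c, Via c G.W i w ∧ G.H w k ≠ 0 with hQ
    have viaW : ∀ {x y}, (x = i ∨ (x ∈ c ∧ Via c G.W i x)) → G.W x y ≠ 0 → Via c G.W i y := by
      rintro x y (rfl | ⟨hx, h⟩) h'
      exacts [.single h', h.trans hx (.single h')]
    have doneW : ∀ {x y}, (x = i ∨ (x ∈ c ∧ Via c G.W i x)) → G.W x y ≠ 0 → y ∈ β → Q :=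
      fun {x y} hx h hy => ⟨y, hy, .inr ⟨y, hβ hy, viaW hx h, s.H_refl (hc (hβ hy))⟩⟩
    have doneH : ∀ {x y}, (x = i ∨ (x ∈ c ∧ Via c G.W i x)) → G.H x y ≠ 0 → y ∈ β → Q := by
      rintro x y (rfl | ⟨hx, h⟩) h' hy
      exacts [⟨y, hy, .inl h'⟩, ⟨y, hy, .inr ⟨x, hx, h, h'⟩⟩]
    -- The argument is that for dashed lines, except that nodes of `β` are not conditioned on. The
    -- sequence of dashed lines through `c` can therefore stop at its first node of `β`, reached by
    -- a dashed line or by an arrow.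
    have key : ∀ {x a k b}, GWalk (CWalk E C M) (↑((G.u \ c) ∪ β)) ↑(c \ β) x a k b → k ∈ β →
        (x ∈ G.u → x ∉ c → a = true) ∧
        ((x = i ∨ (x ∈ c ∧ Via c G.W i x)) → a = true → Q) := by
      intro x a k b h hk
      induction h with
      | @single x a k b h =>
        have hku := hc (hβ hk)
        constructor
        · intro hx hxc
          cases a with
          | true => rfl
          | false =>
            exact absurd (hcl k x (.inr (hβ hk)) hx (s.edge_of_tail h hx (.inl hku)).2.2) hxc
        · rintro hx rfl
          have hxu : x ∈ G.u := by
            rcases hx with rfl | hx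
            exacts [hi, hc hx.1]
          rcases s.edge_of_head h hxu (.inl hku) with h | h | h
          · exact doneW hx h.2.2 hk
          · exact doneH hx h.2.2.1 hk
          · exact absurd h.1 (s.not_mem_v hku)
      | @cons x a y b d k b' h hm _ ih =>
        have ih := ih hk
        have hX : ∀ {y}, y ∈ (G.u \ c) ∪ β → (y ∈ G.u ∧ y ∉ c) ∨ y ∈ β := fun h => by
          simpa only [Finset.mem_union, Finset.mem_sdiff] using h
        have hXu : ∀ {y}, y ∈ (G.u \ c) ∪ β → y ∈ G.u := fun h =>
          (hX h).elim And.left fun h => hc (hβ h)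
        have hyu : y ∈ G.u := by
          cases b <;> cases d
          exacts [hXu hm, hXu hm, hXu hm, hc (Finset.mem_sdiff.1 hm).1]
        have hbc : b = true → y ∉ c → False := by
          rintro rfl hyc
          obtain rfl := ih.1 hyu hyc
          exact hyc (Finset.mem_sdiff.1 hm).1
        constructor
        · intro hx hxc
          cases a with
          | true => rfl
          | false =>
            obtain ⟨-, h2, h3⟩ := s.edge_of_tail h hx (.inl hyu)
            exact (hbc h2 fun hye => hxc (hcl y x (.inr hye) hx h3)).elim
        · rintro hx rfl
          have hxu : x ∈ G.u := by
            rcases hx with rfl | hx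
            exacts [hi, hc hx.1]
          rcases s.edge_of_head h hxu (.inl hyu) with ⟨-, rfl, h2⟩ | ⟨-, rfl, h2, h3⟩ | h
          · have hyc : y ∈ c := by_contra (hbc rfl)
            cases d with
            | true => exact ih.2 (.inr ⟨hyc, viaW hx h2⟩) rfl
            | false => exact doneW hx h2 ((hX hm).resolve_left fun h => h.2 hyc)
          · have hyc : y ∈ c := hcl x y (hx.imp id And.left) hyu h3
            exact doneH hx h2 ((hX hm).resolve_left fun h => h.2 hyc)
          · exact absurd h.1 (s.not_mem_v hyu)
    have h' := key h0 hk
    exact h'.2 (.inl rfl) (h'.1 hi hic)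
  · rintro ⟨k, hk, h⟩
    -- Nodes of `β` on the dashed path are not admissible colliders, so the walk is cut at the first
    -- of them. The first alternative in `P` records that such a node has been reached.
    set P : V → Prop := fun x => x ∈ β ∨
      ∃ k ∈ β, ∃ b, GWalk (CWalk E C M) (↑((G.u \ c) ∪ β)) ↑(c \ β) x true k b with hP
    have hend : ∀ {w}, G.H w k ≠ 0 → P w := by
      intro w h
      obtain ⟨-, ⟨-, rfl | h⟩ | ⟨-, b, h⟩⟩ := (s.H_ne _ _).1 h
      exacts [.inl hk, .inr ⟨k, hk, _, .single h⟩, .inr ⟨k, hk, b, .single h⟩]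
    have hstep : ∀ {x y}, G.W x y ≠ 0 → y ∈ c → P y → P x := by
      intro x y h hy hPy
      obtain ⟨-, -, rfl | h⟩ := (s.W_ne _ _).1 h
      · exact hPy
      by_cases hyβ : y ∈ β
      · exact .inr ⟨y, hyβ, _, .single h⟩
      · obtain ⟨k, hk, b, h'⟩ := hPy.resolve_left hyβ
        exact .inr ⟨k, hk, b, .cons h (c := true) (Finset.mem_sdiff.2 ⟨hy, hyβ⟩) h'⟩
    have hvia : ∀ {x w}, Via c G.W x w → w ∈ c → P w → P x := by
      intro x w h hw hPw
      induction h with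
      | single h => exact hstep h hw hPw
      | cons h hy _ ih => exact hstep h hy (ih hw hPw)
    have hPi : P i := by
      rcases h with h | ⟨w, hw, h1, h2⟩
      exacts [hend h, hvia h1 hw (hend h2)]
    obtain ⟨k, hk, b, h⟩ := hPi.resolve_left fun h => hic (hβ h)
    exact ⟨k, hk, true, b, hw.2 h⟩

end Represents

end Connect

/-! ### Conditional independence of σ-algebras -/

section SigmaAlgebra

variable {Ω : Type*} {m' m₁ m₂ m₃ mΩ : MeasurableSpace Ω} {μ : Measure Ω} [IsFiniteMeasure μ]

/-- The intersections form a π-system, so integrals need to be compared only over them. -/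
lemma sup_eq_generateFrom_inter (m₁ m₂ : MeasurableSpace Ω) :
    m₁ ⊔ m₂ = MeasurableSpace.generateFrom
      {s | ∃ a b, MeasurableSet[m₁] a ∧ MeasurableSet[m₂] b ∧ s = a ∩ b} := by
  apply le_antisymm
  · refine sup_le ?_ ?_
    · intro a ha
      exact MeasurableSpace.measurableSet_generateFrom
        ⟨a, Set.univ, ha, @MeasurableSet.univ _ m₂, by simp⟩
    · intro b hb
      exact MeasurableSpace.measurableSet_generateFrom
        ⟨Set.univ, b, @MeasurableSet.univ _ m₁, hb, by simp⟩
  · refine MeasurableSpace.generateFrom_le ?_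
    rintro _ ⟨a, b, ha, hb, rfl⟩
    have h1 : m₁ ≤ m₁ ⊔ m₂ := le_sup_left
    have h2 : m₂ ≤ m₁ ⊔ m₂ := le_sup_right
    exact @MeasurableSet.inter _ (m₁ ⊔ m₂) _ _ (h1 _ ha) (h2 _ hb)

lemma integrable_ind {t : Set Ω} (ht : MeasurableSet t) :
    Integrable (t.indicator fun _ => (1 : ℝ)) μ :=
  (integrable_const _).indicator ht

/-- The indicator of a set in the conditioning σ-algebra may be pulled out. -/
lemma condExp_inter_ae_eq {t b : Set Ω} (ht : MeasurableSet t)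
    (hb : MeasurableSet[m'] b) :
    μ[(t ∩ b).indicator fun _ => (1 : ℝ) | m'] =ᵐ[μ]
      b.indicator μ[t.indicator fun _ => (1 : ℝ) | m'] := by
  have h := condExp_indicator (m := m') (integrable_ind (μ := μ) ht) hb
  rwa [Set.indicator_indicator, Set.inter_comm b t] at h

/-- Conditioning first on the larger σ-algebra pulls out the indicator of `b`. Conditioning then on
`m'` pulls out the conditional probability of `t`, which is `m'`-measurable and bounded. -/
lemma condExp_inter_ae_eq_of_condIndep (hm' : m' ≤ mΩ) (h₁ : m₁ ≤ mΩ) (h₂ : m₂ ≤ mΩ)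
    (h : ∀ t, MeasurableSet[m₁] t → μ[t.indicator fun _ => (1 : ℝ) | m' ⊔ m₂] =ᵐ[μ]
      μ[t.indicator fun _ => (1 : ℝ) | m']) {t b : Set Ω} (ht : MeasurableSet[m₁] t)
    (hb : MeasurableSet[m₂] b) :
    μ[(t ∩ b).indicator fun _ => (1 : ℝ) | m'] =ᵐ[μ]
      μ[t.indicator fun _ => (1 : ℝ) | m'] * μ[b.indicator fun _ => (1 : ℝ) | m'] := by
  have hs : m' ⊔ m₂ ≤ mΩ := sup_le hm' h₂
  have hb' : MeasurableSet[m' ⊔ m₂] b := (le_sup_right : m₂ ≤ m' ⊔ m₂) _ hb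
  have e1 : μ[(t ∩ b).indicator fun _ => (1 : ℝ) | m' ⊔ m₂] =ᵐ[μ]
      (b.indicator fun _ => (1 : ℝ)) * μ[t.indicator fun _ => (1 : ℝ) | m'] := by
    filter_upwards [condExp_inter_ae_eq (μ := μ) (h₁ _ ht) hb', h t ht] with ω h1 h2
    rw [h1, Pi.mul_apply]
    by_cases hω : ω ∈ b <;> simp [hω, h2]
  have hbd : ∀ᵐ ω ∂μ, ‖μ[t.indicator fun _ => (1 : ℝ) | m'] ω‖ ≤ 1 :=
    ae_bdd_abs_condExp_of_ae_bdd_abs (m := m') (R := 1) (Filter.Eventually.of_forall fun ω => by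
      by_cases hω : ω ∈ t <;> simp [hω])
  calc μ[(t ∩ b).indicator fun _ => (1 : ℝ) | m']
      =ᵐ[μ] μ[μ[(t ∩ b).indicator fun _ => (1 : ℝ) | m' ⊔ m₂] | m'] :=
        (condExp_condExp_of_le le_sup_left hs).symm
    _ =ᵐ[μ] μ[μ[t.indicator fun _ => (1 : ℝ) | m'] * (b.indicator fun _ => (1 : ℝ)) | m'] :=
        condExp_congr_ae (e1.trans (by rw [mul_comm]))
    _ =ᵐ[μ] _ := condExp_stronglyMeasurable_mul_of_bound hm' stronglyMeasurable_condExp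
        (integrable_ind (h₂ _ hb)) _ hbd

variable [StandardBorelSpace Ω]

/-- Conditional independence as a property of conditional probabilities. -/
theorem condIndep_iff_condExp (hm' : m' ≤ mΩ) (h₁ : m₁ ≤ mΩ) (h₂ : m₂ ≤ mΩ) :
    CondIndep m' m₁ m₂ hm' μ ↔ ∀ t, MeasurableSet[m₁] t →
      μ[t.indicator fun _ => (1 : ℝ) | m' ⊔ m₂] =ᵐ[μ] μ[t.indicator fun _ => (1 : ℝ) | m'] := by
  rw [condIndep_iff m' m₁ m₂ hm' h₁ h₂]
  refine ⟨fun h t ht => ?_, fun h t b ht hb =>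
    condExp_inter_ae_eq_of_condIndep hm' h₁ h₂ h ht hb⟩
  have hs : m' ⊔ m₂ ≤ mΩ := sup_le hm' h₂
  have hit := integrable_ind (μ := μ) (h₁ _ ht)
  refine (ae_eq_condExp_of_forall_setIntegral_eq hs hit
    (fun _ _ _ => integrable_condExp.integrableOn) (fun s hs' _ => ?_)
    ⟨_, stronglyMeasurable_condExp.mono le_sup_left, .rfl⟩).symm
  -- Over `a ∩ b` the two integrals agree by the product formula of conditional independence. The
  -- π-λ argument extends this to all sets of `m' ⊔ m₂`.
  refine MeasurableSpace.induction_on_inter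
    (C := fun s _ => ∫ x in s, (μ[t.indicator fun _ => (1 : ℝ) | m']) x ∂μ =
      ∫ x in s, t.indicator (fun _ => (1 : ℝ)) x ∂μ)
    (sup_eq_generateFrom_inter m' m₂) ?_ ?_ ?_ ?_ ?_ s hs'
  · rintro _ ⟨a, b, ha, hb, rfl⟩ _ ⟨a', b', ha', hb', rfl⟩ -
    exact ⟨a ∩ a', b ∩ b', @MeasurableSet.inter _ m' _ _ ha ha',
      @MeasurableSet.inter _ m₂ _ _ hb hb', Set.inter_inter_inter_comm _ _ _ _⟩
  · simp
  · rintro _ ⟨a, b, ha, hb, rfl⟩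
    have hbd : ∀ᵐ ω ∂μ, ‖μ[t.indicator fun _ => (1 : ℝ) | m'] ω‖ ≤ 1 :=
      ae_bdd_abs_condExp_of_ae_bdd_abs (m := m') (R := 1) (Filter.Eventually.of_forall fun ω => by
        by_cases hω : ω ∈ t <;> simp [hω])
    have hib := integrable_ind (μ := μ) (h₂ _ hb)
    have e1 := condExp_stronglyMeasurable_mul_of_bound (μ := μ) hm'
      (stronglyMeasurable_condExp (f := t.indicator fun _ => (1 : ℝ)) (μ := μ) (m := m'))
      hib _ hbd
    have e2 := (h t b ht hb).symm
    have hint : Integrable (μ[t.indicator fun _ => (1 : ℝ) | m'] *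
        b.indicator fun _ => (1 : ℝ)) μ := by
      have : (μ[t.indicator fun _ => (1 : ℝ) | m'] * b.indicator fun _ => (1 : ℝ)) =
          b.indicator μ[t.indicator fun _ => (1 : ℝ) | m'] := by
        ext ω; by_cases hω : ω ∈ b <;> simp [hω]
      rw [this]
      exact integrable_condExp.indicator (h₂ _ hb)
    calc ∫ x in a ∩ b, (μ[t.indicator fun _ => (1 : ℝ) | m']) x ∂μ
        = ∫ x in a, (μ[t.indicator fun _ => (1 : ℝ) | m'] *
            b.indicator fun _ => (1 : ℝ)) x ∂μ := by
          rw [← setIntegral_indicator (h₂ _ hb)]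
          refine setIntegral_congr_fun (hm' _ ha) fun ω _ => ?_
          by_cases hω : ω ∈ b <;> simp [hω]
      _ = ∫ x in a, (μ[μ[t.indicator fun _ => (1 : ℝ) | m'] *
            b.indicator fun _ => (1 : ℝ) | m']) x ∂μ := (setIntegral_condExp hm' hint ha).symm
      _ = ∫ x in a, (μ[(t ∩ b).indicator fun _ => (1 : ℝ) | m']) x ∂μ :=
          integral_congr_ae (ae_restrict_of_ae (e1.trans e2))
      _ = ∫ x in a, (t ∩ b).indicator (fun _ => (1 : ℝ)) x ∂μ :=
          setIntegral_condExp hm' (integrable_ind ((h₁ _ ht).inter (h₂ _ hb))) ha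
      _ = ∫ x in a ∩ b, t.indicator (fun _ => (1 : ℝ)) x ∂μ := by
          rw [← setIntegral_indicator (h₂ _ hb), Set.indicator_indicator, Set.inter_comm t b]
  · intro s hs' ih
    have hs' := hs _ hs'
    have e1 := integral_add_compl hs' (integrable_condExp (m := m') (μ := μ)
      (f := t.indicator fun _ => (1 : ℝ)))
    have e2 := integral_add_compl hs' hit
    have e3 := integral_condExp (μ := μ) hm' (f := t.indicator fun _ => (1 : ℝ))
    linarith
  · intro f hd hf ih
    have hf' := fun i => hs _ (hf i)
    rw [integral_iUnion hf' hd integrable_condExp.integrableOn,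
      integral_iUnion hf' hd hit.integrableOn]
    exact tsum_congr ih

/-- Conditioning on `m' ⊔ m₂ ⊔ m₃` and on `m' ⊔ m₃` both give the conditional probabilities given
`m'`, so they agree with each other. -/
lemma condIndep_weak_union {hm' : m' ≤ mΩ} (h₁ : m₁ ≤ mΩ) (h₂ : m₂ ≤ mΩ) (h₃ : m₃ ≤ mΩ)
    (h : CondIndep m' m₁ (m₂ ⊔ m₃) hm' μ) : CondIndep (m' ⊔ m₃) m₁ m₂ (sup_le hm' h₃) μ := by
  have h3 := condIndep_of_condIndep_of_le_right h (le_sup_right : m₃ ≤ m₂ ⊔ m₃)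
  rw [condIndep_iff_condExp _ h₁ (sup_le h₂ h₃)] at h
  rw [condIndep_iff_condExp _ h₁ h₃] at h3
  rw [condIndep_iff_condExp _ h₁ h₂]
  intro t ht
  rw [sup_assoc, sup_comm m₃ m₂]
  exact (h t ht).trans (h3 t ht).symm

/-- The conditional probabilities are reduced twice, first from all three σ-algebras to `m' ⊔ m₂`
and then to `m'`. -/
lemma condIndep_contraction {hm' : m' ≤ mΩ} (h₁ : m₁ ≤ mΩ) (h₂ : m₂ ≤ mΩ) (h₃ : m₃ ≤ mΩ)
    (h : CondIndep m' m₁ m₂ hm' μ) (h' : CondIndep (m' ⊔ m₂) m₁ m₃ (sup_le hm' h₂) μ) :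
    CondIndep m' m₁ (m₂ ⊔ m₃) hm' μ := by
  rw [condIndep_iff_condExp _ h₁ h₂] at h
  rw [condIndep_iff_condExp _ h₁ h₃] at h'
  rw [condIndep_iff_condExp _ h₁ (sup_le h₂ h₃)]
  intro t ht
  rw [← sup_assoc]
  exact (h' t ht).trans (h t ht)

/-- Needed to pass between a regression residual and its component, each of which is a function of
the other together with the conditioning variables. -/
lemma condIndep_sup_self {hm' : m' ≤ mΩ} (h₁ : m₁ ≤ mΩ) (h₂ : m₂ ≤ mΩ)
    (h : CondIndep m' m₁ m₂ hm' μ) : CondIndep m' m₁ (m₂ ⊔ m') hm' μ := by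
  refine condIndep_contraction h₁ h₂ hm' h ?_
  rw [condIndep_iff_condExp _ h₁ hm']
  intro t _
  rw [sup_eq_left.2 (le_sup_left : m' ≤ m' ⊔ m₂)]

/-- Lets weak union and contraction start from, and end in, unconditional independence, which for
Gaussian variables is absence of correlation. -/
lemma condIndep_bot_iff [IsProbabilityMeasure μ] (h₁ : m₁ ≤ mΩ) (h₂ : m₂ ≤ mΩ) :
    CondIndep ⊥ m₁ m₂ bot_le μ ↔ Indep m₁ m₂ μ := by
  rw [condIndep_iff ⊥ m₁ m₂ bot_le h₁ h₂, Indep_iff]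
  refine forall₄_congr fun s t hs ht => ?_
  have hs := h₁ _ hs
  have ht := h₂ _ ht
  simp only [condExp_bot, integral_indicator_const (μ := μ) (1 : ℝ) hs,
    integral_indicator_const (μ := μ) (1 : ℝ) ht,
    integral_indicator_const (μ := μ) (1 : ℝ) (hs.inter ht), smul_eq_mul, mul_one]
  have : ((fun _ => μ.real (s ∩ t)) =ᵐ[μ] (fun _ : Ω => μ.real s) * fun _ => μ.real t) ↔
      μ.real (s ∩ t) = μ.real s * μ.real t := by
    constructor
    · intro h
      obtain ⟨ω, h⟩ := h.exists
      exact h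
    · intro h
      exact Filter.Eventually.of_forall fun _ => h
  rw [this, measureReal_def, measureReal_def, measureReal_def, ← ENNReal.toReal_mul,
    ENNReal.toReal_eq_toReal_iff' (by simp) (ENNReal.mul_ne_top (by simp) (by simp))]

end SigmaAlgebra

/-! ### Separation implies conditional independence -/

section Soundness

variable {d : ℕ}

/-- The σ-algebra generated by the components in `γ`. -/
abbrev sig (γ : Finset (Fin d)) : MeasurableSpace (Fin d → ℝ) :=
  MeasurableSpace.comap (γ.restrict (π := fun _ => ℝ)) inferInstance

lemma sig_le (γ : Finset (Fin d)) : sig γ ≤ (inferInstance : MeasurableSpace (Fin d → ℝ)) :=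
  (Finset.measurable_restrict γ).comap_le

lemma sig_eq_iSup (γ : Finset (Fin d)) :
    sig γ = ⨆ i ∈ γ, MeasurableSpace.comap (fun y : Fin d → ℝ => y i) inferInstance := by
  have : (inferInstance : MeasurableSpace (∀ _ : γ, ℝ)) =
      ⨆ i : γ, MeasurableSpace.comap (fun y => y i) inferInstance := rfl
  rw [sig, this, MeasurableSpace.comap_iSup, iSup_subtype]
  simp only [MeasurableSpace.comap_comp]
  rfl

lemma sig_union (γ δ : Finset (Fin d)) : sig (γ ∪ δ) = sig γ ⊔ sig δ := by
  simp only [sig_eq_iSup, Finset.mem_union, iSup_or, iSup_sup_eq]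

lemma sig_mono {γ δ : Finset (Fin d)} (h : γ ⊆ δ) : sig γ ≤ sig δ := by
  rw [← Finset.union_eq_right.2 h, sig_union]
  exact le_sup_left

lemma sig_empty : sig (∅ : Finset (Fin d)) = ⊥ := by
  rw [sig_eq_iSup]; simp

variable {μ : ProbabilityMeasure (Fin d → ℝ)} {α β γ δ : Finset (Fin d)}

lemma condInd_iff : CondInd μ α β γ ↔
    CondIndep (sig γ) (sig α) (sig β) (sig_le γ) (μ : Measure (Fin d → ℝ)) := by
  rw [CondInd, condIndepFun_iff_condIndep]

lemma CondInd.symm (h : CondInd μ α β γ) : CondInd μ β α γ := CondIndepFun.symm h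

lemma CondInd.mono_right (h : CondInd μ α β γ) (hδ : δ ⊆ β) : CondInd μ α δ γ :=
  condInd_iff.2 (condIndep_of_condIndep_of_le_right (condInd_iff.1 h) (sig_mono hδ))

lemma CondInd.weak_union (h : CondInd μ α (β ∪ δ) γ) : CondInd μ α β (γ ∪ δ) := by
  rw [condInd_iff] at h ⊢
  simp only [sig_union] at h ⊢
  exact condIndep_weak_union (sig_le _) (sig_le _) (sig_le _) h

lemma CondInd.contraction (h : CondInd μ α β γ) (h' : CondInd μ α δ (γ ∪ β)) :
    CondInd μ α (β ∪ δ) γ := by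
  rw [condInd_iff] at h h' ⊢
  simp only [sig_union] at h h' ⊢
  exact condIndep_contraction (sig_le _) (sig_le _) (sig_le _) h h'

/-- Arrows between nodes from `m` on. -/
def EdgeFrom (E : Fin d → Fin d → Prop) (m : ℕ) (x y : Fin d) : Prop := E x y ∧ m ≤ x.val

variable {E : Fin d → Fin d → Prop}

/-- A connecting walk among the nodes after `x` is also a walk in the larger graph, and may be
used for any conditioning set that agrees on the nodes after `x`. -/
lemma walk_edgeFrom (hlt : ∀ x y, E x y → x < y) {x : Fin d} {s t : Set (Fin d)}
    (hst : ∀ y, x < y → (y ∈ s ↔ y ∈ t)) {i j : Fin d} {a b : Bool}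
    (h : Walk (EdgeFrom E (x.val + 1)) sᶜ s i a j b) : Walk (EdgeFrom E x.val) tᶜ t i a j b := by
  have hb : ∀ {i a j b}, Edge (EdgeFrom E (x.val + 1)) i a j b →
      Edge (EdgeFrom E x.val) i a j b ∧ x < j := by
    rintro i a j b (⟨rfl, rfl, h, hx⟩ | ⟨rfl, rfl, h, hx⟩)
    · refine ⟨.inl ⟨rfl, rfl, h, by omega⟩, ?_⟩
      have := hlt _ _ h
      rw [Fin.lt_def] at this ⊢
      omega
    · exact ⟨.inr ⟨rfl, rfl, h, by omega⟩, by rw [Fin.lt_def]; omega⟩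
  induction h with
  | single h => exact .single (hb h).1
  | @cons i a y b c j d h hm _ ih =>
    have hy := hst y (hb h).2
    refine .cons (hb h).1 ?_ ih
    cases b <;> cases c
    · exact fun h => hm (hy.2 h)
    · exact fun h => hm (hy.2 h)
    · exact fun h => hm (hy.2 h)
    · exact hy.1 hm

/-- One component given its past. -/
lemma condInd_of_local {x : Fin d} {p : Finset (Fin d)}
    (h : CondInd μ {x} (Finset.Ioi x \ p) p) {β δ : Finset (Fin d)} (hβ : β ⊆ Finset.Ioi x \ p)
    (hδ : δ ⊆ Finset.Ioi x) (hp : p ⊆ δ) : CondInd μ {x} β δ := by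
  have h1 : CondInd μ {x} (β ∪ (δ \ p)) p := h.mono_right
    (Finset.union_subset hβ (Finset.sdiff_subset_sdiff hδ subset_rfl))
  have := h1.weak_union
  rwa [Finset.union_sdiff_of_subset hp] at this

/-- The ordered local Markov property implies the global one. -/
theorem condInd_of_not_conn_edgeFrom (hlt : ∀ x y, E x y → x < y) (p : Fin d → Finset (Fin d))
    (hp : ∀ x y, y ∈ p x ↔ E x y) (hμ : ∀ x, CondInd μ {x} (Finset.Ioi x \ p x) (p x)) (m : ℕ)
    (hm : m ≤ d) : ∀ α β γ : Finset (Fin d), (∀ x ∈ α ∪ β ∪ γ, m ≤ x.val) → Disjoint α β →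
      Disjoint α γ → Disjoint β γ → (∀ a ∈ α, ∀ b ∈ β, ¬ Conn (EdgeFrom E m) γ a b) →
      CondInd μ α β γ := by
  induction hm using Nat.decreasingInduction with
  | self =>
    intro α β γ hx _ _ _ _
    have hα : α = ∅ := by
      rw [Finset.eq_empty_iff_forall_notMem]
      intro x hxα
      have := hx x (by simp [hxα])
      have := x.2
      omega
    subst hα
    rw [condInd_iff, sig_empty]
    exact condIndep_bot_left _
  | of_succ m hm ih =>
    set x : Fin d := ⟨m, hm⟩ with hx
    have hpx : p x ⊆ Finset.Ioi x := fun y hy => Finset.mem_Ioi.2 (hlt _ _ ((hp x y).1 hy))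
    have hge : ∀ {y : Fin d}, m ≤ y.val → y ≠ x → m + 1 ≤ y.val := by
      intro y h1 h2
      have : y.val ≠ m := fun h => h2 (Fin.ext h)
      omega
    have hIoi : ∀ {y : Fin d}, m ≤ y.val → y ≠ x → y ∈ Finset.Ioi x := fun h1 h2 =>
      Finset.mem_Ioi.2 (Fin.lt_def.2 (hge h1 h2))
    have hpge : ∀ {y : Fin d}, y ∈ p x → m + 1 ≤ y.val := fun h =>
      Fin.lt_def.1 (Finset.mem_Ioi.1 (hpx h))
    have hpne : ∀ {y : Fin d}, y ∈ p x → y ≠ x := fun h h' => by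
      subst h'
      exact lt_irrefl _ (Finset.mem_Ioi.1 (hpx h))
    have lift : ∀ {s t : Set (Fin d)} {i j : Fin d}, (∀ y, x < y → (y ∈ s ↔ y ∈ t)) →
        Conn (EdgeFrom E (m + 1)) s i j → Conn (EdgeFrom E m) t i j :=
      fun hst ⟨a, b, h⟩ => ⟨a, b, walk_edgeFrom (x := x) hlt hst h⟩
    have hedge : ∀ {k a b}, k ∈ p x → a = true → b = false → Edge (EdgeFrom E m) x a k b :=
      fun hk ha hb => .inl ⟨ha, hb, (hp _ _).1 hk, le_rfl⟩
    -- the first node is among those that are to be separated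
    have first_mem_left : ∀ α β γ : Finset (Fin d), (∀ y ∈ α ∪ β ∪ γ, m ≤ y.val) → Disjoint α β →
        Disjoint α γ → Disjoint β γ → (∀ a ∈ α, ∀ b ∈ β, ¬ Conn (EdgeFrom E m) γ a b) →
        x ∈ α → CondInd μ α β γ := by
      intro α β γ hge' d1 d2 d3 hc hxα
      have hxβ := Finset.disjoint_left.1 d1 hxα
      have hxγ := Finset.disjoint_left.1 d2 hxα
      have hPβ : ∀ {k}, k ∈ p x → k ∉ γ → k ∉ β := fun {k} hk _ hkβ =>
        hc x hxα k hkβ ⟨true, false, .single (hedge hk rfl rfl)⟩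
      -- The parents of `x` outside `γ` are as much separated from `β` as `x` is, since a walk from
      -- such a parent can be prolonged to `x`. After adding them to `α`, the past that matters for
      -- `x` is part of `γ ∪ α'`.
      set α' := α.erase x ∪ (p x \ γ) with hα'
      have hge1 : ∀ y ∈ α', m + 1 ≤ y.val := by
        intro y hy
        rcases Finset.mem_union.1 hy with h | h
        · exact hge (hge' y (by simp [(Finset.mem_erase.1 h).2])) (Finset.mem_erase.1 h).1
        · exact hpge (Finset.mem_sdiff.1 h).1
      have hgeβ : ∀ y ∈ β, m + 1 ≤ y.val := fun y hy =>
        hge (hge' y (by simp [hy])) fun h => hxβ (h ▸ hy)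
      have hgeγ : ∀ y ∈ γ, m + 1 ≤ y.val := fun y hy =>
        hge (hge' y (by simp [hy])) fun h => hxγ (h ▸ hy)
      have h1 : CondInd μ α' β γ := by
        refine ih α' β γ ?_ ?_ ?_ d3 ?_
        · intro y hy
          simp only [Finset.mem_union (s := α' ∪ β), Finset.mem_union (s := α')] at hy
          rcases hy with (h | h) | h
          exacts [hge1 y h, hgeβ y h, hgeγ y h]
        · rw [Finset.disjoint_left]
          intro y hy hyβ
          rcases Finset.mem_union.1 hy with h | h
          · exact Finset.disjoint_left.1 d1 (Finset.mem_erase.1 h).2 hyβ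
          · exact hPβ (Finset.mem_sdiff.1 h).1 (Finset.mem_sdiff.1 h).2 hyβ
        · rw [Finset.disjoint_left]
          intro y hy hyγ
          rcases Finset.mem_union.1 hy with h | h
          · exact Finset.disjoint_left.1 d2 (Finset.mem_erase.1 h).2 hyγ
          · exact (Finset.mem_sdiff.1 h).2 hyγ
        · intro a ha b hb hconn
          rcases Finset.mem_union.1 ha with h | h
          · exact hc a (Finset.mem_erase.1 h).2 b hb (lift (fun _ _ => Iff.rfl) hconn)
          · obtain ⟨h, h'⟩ := Finset.mem_sdiff.1 h
            obtain ⟨a', b', hw⟩ := lift (fun _ _ => Iff.rfl) hconn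
            exact hc x hxα b hb ⟨true, b', .cons (hedge h rfl rfl)
              (show a ∈ ((γ : Set (Fin d))ᶜ) from h') hw⟩
      have h2 : CondInd μ {x} β (γ ∪ α') := by
        refine condInd_of_local (hμ x) ?_ ?_ ?_
        · intro y hy
          refine Finset.mem_sdiff.2 ⟨Finset.mem_Ioi.2 (Fin.lt_def.2 (hgeβ y hy)), fun h => ?_⟩
          exact hPβ h (Finset.disjoint_left.1 d3 hy) hy
        · intro y hy
          rcases Finset.mem_union.1 hy with h | h
          exacts [Finset.mem_Ioi.2 (Fin.lt_def.2 (hgeγ y h)),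
            Finset.mem_Ioi.2 (Fin.lt_def.2 (hge1 y h))]
        · intro y hy
          by_cases h : y ∈ γ <;> simp [hα', hy, h]
      refine ((h1.symm.contraction h2.symm).mono_right ?_).symm
      intro y hy
      by_cases h : y = x <;> simp [hα', hy, h]
    -- the first node belongs to the conditioning set, and `α` avoids its parents
    have first_mem_cond : ∀ α β γ : Finset (Fin d), (∀ y ∈ α ∪ β ∪ γ, m + 1 ≤ y.val) → Disjoint α β →
        Disjoint α γ → Disjoint β γ →
        (∀ a ∈ α, ∀ b ∈ β, ¬ Conn (EdgeFrom E (m + 1)) γ a b) →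
        (∀ a ∈ α, ∀ k ∈ p x \ γ, a ≠ k ∧ ¬ Conn (EdgeFrom E (m + 1)) γ a k) →
        CondInd μ α β (γ ∪ {x}) := by
      intro α β γ hge' d1 d2 d3 hc hP
      have hαp : ∀ {y}, y ∈ α → y ∉ p x := fun {y} hy hyp => by
        by_cases h : y ∈ γ
        · exact Finset.disjoint_left.1 d2 hy h
        · exact (hP y hy y (Finset.mem_sdiff.2 ⟨hyp, h⟩)).1 rfl
      -- The parents outside `γ` are separated from `α` too and may join `β`. Given them and `γ`,
      -- the node `x` is independent of `α`, so contraction adds `x` and weak union moves it into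
      -- the condition.
      have h1 : CondInd μ α (β ∪ (p x \ γ)) γ := by
        refine ih α _ γ ?_ ?_ d2 ?_ ?_
        · intro y hy
          simp only [Finset.mem_union, Finset.mem_sdiff] at hy hge'
          rcases hy with (h | h | h) | h
          exacts [hge' y (by tauto), hge' y (by tauto), hpge h.1, hge' y (by tauto)]
        · rw [Finset.disjoint_union_right]
          refine ⟨d1, Finset.disjoint_left.2 fun y hy h => hαp hy (Finset.mem_sdiff.1 h).1⟩
        · rw [Finset.disjoint_union_left]
          exact ⟨d3, Finset.sdiff_disjoint⟩
        · intro a ha b hb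
          rcases Finset.mem_union.1 hb with h | h
          exacts [hc a ha b h, (hP a ha b h).2]
      have h2 : CondInd μ {x} α (γ ∪ (β ∪ (p x \ γ))) := by
        refine condInd_of_local (hμ x) ?_ ?_ ?_
        · intro y hy
          exact Finset.mem_sdiff.2
            ⟨Finset.mem_Ioi.2 (Fin.lt_def.2 (hge' y (by simp [hy]))), hαp hy⟩
        · intro y hy
          simp only [Finset.mem_union, Finset.mem_sdiff] at hy hge'
          rw [Finset.mem_Ioi, Fin.lt_def]
          rcases hy with h | h | h
          exacts [hge' y (by tauto), hge' y (by tauto), hpge h.1]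
        · intro y hy
          by_cases h : y ∈ γ <;> simp [hy, h]
      refine ((h1.contraction h2.symm).mono_right ?_).weak_union
      exact Finset.union_subset_union_left Finset.subset_union_left
    intro α β γ hge' d1 d2 d3 hc
    by_cases hxα : x ∈ α
    · exact first_mem_left α β γ hge' d1 d2 d3 hc hxα
    by_cases hxβ : x ∈ β
    · refine (first_mem_left β α γ (fun y hy => hge' y ?_) d1.symm d3 d2
        (fun b hb a ha h => hc a ha b hb h.symm) hxβ).symm
      rwa [Finset.union_comm α β]
    by_cases hxγ : x ∈ γ
    · set γ' := γ.erase x with hγ'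
      have hγ : γ' ∪ {x} = γ := by
        rw [Finset.union_comm, ← Finset.insert_eq, Finset.insert_erase hxγ]
      have hge1 : ∀ y ∈ α ∪ β ∪ γ', m + 1 ≤ y.val := by
        intro y hy
        refine hge (hge' y ?_) ?_
        · simp only [hγ', Finset.mem_union, Finset.mem_erase] at hy ⊢
          tauto
        · rintro rfl
          simp [hγ', hxα, hxβ] at hy
      have d2' : Disjoint α γ' := d2.mono_right (Finset.erase_subset _ _)
      have d3' : Disjoint β γ' := d3.mono_right (Finset.erase_subset _ _)
      have hst : ∀ y, x < y → (y ∈ (γ' : Set (Fin d)) ↔ y ∈ (γ : Set (Fin d))) := by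
        intro y hy
        simp [hγ', hy.ne']
      have hc' : ∀ a ∈ α, ∀ b ∈ β, ¬ Conn (EdgeFrom E (m + 1)) γ' a b :=
        fun a ha b hb h => hc a ha b hb (lift hst h)
      have touch : ∀ {a k}, k ∈ p x \ γ' → ¬ (a ≠ k ∧ ¬ Conn (EdgeFrom E (m + 1)) γ' a k) →
          ∃ a', Walk (EdgeFrom E m) (γ : Set (Fin d))ᶜ γ a a' x true := by
        intro a k hk h
        obtain ⟨hk, hk'⟩ := Finset.mem_sdiff.1 hk
        have he : Edge (EdgeFrom E m) k false x true := (hedge hk rfl rfl).symm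
        by_cases hak : a = k
        · subst hak
          exact ⟨false, .single he⟩
        · obtain ⟨a', b', hw⟩ := lift hst (not_not.1 fun h' => h ⟨hak, h'⟩)
          refine ⟨a', hw.trans (c := false) ?_ (.single he)⟩
          have : k ∈ (γ : Set (Fin d))ᶜ := fun h => hk' (Finset.mem_erase.2 ⟨hpne hk, h⟩)
          cases b' <;> exact this
      rw [← hγ]
      by_cases h1 : ∀ a ∈ α, ∀ k ∈ p x \ γ', a ≠ k ∧ ¬ Conn (EdgeFrom E (m + 1)) γ' a k
      · exact first_mem_cond α β γ' hge1 d1 d2' d3' hc' h1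
      by_cases h2 : ∀ b ∈ β, ∀ k ∈ p x \ γ', b ≠ k ∧ ¬ Conn (EdgeFrom E (m + 1)) γ' b k
      · refine (first_mem_cond β α γ' ?_ d1.symm d3' d2' (fun b hb a ha h => hc' a ha b hb h.symm) h2).symm
        rwa [Finset.union_comm β α]
      -- Otherwise both `α` and `β` reach `x` with an arrowhead. As `x` is conditioned on, it is an
      -- admissible collider and connects them.
      exfalso
      push Not at h1 h2
      obtain ⟨a, ha, k, hk, h1⟩ := h1
      obtain ⟨b, hb, l, hl, h2⟩ := h2
      obtain ⟨a', wa⟩ := touch hk (fun h => h.2 (h1 h.1))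
      obtain ⟨b', wb⟩ := touch hl (fun h => h.2 (h2 h.1))
      exact hc a ha b hb ⟨a', b', wa.trans (c := true) (show x ∈ (γ : Set (Fin d)) from hxγ)
        wb.symm⟩
    · refine ih α β γ (fun y hy => hge (hge' y hy) ?_) d1 d2 d3
        (fun a ha b hb h => hc a ha b hb (lift (fun _ _ => Iff.rfl) h))
      rintro rfl
      simp [hxα, hxβ, hxγ] at hy

lemma edgeFrom_zero : EdgeFrom E 0 = E := by
  funext x y; simp [EdgeFrom]

/-- Separated sets of components are conditionally independent. -/
theorem condInd_of_not_conn (hlt : ∀ x y, E x y → x < y) (p : Fin d → Finset (Fin d))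
    (hp : ∀ x y, y ∈ p x ↔ E x y) (hμ : ∀ x, CondInd μ {x} (Finset.Ioi x \ p x) (p x))
    (hαβ : Disjoint α β) (hαγ : Disjoint α γ) (hβγ : Disjoint β γ)
    (h : ∀ a ∈ α, ∀ b ∈ β, ¬ Conn E γ a b) : CondInd μ α β γ :=
  condInd_of_not_conn_edgeFrom hlt p hp hμ 0 (Nat.zero_le _) α β γ (fun _ _ => Nat.zero_le _)
    hαβ hαγ hβγ (by rwa [edgeFrom_zero])

end Soundness

/-! ### Gaussian distributions and their covariance vectors -/

section Gaussian

variable {d : ℕ} {μ : ProbabilityMeasure (Fin d → ℝ)} {y : Fin d → EuclideanSpace ℝ (Fin d)}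

/-- The random vector is Gaussian, and the covariances of its components are the inner products of
the vectors `y i`. -/
structure IsGaussianWith (μ : ProbabilityMeasure (Fin d → ℝ))
    (y : Fin d → EuclideanSpace ℝ (Fin d)) : Prop where
  gaussian : HasGaussianLaw (fun ω : Fin d → ℝ => ω) (μ : Measure (Fin d → ℝ))
  cov : ∀ i j, cov[fun ω => ω i, fun ω => ω j; (μ : Measure (Fin d → ℝ))] = inner ℝ (y i) (y j)

/-- The linear combination of the components with coefficients `a`. -/
def linComb (a : Fin d → ℝ) (ω : Fin d → ℝ) : ℝ := ∑ k, a k * ω k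

lemma measurable_linComb (a : Fin d → ℝ) : Measurable (linComb a) := by
  unfold linComb; fun_prop

lemma linComb_single (j : Fin d) : linComb (Pi.single j 1) = fun ω => ω j := by
  funext ω
  simp [linComb, Pi.single_apply]

lemma IsGaussianWith.memLp_eval (h : IsGaussianWith μ y) (i : Fin d) :
    MemLp (fun ω : Fin d → ℝ => ω i) 2 (μ : Measure (Fin d → ℝ)) :=
  (HasGaussianLaw.eval (X := fun (i : Fin d) (ω : Fin d → ℝ) => ω i) h.gaussian i).memLp_two

lemma IsGaussianWith.cov_linComb (h : IsGaussianWith μ y) (a b : Fin d → ℝ) :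
    cov[linComb a, linComb b; (μ : Measure (Fin d → ℝ))] =
      inner ℝ (∑ k, a k • y k) (∑ k, b k • y k) := by
  unfold linComb
  rw [covariance_fun_sum_fun_sum (fun i => (h.memLp_eval i).const_mul _)
    (fun i => (h.memLp_eval i).const_mul _), sum_inner]
  refine Finset.sum_congr rfl fun i _ => ?_
  rw [inner_sum]
  refine Finset.sum_congr rfl fun j _ => ?_
  rw [covariance_const_mul_left, covariance_const_mul_right, h.cov, real_inner_smul_left,
    real_inner_smul_right]

lemma IsGaussianWith.memLp_linComb (h : IsGaussianWith μ y) (a : Fin d → ℝ) :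
    MemLp (linComb a) 2 (μ : Measure (Fin d → ℝ)) := by
  unfold linComb
  exact memLp_finsetSum _ fun i _ => (h.memLp_eval i).const_mul _

/-- Uncorrelated linear combinations are independent. -/
lemma IsGaussianWith.indep_of_inner (h : IsGaussianWith μ y) (a : Fin d → ℝ)
    {γ : Finset (Fin d)} (ha : ∀ k ∈ γ, inner ℝ (∑ l, a l • y l) (y k) = 0) :
    Indep (MeasurableSpace.comap (linComb a) inferInstance) (sig γ)
      (μ : Measure (Fin d → ℝ)) := by
  have hXY : HasGaussianLaw (fun ω : Fin d → ℝ =>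
      ((fun _ : Unit => linComb a ω), (fun k : γ => ω k))) (μ : Measure (Fin d → ℝ)) := by
    refine h.gaussian.map_fun (ContinuousLinearMap.prod
      (ContinuousLinearMap.pi fun _ => ∑ k, a k • ContinuousLinearMap.proj (R := ℝ) k)
      (ContinuousLinearMap.pi fun k : γ => ContinuousLinearMap.proj (R := ℝ) k.1)) |>.congr ?_
    refine Filter.Eventually.of_forall fun ω => ?_
    simp only [ContinuousLinearMap.prod_apply, Prod.mk.injEq]
    constructor
    · funext _
      simp [linComb]
    · rfl
  have := hXY.indepFun_of_covariance_eval (X := fun _ => linComb a) (Y := fun (k : γ) (ω : Fin d → ℝ) => ω k.1) ?_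
  · have h2 := this.comp (measurable_pi_apply ()) measurable_id
    rw [IndepFun_iff_Indep] at h2
    exact h2
  · rintro _ ⟨k, hk⟩
    rw [← linComb_single, h.cov_linComb]
    simpa [Pi.single_apply, ite_smul] using ha k hk

lemma comap_linComb_le (a : Fin d → ℝ) {γ : Finset (Fin d)} (ha : ∀ k, k ∉ γ → a k = 0) :
    MeasurableSpace.comap (linComb a) inferInstance ≤ sig γ := by
  have : linComb a = (fun z : γ → ℝ => ∑ k, a k.1 * z k) ∘ γ.restrict (π := fun _ => ℝ) := by
    funext ω
    simp only [linComb, Function.comp_apply, Finset.restrict]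
    rw [← Finset.sum_subset γ.subset_univ (fun k _ hk => by rw [ha k hk, zero_mul])]
    exact (Finset.sum_coe_sort γ (fun k => a k * ω k)).symm
  rw [this, ← MeasurableSpace.comap_comp]
  refine MeasurableSpace.comap_mono (Measurable.comap_le ?_)
  fun_prop

/-- The component `i` is the linear combination minus a linear combination of the components in `γ`.
-/
lemma sig_singleton_le_of_linComb {i : Fin d} {γ : Finset (Fin d)} {a : Fin d → ℝ}
    (hai : a i = 1) (hi : i ∉ γ) (ha : ∀ k, k ≠ i → k ∉ γ → a k = 0) :
    sig {i} ≤ MeasurableSpace.comap (linComb a) inferInstance ⊔ sig γ := by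
  have hb : MeasurableSpace.comap (linComb (a - Pi.single i 1)) inferInstance ≤ sig γ := by
    refine comap_linComb_le _ fun k hk => ?_
    by_cases h : k = i
    · subst h; simp [hai]
    · simp [h, ha k h hk]
  have : sig {i} = MeasurableSpace.comap (fun ω : Fin d → ℝ => ω i) inferInstance := by
    rw [sig_eq_iSup]; simp
  rw [this, ← measurable_iff_comap_le]
  have h1 : Measurable[MeasurableSpace.comap (linComb a) inferInstance ⊔ sig γ] (linComb a) :=
    measurable_iff_comap_le.2 le_sup_left
  have h2 : Measurable[MeasurableSpace.comap (linComb a) inferInstance ⊔ sig γ]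
      (linComb (a - Pi.single i 1)) := measurable_iff_comap_le.2 (hb.trans le_sup_right)
  have h3 : (fun ω : Fin d → ℝ => ω i) = fun ω => linComb a ω - linComb (a - Pi.single i 1) ω := by
    funext ω
    simp [linComb, sub_mul, Finset.sum_sub_distrib, Pi.single_apply]
  rw [h3]
  exact h1.sub h2

/-- A component depends on the others only through its regressors. -/
lemma IsGaussianWith.condInd_of_inner (h : IsGaussianWith μ y) {i : Fin d} {β γ : Finset (Fin d)}
    {a : Fin d → ℝ} (hai : a i = 1) (hi : i ∉ γ) (ha : ∀ k, k ≠ i → k ∉ γ → a k = 0)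
    (hy : ∀ k ∈ β ∪ γ, inner ℝ (∑ l, a l • y l) (y k) = 0) : CondInd μ {i} β γ := by
  have hm : MeasurableSpace.comap (linComb a) inferInstance ≤
      (inferInstance : MeasurableSpace (Fin d → ℝ)) := (measurable_linComb a).comap_le
  -- The residual is independent of `β ∪ γ`, hence of `β` given `γ` by weak union. Given `γ`, it can
  -- be replaced by the component `i`.
  have h1 := (condIndep_bot_iff hm (sig_le _)).2 (h.indep_of_inner a hy)
  rw [sig_union] at h1
  have h2 := condIndep_weak_union hm (sig_le _) (sig_le _) h1
  have h3 := condIndep_sup_self (sig_le _) hm h2.symm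
  have h4 := (condIndep_of_condIndep_of_le_right h3
    ((sig_singleton_le_of_linComb hai hi ha).trans (sup_le_sup le_rfl le_sup_right))).symm
  rw [condInd_iff]
  simpa using h4

/-- Conditional independence makes the residual uncorrelated. -/
lemma IsGaussianWith.inner_eq_zero_of_condInd (h : IsGaussianWith μ y) {i j : Fin d}
    {γ : Finset (Fin d)} (hc : CondInd μ {i} {j} γ) {a : Fin d → ℝ}
    (ha : ∀ k, k ≠ i → k ∉ γ → a k = 0)
    (hy : ∀ k ∈ γ, inner ℝ (∑ l, a l • y l) (y k) = 0) :
    inner ℝ (∑ l, a l • y l) (y j) = 0 := by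
  have hm : MeasurableSpace.comap (linComb a) inferInstance ≤
      (inferInstance : MeasurableSpace (Fin d → ℝ)) := (measurable_linComb a).comap_le
  have h1 := (condIndep_bot_iff hm (sig_le _)).2 (h.indep_of_inner a hy)
  have h2 := condIndep_sup_self (sig_le _) (sig_le _) (condInd_iff.1 hc).symm
  have h3 : MeasurableSpace.comap (linComb a) inferInstance ≤ sig {i} ⊔ sig γ := by
    rw [← sig_union]
    refine comap_linComb_le _ fun k hk => ?_
    simp only [Finset.mem_union, Finset.mem_singleton, not_or] at hk
    exact ha k hk.1 hk.2
  have h4 := (condIndep_of_condIndep_of_le_right h2 h3).symm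
  -- The residual is independent of `γ`, and independent of component `j` given `γ`. Contraction
  -- makes it independent of component `j` outright.
  have h5 := condIndep_contraction hm (sig_le γ) (sig_le {j}) h1 (by simpa using h4)
  have h6 := (condIndep_bot_iff hm (sup_le (sig_le γ) (sig_le {j}))).1 h5
  have h7 : IndepFun (linComb a) (fun ω : Fin d → ℝ => ω j) (μ : Measure (Fin d → ℝ)) := by
    rw [IndepFun_iff_Indep]
    refine indep_of_indep_of_le_right h6 (le_trans ?_ le_sup_right)
    rw [sig_eq_iSup]; simp
  have h8 := h7.covariance_eq_zero (h.memLp_linComb a) (h.memLp_eval j)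
  rw [← linComb_single, h.cov_linComb] at h8
  simpa [Pi.single_apply, ite_smul] using h8

end Gaussian

/-! ### Gaussian triangular systems -/

section Triangular

variable {d : ℕ} {A B : Matrix (Fin d) (Fin d) ℝ} {δ : Fin d → ℝ≥0}
  {μ : ProbabilityMeasure (Fin d → ℝ)} {y : Fin d → EuclideanSpace ℝ (Fin d)}

lemma covariance_pi_gaussianReal (k l : Fin d) :
    cov[fun x => x k, fun x => x l; Measure.pi fun i => gaussianReal 0 (δ i)] =
      if k = l then (δ k : ℝ) else 0 := by
  have hlaw : ∀ k, HasLaw (fun x : Fin d → ℝ => x k) (gaussianReal 0 (δ k))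
      (Measure.pi fun i => gaussianReal 0 (δ i)) := fun k =>
    (measurePreserving_eval (fun i => gaussianReal 0 (δ i)) k).hasLaw
  split_ifs with h
  · subst h
    rw [covariance_self (measurable_pi_apply k).aemeasurable, (hlaw k).variance_eq,
      variance_id_gaussianReal]
  · have hi : iIndepFun (fun (i : Fin d) (x : Fin d → ℝ) => x i)
        (Measure.pi fun i => gaussianReal 0 (δ i)) :=
      iIndepFun_pi (X := fun _ x => x) fun i => aemeasurable_id
    exact (hi.indepFun h).covariance_eq_zero (hlaw k).hasGaussianLaw.memLp_two
      (hlaw l).hasGaussianLaw.memLp_two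

lemma eq_sum_inv_of_sum_eq (hB : IsUnit B.det) {s : Fin d → ℝ}
    (hy : ∀ i, ∑ k, B i k • y k = EuclideanSpace.single i (s i)) (i : Fin d) :
    y i = ∑ k, B⁻¹ i k • EuclideanSpace.single k (s k) := by
  simp only [← hy, Finset.smul_sum, smul_smul]
  rw [Finset.sum_comm]
  simp only [← Finset.sum_smul]
  have : ∀ l, ∑ k, B⁻¹ i k * B k l = (1 : Matrix (Fin d) (Fin d) ℝ) i l := fun l => by
    rw [← Matrix.mul_apply, Matrix.nonsing_inv_mul _ hB]
  simp [this, Matrix.one_apply, ite_smul]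

/-- The covariance vectors of a linear Gaussian system. -/
lemma isGaussianWith_of_map (hB : IsUnit B.det)
    (hμ : (μ : Measure (Fin d → ℝ)).map B.mulVec = Measure.pi fun i => gaussianReal 0 (δ i))
    (hy : ∀ i, ∑ k, B i k • y k = EuclideanSpace.single i (Real.sqrt (δ i))) :
    IsGaussianWith μ y := by
  have hBm : Measurable B.mulVec := by
    refine measurable_pi_lambda _ fun i => ?_
    simp only [Matrix.mulVec, dotProduct]
    fun_prop
  have hlaw : HasLaw B.mulVec (Measure.pi fun i => gaussianReal 0 (δ i))
    (μ : Measure (Fin d → ℝ)) := ⟨hBm.aemeasurable, hμ⟩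
  have hinv : ∀ ω i, ω i = ∑ k, B⁻¹ i k * B.mulVec ω k := by
    intro ω i
    have : B⁻¹.mulVec (B.mulVec ω) = ω := by
      rw [Matrix.mulVec_mulVec, Matrix.nonsing_inv_mul _ hB, Matrix.one_mulVec]
    exact (congrFun this i).symm
  have hg : HasGaussianLaw B.mulVec (μ : Measure (Fin d → ℝ)) := by
    have : HasGaussianLaw (fun x : Fin d → ℝ => x)
        (Measure.pi fun i => gaussianReal 0 (δ i)) := by
      refine iIndepFun.hasGaussianLaw (X := fun (i : Fin d) (x : Fin d → ℝ) => x i)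
        (fun k => ?_) (iIndepFun_pi (X := fun _ x => x) fun i => aemeasurable_id)
      exact (measurePreserving_eval (fun i => gaussianReal 0 (δ i)) k).hasLaw.hasGaussianLaw
    refine ⟨?_⟩
    rw [hμ]
    simpa using this.isGaussian_map
  have hmem : ∀ k, MemLp (fun ω => B.mulVec ω k) 2 (μ : Measure (Fin d → ℝ)) := fun k =>
    (HasGaussianLaw.eval (X := fun k ω => B.mulVec ω k) hg k).memLp_two
  refine ⟨?_, fun i j => ?_⟩
  · refine (hg.map_fun (LinearMap.toContinuousLinearMap (Matrix.mulVecLin B⁻¹))).congr ?_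
    refine Filter.Eventually.of_forall fun ω => ?_
    funext i
    exact (hinv ω i).symm
  · have hcov : ∀ k l, cov[fun ω => B.mulVec ω k, fun ω => B.mulVec ω l;
        (μ : Measure (Fin d → ℝ))] = if k = l then (δ k : ℝ) else 0 := by
      intro k l
      rw [← covariance_pi_gaussianReal]
      exact hlaw.covariance_fun_comp (f := fun x => x k) (g := fun x => x l)
        (measurable_pi_apply k).aemeasurable (measurable_pi_apply l).aemeasurable
    have e : ∀ i, (fun ω : Fin d → ℝ => ω i) = fun ω => ∑ k, B⁻¹ i k * B.mulVec ω k :=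
      fun i => funext fun ω => hinv ω i
    rw [e i, e j, covariance_fun_sum_fun_sum (fun k => (hmem k).const_mul _)
      (fun k => (hmem k).const_mul _), eq_sum_inv_of_sum_eq hB hy i, eq_sum_inv_of_sum_eq hB hy j,
      sum_inner]
    refine Finset.sum_congr rfl fun k _ => ?_
    rw [inner_sum]
    refine Finset.sum_congr rfl fun l _ => ?_
    rw [covariance_const_mul_left, covariance_const_mul_right, hcov, real_inner_smul_left,
      real_inner_smul_right]
    by_cases h : k = l
    · subst h
      simp
    · simp [h, EuclideanSpace.inner_single_left]

lemma blockTriangular_of_ind (hA : IsParentMatrix A) (hBA : ind B = A) :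
    B.BlockTriangular id := by
  intro i k hik
  have := hA.2.2 i k hik
  rw [← hBA] at this
  by_contra h
  simp [ind, h] at this

lemma isUnit_det_of_ind (hA : IsParentMatrix A) (hBA : ind B = A) (hB : ∀ i, B i i = 1) :
    IsUnit B.det := by
  rw [Matrix.det_of_isUpperTriangular (blockTriangular_of_ind hA hBA)]
  simp [hB]

lemma mem_par_iff (hA : IsParentMatrix A) {i k : Fin d} : k ∈ par A i ↔ Arrow A i k := by
  simp only [par, Finset.mem_filter, Finset.mem_Ioi, Arrow]
  constructor
  · rintro ⟨h, h'⟩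
    exact ⟨h.ne, h'⟩
  · rintro ⟨h, h'⟩
    refine ⟨lt_of_le_of_ne ?_ h, h'⟩
    by_contra hlt
    exact h' (hA.2.2 i k (not_le.1 hlt))

lemma mem_par_iff_of_ind (hA : IsParentMatrix A) (hBA : ind B = A) {i k : Fin d} :
    k ∈ par A i ↔ i ≠ k ∧ B i k ≠ 0 := by
  rw [mem_par_iff hA, Arrow, ← hBA]
  simp [ind]

/-- The inner product of the parts of `x` and `z` that are orthogonal to `K`. -/
def partialInner {F : Type*} [NormedAddCommGroup F] [InnerProductSpace ℝ F] (K : Submodule ℝ F)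
    [K.HasOrthogonalProjection] (x z : F) : ℝ :=
  inner ℝ (Kᗮ.starProjection x) z

/-- The span of the vectors with index in `γ`. -/
abbrev spanOf (y : Fin d → EuclideanSpace ℝ (Fin d)) (γ : Finset (Fin d)) :
    Submodule ℝ (EuclideanSpace ℝ (Fin d)) := Submodule.span ℝ (y '' γ)

/-- The part of `y i` orthogonal to the span over `γ` is the covariance vector of the residual of
component `i` after regression on `γ`, so the partial inner product is a partial covariance. -/
lemma IsGaussianWith.partialInner_eq_zero (h : IsGaussianWith μ y) {i j : Fin d}
    {γ : Finset (Fin d)} (hc : CondInd μ {i} {j} γ) :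
    partialInner (spanOf y γ) (y i) (y j) = 0 := by
  have hmem := (spanOf y γ).starProjection_apply_mem (y i)
  obtain ⟨b, hb⟩ : ∃ b : Fin d → ℝ, ∑ k ∈ γ, b k • y k = (spanOf y γ).starProjection (y i) := by
    obtain ⟨b, hb⟩ := (Submodule.mem_span_image_finset_iff_exists_fun ℝ).1 hmem
    refine ⟨fun k => if h : k ∈ γ then b ⟨k, h⟩ else 0, ?_⟩
    rw [← hb, ← Finset.sum_coe_sort]
    simp
  set a : Fin d → ℝ := fun k => (if k = i then 1 else 0) - if k ∈ γ then b k else 0 with ha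
  have hsum : ∑ l, a l • y l = (spanOf y γ)ᗮ.starProjection (y i) := by
    rw [Submodule.starProjection_orthogonal_val, ← hb]
    simp [ha, sub_smul, Finset.sum_sub_distrib, ite_smul]
  rw [partialInner, ← hsum]
  refine h.inner_eq_zero_of_condInd hc (a := a) (fun k h1 h2 => by simp [ha, h1, h2]) fun k hk => ?_
  rw [hsum, real_inner_comm]
  exact (Submodule.mem_orthogonal _ _).1 (Submodule.starProjection_apply_mem _ _) _
    (Submodule.subset_span ⟨k, hk, rfl⟩)

lemma partialInner_self_ne_zero {F : Type*} [NormedAddCommGroup F] [InnerProductSpace ℝ F]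
    {K : Submodule ℝ F} [K.HasOrthogonalProjection] {x : F} (hx : x ∉ K) :
    partialInner K x x ≠ 0 := by
  intro h
  have h1 : inner ℝ (Kᗮ.starProjection x) (Kᗮ.starProjection x) = 0 := by
    rw [Submodule.inner_starProjection_left_eq_right,
      Submodule.starProjection_eq_self_iff.2 (Submodule.starProjection_apply_mem _ _),
      real_inner_comm]
    rwa [partialInner] at h
  rw [inner_self_eq_zero, Submodule.starProjection_orthogonal_val, sub_eq_zero] at h1
  exact hx (Submodule.starProjection_eq_self_iff.1 h1.symm)

lemma linearIndependent_of_sum_eq {s : Fin d → ℝ} (hs : ∀ i, s i ≠ 0)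
    (hy : ∀ i, ∑ k, B i k • y k = EuclideanSpace.single i (s i)) : LinearIndependent ℝ y := by
  refine linearIndependent_of_top_le_span_of_card_eq_finrank ?_ (by simp)
  rw [← (EuclideanSpace.basisFun (Fin d) ℝ).toBasis.span_eq, Submodule.span_le]
  rintro _ ⟨i, rfl⟩
  have h1 : EuclideanSpace.single i (s i) ∈ Submodule.span ℝ (Set.range y) := by
    rw [← hy i]
    exact Submodule.sum_mem _ fun k _ => Submodule.smul_mem _ _ (Submodule.subset_span ⟨k, rfl⟩)
  have h2 := Submodule.smul_mem _ (s i)⁻¹ h1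
  have h3 : (s i)⁻¹ • EuclideanSpace.single i (s i) = EuclideanSpace.single i (1 : ℝ) := by
    ext k
    by_cases h : k = i <;> simp [h, hs i]
  rw [h3] at h2
  simpa using h2

/-- Gaussian triangular systems are generated over the graph. -/
theorem gaussianOver_subset_generatedOver (hA : IsParentMatrix A) :
    gaussianOver A ⊆ generatedOver A := by
  rintro μ ⟨B, δ, hB1, hBA, hδ, hμ⟩
  have hdet := isUnit_det_of_ind hA hBA hB1
  set y : Fin d → EuclideanSpace ℝ (Fin d) :=
    fun i => ∑ k, B⁻¹ i k • EuclideanSpace.single k (Real.sqrt (δ k)) with hydef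
  have hy : ∀ i, ∑ k, B i k • y k = EuclideanSpace.single i (Real.sqrt (δ i)) := by
    intro i
    simp only [hydef, Finset.smul_sum, smul_smul]
    rw [Finset.sum_comm]
    simp only [← Finset.sum_smul]
    have : ∀ l, ∑ k, B i k * B⁻¹ k l = (1 : Matrix (Fin d) (Fin d) ℝ) i l := fun l => by
      rw [← Matrix.mul_apply, Matrix.mul_nonsing_inv _ hdet]
    simp [this, Matrix.one_apply, ite_smul]
  have hg := isGaussianWith_of_map hdet hμ hy
  have hs : ∀ i, Real.sqrt (δ i) ≠ 0 := fun i =>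
    (Real.sqrt_pos.2 (NNReal.coe_pos.2 (pos_iff_ne_zero.2 (hδ i)))).ne'
  have hlin := linearIndependent_of_sum_eq hs hy
  -- The inverse of `B` is triangular as well, so the vectors of later nodes have no part in the
  -- direction of an earlier residual.
  have htri : ∀ i k, i < k → y k i = 0 := by
    intro i k hik
    have : B⁻¹ k i = 0 := by
      have := B.invertibleOfIsUnitDet hdet
      exact Matrix.blockTriangular_inv_of_blockTriangular (blockTriangular_of_ind hA hBA) hik
    simp [hydef, Pi.single_apply, this]
  refine ⟨fun i => ?_, fun i l hl hc => ?_⟩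
  · refine hg.condInd_of_inner (a := B i) (hB1 i) ?_ ?_ ?_
    · simp [mem_par_iff_of_ind hA hBA]
    · intro k hki hk
      by_contra h
      exact hk ((mem_par_iff_of_ind hA hBA).2 ⟨hki.symm, h⟩)
    · intro k hk
      have hik : i < k := by
        rcases Finset.mem_union.1 hk with h | h
        · exact Finset.mem_Ioi.1 (Finset.mem_sdiff.1 h).1
        · exact Finset.mem_Ioi.1 (Finset.mem_filter.1 h).1
      rw [hy i, EuclideanSpace.inner_single_left, htri i k hik, mul_zero]
  · obtain ⟨hil, hBl⟩ := (mem_par_iff_of_ind hA hBA).1 hl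
    have h0 := hg.partialInner_eq_zero hc
    set K := spanOf y (par A i \ {l}) with hK
    have hKlt : ∀ z ∈ K, z i = 0 := by
      intro z hz
      refine Submodule.span_induction ?_ rfl ?_ ?_ hz
      · rintro _ ⟨k, hk, rfl⟩
        refine htri i k ?_
        exact Finset.mem_Ioi.1 (Finset.mem_filter.1
          (Finset.mem_sdiff.1 (Finset.mem_coe.1 hk)).1).1
      · intro u v _ _ hu hv
        simp [hu, hv]
      · intro c u _ hu
        simp [hu]
    have hil' : i < l := Finset.mem_Ioi.1 (Finset.mem_filter.1 hl).1
    have hyi : y i = EuclideanSpace.single i (Real.sqrt (δ i)) - ∑ k ∈ Finset.univ.erase i,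
        B i k • y k := by
      rw [← hy i, ← Finset.add_sum_erase _ _ (Finset.mem_univ i), hB1]
      simp
    -- The vectors of all parents except `l` lie in `K`, and the residual of `i` is orthogonal to
    -- `K`. The partial covariance of `i` and `l` is thus `-B i l` times the partial variance of
    -- `l`, which is non-zero by linear independence.
    have hproj : Kᗮ.starProjection (y i) =
        EuclideanSpace.single i (Real.sqrt (δ i)) - B i l • Kᗮ.starProjection (y l) := by
      rw [hyi, map_sub, map_sum]
      congr 1
      · refine Submodule.starProjection_eq_self_iff.2 ((Submodule.mem_orthogonal _ _).2 ?_)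
        intro z hz
        simp [EuclideanSpace.inner_single_right, hKlt z hz]
      · rw [Finset.sum_eq_single l]
        · rw [map_smul]
        · intro k hk hkl
          by_cases hBk : B i k = 0
          · simp [hBk]
          · have : y k ∈ K := Submodule.subset_span ⟨k, by
              simpa [mem_par_iff_of_ind hA hBA, hkl, hBk] using (Finset.mem_erase.1 hk).1.symm, rfl⟩
            rw [map_smul, Submodule.starProjection_orthogonal_apply_eq_zero this, smul_zero]
        · intro h
          simp [hil.symm] at h
    rw [partialInner, hproj, inner_sub_left, EuclideanSpace.inner_single_left, htri i l hil',
      mul_zero, zero_sub, real_inner_smul_left, neg_eq_zero, mul_eq_zero] at h0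
    refine partialInner_self_ne_zero (K := K) (x := y l) ?_ (h0.resolve_left hBl)
    exact hlin.notMem_span_image (by simp)

/-- A Gaussian triangular system with given covariance vectors. -/
lemma exists_mem_gaussianOver (hA : IsParentMatrix A) (hBA : ind B = A) (hB : ∀ i, B i i = 1)
    (hδ : ∀ i, δ i ≠ 0)
    (hy : ∀ i, ∑ k, B i k • y k = EuclideanSpace.single i (Real.sqrt (δ i))) :
    ∃ μ ∈ gaussianOver A, IsGaussianWith μ y := by
  have hdet := isUnit_det_of_ind hA hBA hB
  have hm : ∀ D : Matrix (Fin d) (Fin d) ℝ, Measurable D.mulVec := fun D => by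
    refine measurable_pi_lambda _ fun i => ?_
    simp only [Matrix.mulVec, dotProduct]
    fun_prop
  have hp : IsProbabilityMeasure ((Measure.pi fun i => gaussianReal 0 (δ i)).map B⁻¹.mulVec) :=
    Measure.isProbabilityMeasure_map (hm _).aemeasurable
  have hμ : ((Measure.pi fun i => gaussianReal 0 (δ i)).map B⁻¹.mulVec).map B.mulVec =
      Measure.pi fun i => gaussianReal 0 (δ i) := by
    rw [Measure.map_map (hm _) (hm _)]
    have : B.mulVec ∘ B⁻¹.mulVec = id := by
      funext x
      simp [Matrix.mulVec_mulVec, Matrix.mul_nonsing_inv _ hdet]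
    rw [this, Measure.map_id]
  exact ⟨⟨_, hp⟩, ⟨B, δ, hB, hBA, hδ, hμ⟩, isGaussianWith_of_map hdet hμ hy⟩

end Triangular

/-! ### Connecting walks and the removal of the first node -/

section FirstNode

variable {d : ℕ} {E : Fin d → Fin d → Prop} {x : Fin d} {s t : Set (Fin d)}

lemma edge_edgeFrom_cases (hlt : ∀ x y, E x y → x < y) {i j : Fin d} {a b : Bool}
    (h : Edge (EdgeFrom E x.val) i a j b) :
    (i = x ∧ a = true ∧ b = false ∧ E x j ∧ x < j) ∨
    (j = x ∧ a = false ∧ b = true ∧ E x i ∧ x < i) ∨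
    (x < i ∧ x < j ∧ Edge (EdgeFrom E (x.val + 1)) i a j b) := by
  rcases h with ⟨rfl, rfl, h, hx⟩ | ⟨rfl, rfl, h, hx⟩
  · rcases eq_or_ne i x with rfl | hi
    · exact .inl ⟨rfl, rfl, rfl, h, hlt _ _ h⟩
    · have hxi : x < i := lt_of_le_of_ne (Fin.le_def.2 hx) hi.symm
      exact .inr (.inr ⟨hxi, hxi.trans (hlt _ _ h), .inl ⟨rfl, rfl, h, hxi⟩⟩)
  · rcases eq_or_ne j x with rfl | hj
    · exact .inr (.inl ⟨rfl, rfl, rfl, h, hlt _ _ h⟩)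
    · have hxj : x < j := lt_of_le_of_ne (Fin.le_def.2 hx) hj.symm
      exact .inr (.inr ⟨hxj.trans (hlt _ _ h), hxj, .inr ⟨rfl, rfl, h, hxj⟩⟩)

/-- All joints come after `x`, so it does not matter whether `x` is conditioned on. -/
lemma walk_congr (hlt : ∀ x y, E x y → x < y) (hst : ∀ y, x < y → (y ∈ s ↔ y ∈ t))
    {i j : Fin d} {a b : Bool} (h : Walk (EdgeFrom E (x.val + 1)) sᶜ s i a j b) :
    Walk (EdgeFrom E (x.val + 1)) tᶜ t i a j b := by
  have hb : ∀ {i a j b}, Edge (EdgeFrom E (x.val + 1)) i a j b → x < j := by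
    rintro i a j b (⟨rfl, rfl, h, hx⟩ | ⟨rfl, rfl, h, hx⟩)
    · exact lt_trans (Fin.lt_def.2 hx) (hlt _ _ h)
    · exact Fin.lt_def.2 hx
  induction h with
  | single h => exact .single h
  | @cons i a y b c j d h hm _ ih =>
    have hy := hst y (hb h)
    refine .cons h ?_ ih
    cases b <;> cases c
    · exact fun h => hm (hy.2 h)
    · exact fun h => hm (hy.2 h)
    · exact fun h => hm (hy.2 h)
    · exact hy.1 hm

/-- The node `j` is, or is connected to, a parent of `x` outside `s`. -/
def Touches (E : Fin d → Fin d → Prop) (x : Fin d) (s : Set (Fin d)) (j : Fin d) : Prop :=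
  ∃ k, E x k ∧ k ∉ s ∧ (k = j ∨ Conn (EdgeFrom E (x.val + 1)) s k j)

/-- In the graph from `x` on, all arrows at `x` point into `x`. A walk can therefore pass `x` only
as a collider, which needs `x ∈ s`. The neighbours of `x` on the walk are parents with a tail there,
so they are outside `s` unless they are end nodes of the walk. -/
lemma walk_decompose (hlt : ∀ x y, E x y → x < y) {i j : Fin d} {a b : Bool}
    (h : Walk (EdgeFrom E x.val) sᶜ s i a j b) (hj : j ≠ x) (hjs : j ∉ s) :
    (i = x ∧ a = true ∧ Touches E x s j) ∨
    (i ≠ x ∧ (Walk (EdgeFrom E (x.val + 1)) sᶜ s i a j b ∨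
      (x ∈ s ∧ Touches E x s j ∧ ∃ k, E x k ∧ ((k = i ∧ a = false) ∨
        (k ∉ s ∧ ∃ c, Walk (EdgeFrom E (x.val + 1)) sᶜ s i a k c))))) := by
  induction h with
  | @single i a j b h =>
    rcases edge_edgeFrom_cases hlt h with ⟨h1, h2, _, h3, _⟩ | ⟨h1, _⟩ | ⟨h1, _, h2⟩
    · exact .inl ⟨h1, h2, j, h3, hjs, .inl rfl⟩
    · exact absurd h1 hj
    · exact .inr ⟨h1.ne', .inl (.single h2)⟩
  | @cons i a y b c j d h hm hw ih =>
    specialize ih hj hjs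
    rcases edge_edgeFrom_cases hlt h with ⟨h1, h2, rfl, h3, h4⟩ | ⟨rfl, rfl, rfl, h3, h4⟩ |
      ⟨h1, h2, h3⟩
    · refine .inl ⟨h1, h2, ?_⟩
      have hys : y ∉ s := hm
      rcases ih with ⟨h, _⟩ | ⟨_, h | h⟩
      · exact absurd h h4.ne'
      · exact ⟨y, h3, hys, .inr ⟨_, _, h⟩⟩
      · exact h.2.1
    · rcases ih with ⟨_, rfl, h⟩ | ⟨h, _⟩
      · exact .inr ⟨h4.ne', .inr ⟨hm, h, i, h3, .inl ⟨rfl, rfl⟩⟩⟩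
      · exact absurd rfl h
    · refine .inr ⟨h1.ne', ?_⟩
      rcases ih with ⟨h, _⟩ | ⟨_, h | ⟨hx, h, k, hk, h'⟩⟩
      · exact absurd h h2.ne'
      · exact .inl (.cons h3 hm h)
      · refine .inr ⟨hx, h, k, hk, .inr ?_⟩
        rcases h' with ⟨rfl, rfl⟩ | ⟨hks, c', h'⟩
        · exact ⟨by cases b <;> exact hm, b, .single h3⟩
        · exact ⟨hks, c', .cons h3 hm h'⟩

lemma touches_of_conn (hlt : ∀ x y, E x y → x < y) {j : Fin d}
    (h : Conn (EdgeFrom E x.val) s x j) (hj : j ≠ x) (hjs : j ∉ s) : Touches E x s j := by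
  obtain ⟨a, b, h⟩ := h
  rcases walk_decompose hlt h hj hjs with h | ⟨h, _⟩
  exacts [h.2.2, absurd rfl h]

lemma conn_decompose (hlt : ∀ x y, E x y → x < y) {i j : Fin d}
    (h : Conn (EdgeFrom E x.val) s i j) (hi : i ≠ x) (hj : j ≠ x) (his : i ∉ s) (hjs : j ∉ s) :
    Conn (EdgeFrom E (x.val + 1)) s i j ∨ (x ∈ s ∧ Touches E x s i ∧ Touches E x s j) := by
  obtain ⟨a, b, h⟩ := h
  rcases walk_decompose hlt h hj hjs with h | ⟨_, h | ⟨hx, h, k, hk, h'⟩⟩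
  · exact absurd h.1 hi
  · exact .inl ⟨_, _, h⟩
  · refine .inr ⟨hx, ?_, h⟩
    rcases h' with ⟨rfl, _⟩ | ⟨hks, c, h'⟩
    · exact ⟨k, hk, his, .inl rfl⟩
    · exact ⟨k, hk, hks, .inr ⟨_, _, h'.symm⟩⟩

end FirstNode

/-! ### Partial inner products -/

section PartialInner

variable {F : Type*} [NormedAddCommGroup F] [InnerProductSpace ℝ F] [FiniteDimensional ℝ F]
  {K : Submodule ℝ F} {v w x z : F}

lemma partialInner_comm : partialInner K x z = partialInner K z x := by
  rw [partialInner, Submodule.inner_starProjection_left_eq_right, real_inner_comm, partialInner]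

lemma partialInner_add_left : partialInner K (x + w) z = partialInner K x z + partialInner K w z := by
  rw [partialInner, map_add, inner_add_left]; rfl

lemma partialInner_add_right :
    partialInner K z (x + w) = partialInner K z x + partialInner K z w := by
  rw [partialInner, inner_add_right]; rfl

lemma partialInner_sum_left {ι : Type*} (q : Finset ι) (a : ι → ℝ) (f : ι → F) :
    partialInner K (∑ k ∈ q, a k • f k) z = ∑ k ∈ q, a k * partialInner K (f k) z := by
  simp only [partialInner, map_sum, map_smul, sum_inner, real_inner_smul_left]

lemma partialInner_of_orthogonal (hw : w ∈ Kᗮ) : partialInner K w z = inner ℝ w z := by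
  rw [partialInner, Submodule.starProjection_eq_self_iff.2 hw]

lemma partialInner_self_nonneg : 0 ≤ partialInner K x x := by
  have : partialInner K x x = inner ℝ (Kᗮ.starProjection x) (Kᗮ.starProjection x) := by
    rw [Submodule.inner_starProjection_left_eq_right,
      Submodule.starProjection_eq_self_iff.2 (Submodule.starProjection_apply_mem _ _),
      real_inner_comm]
    rfl
  rw [this]
  exact real_inner_self_nonneg

/-- The recursion for partial inner products. -/
lemma partialInner_sup_span (hv : partialInner K v v ≠ 0) :
    partialInner (K ⊔ Submodule.span ℝ {v}) x z * partialInner K v v =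
      partialInner K x z * partialInner K v v - partialInner K x v * partialInner K v z := by
  -- This is the regression coefficient of `x` on `v` after removal of `K`. Subtracting the
  -- corresponding multiple gives a vector orthogonal to `v` as well, which must be the new
  -- projection.
  set c := partialInner K x v / partialInner K v v with hc
  have h : (K ⊔ Submodule.span ℝ {v})ᗮ.starProjection x =
      Kᗮ.starProjection x - c • Kᗮ.starProjection v := by
    have hmem : Kᗮ.starProjection x - c • Kᗮ.starProjection v ∈ (K ⊔ Submodule.span ℝ {v})ᗮ := by
      rw [← Submodule.inf_orthogonal, Submodule.mem_inf]
      have h1 : Kᗮ.starProjection x - c • Kᗮ.starProjection v ∈ Kᗮ :=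
        Submodule.sub_mem _ (Submodule.starProjection_apply_mem _ _)
          (Submodule.smul_mem _ _ (Submodule.starProjection_apply_mem _ _))
      refine ⟨h1, ?_⟩
      rw [Submodule.mem_orthogonal_singleton_iff_inner_left, inner_sub_left, real_inner_smul_left]
      change partialInner K x v - c * partialInner K v v = 0
      rw [hc, div_mul_cancel₀ _ hv, sub_self]
    refine Submodule.eq_starProjection_of_mem_orthogonal hmem ?_
    rw [Submodule.orthogonal_orthogonal]
    have h2 : x - (Kᗮ.starProjection x - c • Kᗮ.starProjection v) =
        (x - Kᗮ.starProjection x) - c • (v - Kᗮ.starProjection v) + c • v := by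
      rw [smul_sub]; abel
    have h3 : ∀ w, w - Kᗮ.starProjection w ∈ K := fun w => by
      rw [Submodule.starProjection_orthogonal_val, sub_sub_cancel]
      exact Submodule.starProjection_apply_mem _ _
    rw [h2]
    exact Submodule.add_mem _ (Submodule.mem_sup_left (Submodule.sub_mem _ (h3 x)
      (Submodule.smul_mem _ _ (h3 v)))) (Submodule.mem_sup_right
        (Submodule.smul_mem _ _ (Submodule.mem_span_singleton_self v)))
  have h' : partialInner (K ⊔ Submodule.span ℝ {v}) x z =
      partialInner K x z - c * partialInner K v z := by
    rw [partialInner, h, inner_sub_left, real_inner_smul_left]; rfl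
  rw [h', sub_mul, hc]
  field_simp

end PartialInner

/-! ### A Gaussian triangular system without accidental independences -/

section Faithful

variable {d : ℕ}

/-- Finitely many non-zero linear functionals on a real vector space have a common point where none
of them vanishes. The coordinates in `q` are included among the functionals to make the coefficients
themselves non-zero. -/
lemma exists_generic_coefficients {ι : Type*} [Finite ι] (q : Finset (Fin d))
    (c : ι → Fin d → ℝ) : ∃ a : Fin d → ℝ, (∀ k ∈ q, a k ≠ 0) ∧
      ∀ i, (∃ k ∈ q, c i k ≠ 0) → ∑ k ∈ q, a k * c i k ≠ 0 := by
  let f : {i // ∃ k ∈ q, c i k ≠ 0} ⊕ q → Module.Dual ℝ (Fin d → ℝ) :=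
    Sum.elim (fun i => ∑ k ∈ q, c i.1 k • LinearMap.proj k) (fun k => LinearMap.proj k.1)
  obtain ⟨a, ha⟩ := Module.Dual.exists_forall_ne_zero_of_forall_exists f (by
    rintro (⟨i, k, hk, hc⟩ | k)
    · refine ⟨Pi.single k 1, ?_⟩
      simpa [f, Pi.single_apply, hk] using hc
    · exact ⟨Pi.single k.1 1, by simp [f]⟩)
  refine ⟨a, fun k hk => ha (.inr ⟨k, hk⟩), fun i hi => ?_⟩
  have := ha (.inl ⟨i, hi⟩)
  simpa [f, mul_comm] using this

/-- For each index at most one positive `s` violates the condition: none if `a i = 0`, and otherwise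
only the root of `b i / a i - c i`. Finitely many values have to be avoided. -/
lemma exists_pos_avoiding {ι : Type*} [Finite ι] (a b c : ι → ℝ) :
    ∃ s : ℝ, 0 < s ∧ ∀ i, (a i ≠ 0 ∨ b i ≠ 0) → a i * (c i + s ^ 2) - b i ≠ 0 := by
  have hfin : (Set.range fun i => Real.sqrt (b i / a i - c i)).Finite := Set.finite_range _
  obtain ⟨s, hs, hs'⟩ := ((Set.Ioi_infinite (0 : ℝ)).sdiff hfin).nonempty
  refine ⟨s, hs, fun i hi h => ?_⟩
  rcases eq_or_ne (a i) 0 with ha | ha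
  · rcases hi with hi | hi
    · exact hi ha
    · exact hi (by simpa [ha] using h)
  · refine hs' ⟨i, ?_⟩
    have : b i / a i - c i = s ^ 2 := by
      field_simp
      linarith
    simp only [this]
    exact Real.sqrt_sq (le_of_lt hs)

variable {E : Fin d → Fin d → Prop}

/-- The vectors `y i` for `i ≥ m` solve a triangular system over the graph, and none of their partial
inner products vanishes when the nodes are connected. -/
structure FaithfulFrom (E : Fin d → Fin d → Prop) (p : Fin d → Finset (Fin d)) (m : ℕ)
    (y : Fin d → EuclideanSpace ℝ (Fin d)) (a : Fin d → Fin d → ℝ) (s : Fin d → ℝ) : Prop where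
  coeff_ne_zero : ∀ i, m ≤ i.val → ∀ k ∈ p i, a i k ≠ 0
  scale_pos : ∀ i, m ≤ i.val → 0 < s i
  eq_sum : ∀ i, m ≤ i.val → y i = ∑ k ∈ p i, a i k • y k + EuclideanSpace.single i (s i)
  lower : ∀ i, m ≤ i.val → ∀ l < i, y i l = 0
  partialInner_ne_zero : ∀ (i j : Fin d) (γ : Finset (Fin d)), m ≤ i.val → m ≤ j.val →
    (∀ k ∈ γ, m ≤ k.val) → i ∉ γ → j ∉ γ → (i = j ∨ Conn (EdgeFrom E m) γ i j) →
    partialInner (spanOf y γ) (y i) (y j) ≠ 0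

/-! ### Adding one node to a faithful system -/

section Step

variable {p : Fin d → Finset (Fin d)} {x : Fin d} {y : Fin d → EuclideanSpace ℝ (Fin d)}

lemma apply_eq_zero_of_mem_spanOf {γ : Finset (Fin d)} (h : ∀ k ∈ γ, y k x = 0)
    {z : EuclideanSpace ℝ (Fin d)} (hz : z ∈ spanOf y γ) : z x = 0 := by
  refine Submodule.span_induction ?_ rfl ?_ ?_ hz
  · rintro _ ⟨k, hk, rfl⟩
    exact h k hk
  · intro u v _ _ hu hv
    simp [hu, hv]
  · intro c u _ hu
    simp [hu]

lemma single_mem_orthogonal {γ : Finset (Fin d)} (h : ∀ k ∈ γ, y k x = 0) (r : ℝ) :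
    EuclideanSpace.single x r ∈ (spanOf y γ)ᗮ := by
  refine (Submodule.mem_orthogonal _ _).2 fun z hz => ?_
  simp [EuclideanSpace.inner_single_right, apply_eq_zero_of_mem_spanOf h hz]

lemma spanOf_update_of_notMem {γ : Finset (Fin d)} (h : x ∉ γ) (v : EuclideanSpace ℝ (Fin d)) :
    spanOf (Function.update y x v) γ = spanOf y γ := by
  unfold spanOf
  congr 1
  refine Set.image_congr fun k hk => ?_
  rw [Function.update_of_ne]
  rintro rfl
  exact h hk

lemma spanOf_update_of_mem {γ : Finset (Fin d)} (h : x ∈ γ) (v : EuclideanSpace ℝ (Fin d)) :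
    spanOf (Function.update y x v) γ = spanOf y (γ.erase x) ⊔ Submodule.span ℝ {v} := by
  conv_lhs => rw [← Finset.insert_erase h]
  unfold spanOf
  rw [Finset.coe_insert, Set.image_insert_eq, Submodule.span_insert, sup_comm, Function.update_self]
  congr 1
  exact spanOf_update_of_notMem (Finset.notMem_erase _ _) v

/-- The new vector is a generic combination `V` of the parents' vectors plus a multiple `w` of a
direction orthogonal to all later vectors. If `x` is an end node, generic coefficients keep its
partial inner product with `j` from vanishing as soon as some unconditioned parent is `j` or is
connected to it. If `x` is conditioned on, the recursion adds a term that is non-zero when both ends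
touch `x`, and a generic length of `w` prevents it from cancelling the old partial inner product. -/
lemma FaithfulFrom.step (hlt : ∀ x y, E x y → x < y) (hp : ∀ x y, y ∈ p x ↔ E x y)
    {a : Fin d → Fin d → ℝ} {s : Fin d → ℝ} (h : FaithfulFrom E p (x.val + 1) y a s) :
    ∃ y' a' s', FaithfulFrom E p x.val y' a' s' := by
  have hxp : ∀ {k}, k ∈ p x → x < k := fun hk => hlt _ _ ((hp _ _).1 hk)
  have hyx : ∀ {k}, x < k → y k x = 0 := fun hk => h.lower _ hk _ hk
  obtain ⟨b, hb, hb'⟩ := exists_generic_coefficients (p x)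
    (fun (r : Fin d × Finset (Fin d)) k => partialInner (spanOf y r.2) (y k) (y r.1))
  set V := ∑ k ∈ p x, b k • y k with hV
  have hVx : V x = 0 := by
    simp only [hV, WithLp.ofLp_sum, WithLp.ofLp_smul, Finset.sum_apply, Pi.smul_apply, smul_eq_mul]
    exact Finset.sum_eq_zero fun k hk => by rw [hyx (hxp hk), mul_zero]
  -- The index runs over pairs of end nodes and the conditioning sets to which `x` is adjoined. The
  -- avoided expression is the numerator of the recursion with `r ^ 2` as the residual variance of
  -- `x`.
  obtain ⟨r, hr, hr'⟩ := exists_pos_avoiding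
    (fun q : Fin d × Fin d × Finset (Fin d) => partialInner (spanOf y q.2.2) (y q.1) (y q.2.1))
    (fun q => partialInner (spanOf y q.2.2) (y q.1) V * partialInner (spanOf y q.2.2) V (y q.2.1))
    (fun q => partialInner (spanOf y q.2.2) V V)
  set w : EuclideanSpace ℝ (Fin d) := EuclideanSpace.single x r with hw
  set v := V + w with hv
  set y' := Function.update y x v with hy'
  have hy'x : y' x = v := Function.update_self _ _ _
  have hy'k : ∀ {k}, k ≠ x → y' k = y k := fun hk => Function.update_of_ne hk _ _
  -- partial inner products with the new vector
  have hγ0 : ∀ {γ : Finset (Fin d)}, (∀ k ∈ γ, x < k) → w ∈ (spanOf y γ)ᗮ := fun hγ =>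
    single_mem_orthogonal (fun k hk => hyx (hγ k hk)) r
  have hvj : ∀ {γ : Finset (Fin d)}, (∀ k ∈ γ, x < k) → ∀ {j}, x < j →
      partialInner (spanOf y γ) v (y j) = partialInner (spanOf y γ) V (y j) := by
    intro γ hγ j hj
    rw [hv, partialInner_add_left, partialInner_of_orthogonal (hγ0 hγ), hw,
      EuclideanSpace.inner_single_left, hyx hj]
    simp
  have hvv : ∀ {γ : Finset (Fin d)}, (∀ k ∈ γ, x < k) →
      partialInner (spanOf y γ) v v = partialInner (spanOf y γ) V V + r ^ 2 := by
    intro γ hγ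
    rw [hv, partialInner_add_left, partialInner_add_right, partialInner_add_right,
      partialInner_comm (x := V) (z := w), partialInner_of_orthogonal (hγ0 hγ),
      partialInner_of_orthogonal (hγ0 hγ), hw, EuclideanSpace.inner_single_left,
      EuclideanSpace.inner_single_left, hVx]
    simp [sq]
  have hvv0 : ∀ {γ : Finset (Fin d)}, (∀ k ∈ γ, x < k) → partialInner (spanOf y γ) v v ≠ 0 := by
    intro γ hγ
    rw [hvv hγ]
    have := partialInner_self_nonneg (K := spanOf y γ) (x := V)
    positivity
  have touch : ∀ {γ : Finset (Fin d)} {t : Set (Fin d)}, (∀ k ∈ γ, x < k) →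
      (∀ k, x < k → (k ∈ t ↔ k ∈ (γ : Set (Fin d)))) → ∀ {j}, x < j → j ∉ γ → Touches E x t j →
      partialInner (spanOf y γ) V (y j) ≠ 0 := by
    rintro γ t hγ ht j hj hjγ ⟨k, hk, hkγ, hc⟩
    have hk' := (hp x k).2 hk
    rw [hV, partialInner_sum_left]
    refine hb' (j, γ) ⟨k, hk', ?_⟩
    refine h.partialInner_ne_zero k j γ (hxp hk') hj (fun k hk => hγ k hk)
      (fun hc => hkγ ((ht k (hxp hk')).2 hc)) hjγ (hc.imp_right ?_)
    rintro ⟨a, b, hc⟩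
    exact ⟨a, b, walk_congr hlt ht hc⟩
  have hge : ∀ {k : Fin d}, x.val ≤ k.val → k ≠ x → x < k := fun h1 h2 =>
    lt_of_le_of_ne (Fin.le_def.2 h1) h2.symm
  -- the new node is one of the end nodes
  have hend : ∀ {γ : Finset (Fin d)} {j}, (∀ k ∈ γ, x < k) → x ≤ j → j ∉ γ →
      (x = j ∨ Conn (EdgeFrom E x.val) γ x j) → partialInner (spanOf y γ) v (y' j) ≠ 0 := by
    intro γ j hγ hj hjγ hc
    rcases eq_or_ne j x with rfl | hjx
    · rw [hy'x]
      exact hvv0 hγ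
    · have hj' := hge hj hjx
      rw [hy'k hjx, hvj hγ hj']
      exact touch hγ (fun _ _ => Iff.rfl) hj' hjγ
        (touches_of_conn hlt (hc.resolve_left hjx.symm) hjx (by simpa using hjγ))
  refine ⟨y', Function.update a x b, Function.update s x r, ?_, ?_, ?_, ?_, ?_⟩
  · intro i hi k hk
    rcases eq_or_ne i x with rfl | hix
    · rw [Function.update_self]
      exact hb k hk
    · rw [Function.update_of_ne hix]
      exact h.coeff_ne_zero i (hge hi hix) k hk
  · intro i hi
    rcases eq_or_ne i x with rfl | hix
    · rwa [Function.update_self]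
    · rw [Function.update_of_ne hix]
      exact h.scale_pos i (hge hi hix)
  · intro i hi
    have hpi : ∀ k ∈ p i, k ≠ x := by
      rintro k hk rfl
      exact absurd (hlt _ _ ((hp _ _).1 hk)) (not_lt.2 (Fin.le_def.2 hi))
    rcases eq_or_ne i x with rfl | hix
    · rw [Function.update_self, Function.update_self, hy'x, hv, hV]
      congr 1
      exact Finset.sum_congr rfl fun k hk => by rw [hy'k (hpi k hk)]
    · rw [Function.update_of_ne hix, Function.update_of_ne hix, hy'k hix,
        h.eq_sum i (hge hi hix)]
      congr 1
      exact Finset.sum_congr rfl fun k hk => by rw [hy'k (hpi k hk)]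
  · intro i hi l hl
    rcases eq_or_ne i x with rfl | hix
    · have : V l = 0 := by
        simp only [hV, WithLp.ofLp_sum, WithLp.ofLp_smul, Finset.sum_apply, Pi.smul_apply,
          smul_eq_mul]
        exact Finset.sum_eq_zero fun k hk => by
          rw [h.lower k (hxp hk) l (hl.trans (hxp hk)), mul_zero]
      rw [hy'x, hv, hw]
      simp [this, hl.ne]
    · rw [hy'k hix]
      exact h.lower i (hge hi hix) l hl
  · intro i j γ hi hj hγ hiγ hjγ hc
    by_cases hxγ : x ∈ γ
    · have hix : i ≠ x := fun h => hiγ (h ▸ hxγ)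
      have hjx : j ≠ x := fun h => hjγ (h ▸ hxγ)
      have hi' := hge hi hix
      have hj' := hge hj hjx
      set γ' := γ.erase x with hγ'
      have hγ1 : ∀ k ∈ γ', x < k := fun k hk =>
        hge (hγ k (Finset.mem_erase.1 hk).2) (Finset.mem_erase.1 hk).1
      have hst : ∀ k, x < k → (k ∈ (γ : Set (Fin d)) ↔ k ∈ (γ' : Set (Fin d))) := by
        intro k hk
        simp [hγ', hk.ne']
      have hiγ' : i ∉ γ' := fun h => hiγ (Finset.mem_erase.1 h).2
      have hjγ' : j ∉ γ' := fun h => hjγ (Finset.mem_erase.1 h).2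
      rw [hy', spanOf_update_of_mem hxγ, ← hy', hy'k hix, hy'k hjx]
      intro h0
      -- If the partial inner product given `γ` were zero, the right-hand side of the recursion
      -- would vanish, which the choice of `r` excludes whenever the old product or the product of
      -- the two touching terms is non-zero.
      have h1 := partialInner_sup_span (K := spanOf y γ') (x := y i) (z := y j) (hvv0 hγ1)
      rw [h0, zero_mul, hvv hγ1, partialInner_comm (x := y i) (z := v), hvj hγ1 hi', hvj hγ1 hj',
        partialInner_comm (x := V) (z := y i)] at h1
      refine hr' (i, j, γ') ?_ h1.symm
      have hne : (i = j ∨ Conn (EdgeFrom E (x.val + 1)) γ' i j) →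
          partialInner (spanOf y γ') (y i) (y j) ≠ 0 :=
        h.partialInner_ne_zero i j γ' hi' hj' (fun k hk => hγ1 k hk) hiγ' hjγ'
      rcases hc with hc | hc
      · exact .inl (hne (.inl hc))
      · rcases conn_decompose hlt hc hix hjx (by simpa using hiγ) (by simpa using hjγ) with
          ⟨e, f, hc⟩ | ⟨_, hti, htj⟩
        · exact .inl (hne (.inr ⟨e, f, walk_congr hlt hst hc⟩))
        · refine .inr (mul_ne_zero ?_ (touch hγ1 hst hj' hjγ' htj))
          simp only
          rw [partialInner_comm]
          exact touch hγ1 hst hi' hiγ' hti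
    · have hγ1 : ∀ k ∈ γ, x < k := fun k hk => hge (hγ k hk) fun h => hxγ (h ▸ hk)
      rw [hy', spanOf_update_of_notMem hxγ, ← hy']
      rcases eq_or_ne i x with rfl | hix
      · rw [hy'x]
        exact hend hγ1 hj hjγ hc
      rcases eq_or_ne j x with rfl | hjx
      · rw [partialInner_comm, hy'x]
        exact hend hγ1 hi hiγ (hc.imp Eq.symm Conn.symm)
      rw [hy'k hix, hy'k hjx]
      refine h.partialInner_ne_zero i j γ (hge hi hix) (hge hj hjx) (fun k hk => hγ1 k hk) hiγ hjγ
        (hc.imp_right fun hc => ?_)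
      exact (conn_decompose hlt hc hix hjx (by simpa using hiγ) (by simpa using hjγ)).resolve_right
        fun h => hxγ h.1

end Step

lemma exists_faithfulFrom {p : Fin d → Finset (Fin d)} (hlt : ∀ x y, E x y → x < y)
    (hp : ∀ x y, y ∈ p x ↔ E x y) {m : ℕ} (hm : m ≤ d) : ∃ y a s, FaithfulFrom E p m y a s := by
  induction hm using Nat.decreasingInduction with
  | self =>
    have hd : ∀ i : Fin d, ¬ d ≤ i.val := fun i => not_le.2 i.2
    exact ⟨0, 0, 0, fun i hi => absurd hi (hd i), fun i hi => absurd hi (hd i),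
      fun i hi => absurd hi (hd i), fun i hi => absurd hi (hd i),
      fun i _ _ hi => absurd hi (hd i)⟩
  | of_succ m hm ih =>
    obtain ⟨y, a, s, h⟩ := ih
    exact FaithfulFrom.step (x := ⟨m, hm⟩) hlt hp h

/-- Some Gaussian triangular system has no independences besides those implied by the graph. -/
theorem exists_gaussian_not_condInd {A : Matrix (Fin d) (Fin d) ℝ} (hA : IsParentMatrix A) :
    ∃ μ ∈ gaussianOver A, ∀ (i j : Fin d) (γ : Finset (Fin d)), i ∉ γ → j ∉ γ →
      Conn (Arrow A) γ i j → ¬ CondInd μ {i} {j} γ := by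
  have hp : ∀ x y, y ∈ par A x ↔ Arrow A x y := fun _ _ => mem_par_iff hA
  have hlt : ∀ x y, Arrow A x y → x < y := fun x y h =>
    Finset.mem_Ioi.1 (Finset.mem_filter.1 ((hp x y).2 h)).1
  obtain ⟨y, a, s, h⟩ := exists_faithfulFrom hlt hp (Nat.zero_le d)
  -- Moving the parents to the left-hand side of the recursive equations gives the triangular
  -- system, so the coefficients change sign.
  let B : Matrix (Fin d) (Fin d) ℝ := fun i k =>
    (if k = i then 1 else 0) - if k ∈ par A i then a i k else 0
  have hii : ∀ i, i ∉ par A i := fun i hi => ((hp i i).1 hi).1 rfl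
  have hB1 : ∀ i, B i i = 1 := fun i => by simp [B, hii]
  have hBA : ind B = A := by
    funext i k
    rcases eq_or_ne k i with rfl | hki
    · simp [ind, hB1, hA.2.1]
    · by_cases hk : k ∈ par A i
      · have h1 := h.coeff_ne_zero i (Nat.zero_le _) k hk
        have h2 := (hA.1 i k).resolve_left ((hp i k).1 hk).2
        simp [ind, B, hki, hk, h1, h2]
      · have h2 : A i k = 0 := by
          by_contra h0
          exact hk ((hp i k).2 ⟨hki.symm, h0⟩)
        simp [ind, B, hki, hk, h2]
  have hδ : ∀ i, Real.toNNReal (s i ^ 2) ≠ 0 := fun i => by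
    have := h.scale_pos i (Nat.zero_le _)
    simp only [ne_eq, Real.toNNReal_eq_zero, not_le]
    positivity
  have hy : ∀ i, ∑ k, B i k • y k =
      EuclideanSpace.single i (Real.sqrt (Real.toNNReal (s i ^ 2))) := fun i => by
    have hs := h.scale_pos i (Nat.zero_le _)
    rw [Real.coe_toNNReal _ (sq_nonneg _), Real.sqrt_sq hs.le]
    simp only [B, sub_smul, Finset.sum_sub_distrib, ite_smul, one_smul, zero_smul,
      Finset.sum_ite_eq', Finset.mem_univ, if_true, Finset.sum_ite_mem, Finset.univ_inter]
    rw [h.eq_sum i (Nat.zero_le _), add_sub_cancel_left]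
  obtain ⟨μ, hμ, hg⟩ := exists_mem_gaussianOver hA hBA hB1 hδ hy
  refine ⟨μ, hμ, fun i j γ hi hj hc hind => ?_⟩
  refine h.partialInner_ne_zero i j γ (Nat.zero_le _) (Nat.zero_le _) (fun _ _ => Nat.zero_le _)
    hi hj (.inr ?_) (hg.partialInner_eq_zero hind)
  rwa [edgeFrom_zero]

end Faithful

/-! ### Implied independences and matrix conditions -/

section Implied

variable {d : ℕ} {A : Matrix (Fin d) (Fin d) ℝ}

lemma arrow_lt (hA : IsParentMatrix A) {x y : Fin d} (h : Arrow A x y) : x < y :=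
  Finset.mem_Ioi.1 (Finset.mem_filter.1 ((mem_par_iff hA).2 h)).1

lemma not_transGen_arrow_self (hA : IsParentMatrix A) (x : Fin d) :
    ¬ Relation.TransGen (Arrow A) x x := by
  have h : ∀ {x y}, Relation.TransGen (Arrow A) x y → x < y := fun h => by
    induction h with
    | single h => exact arrow_lt hA h
    | tail _ h ih => exact ih.trans (arrow_lt hA h)
  exact fun hx => lt_irrefl _ (h hx)

/-- The independences implied for a family between the Gaussian triangular systems and all
distributions generated over the graph are those given by separation. -/
theorem implied_iff_not_conn (hA : IsParentMatrix A) {P : Set (ProbabilityMeasure (Fin d → ℝ))}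
    (hP : gaussianOver A ⊆ P) (hP' : P ⊆ generatedOver A) {i : Fin d} {β γ : Finset (Fin d)}
    (hiβ : i ∉ β) (hiγ : i ∉ γ) (hβγ : Disjoint β γ) :
    Implied P {i} β γ ↔ ¬ ∃ k ∈ β, Conn (Arrow A) γ i k := by
  constructor
  · rintro h ⟨k, hk, hc⟩
    obtain ⟨μ, hμ, hfaithful⟩ := exists_gaussian_not_condInd hA
    exact hfaithful i k γ hiγ (Finset.disjoint_left.1 hβγ hk) hc
      ((h μ (hP hμ)).mono_right (Finset.singleton_subset_iff.2 hk))
  · intro h μ hμ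
    refine condInd_of_not_conn (fun _ _ => arrow_lt hA) (par A) (fun _ _ => mem_par_iff hA)
      (hP' hμ).1 (Finset.disjoint_singleton_left.2 hiβ) (Finset.disjoint_singleton_left.2 hiγ) hβγ ?_
    intro x hx k hk hc
    rw [Finset.mem_singleton.1 hx] at hc
    exact h ⟨k, hk, hc⟩

variable {V : Type*} [Fintype V] [DecidableEq V]

/-- The closure contains the identity on `a`, so the first two factors describe all paths through
`a` from `i` to a node of `a`, including single steps. -/
lemma mul_clo_mul_ne_zero {F K : Matrix V V ℝ} (hF : UnitEntries F) (hK : UnitEntries K)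
    {i k : V} {a b : Finset V} (hk : k ∈ b) :
    (blk {i} a F * clo a F * blk a b K) i k ≠ 0 ↔ ∃ w ∈ a, Via a F i w ∧ K w k ≠ 0 := by
  have hb := blk_nonneg hF.nonneg {i} a
  rw [matrix_mul_ne_zero (matrix_mul_nonneg hb (clo_nonneg a F)) (blk_nonneg hK.nonneg a b)]
  simp only [matrix_mul_ne_zero hb (clo_nonneg a F), blk_ne_zero, clo_ne_zero' hF]
  constructor
  · rintro ⟨w, ⟨z, ⟨-, hz, hiz⟩, -, hw, hzw⟩, -, -, hwk⟩
    refine ⟨w, hw, ?_, hwk⟩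
    rcases hzw with rfl | hzw
    exacts [.single hiz, .cons hiz hz hzw]
  · rintro ⟨w, hw, h, hwk⟩
    cases h with
    | single h => exact ⟨w, ⟨w, ⟨by simp, hw, h⟩, hw, hw, .inl rfl⟩, hw, hk, hwk⟩
    | @cons _ z _ h hz h' =>
      exact ⟨w, ⟨z, ⟨by simp, hz, h⟩, hz, hw, .inr h'⟩, hw, hk, hwk⟩

/-- A path either is a single edge or has a last inner node in `a`. These two cases are the two
matrix conditions for missing dashed connections. -/
lemma not_via_iff {F : Matrix V V ℝ} (hF : UnitEntries F) {i k : V} {a : Finset V} :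
    ¬ Via a F i k ↔ F i k = 0 ∧ (blk {i} a F * clo a F * blk a {k} F) i k = 0 := by
  rw [← not_iff_not, not_not, not_and_or, ← Ne, ← Ne,
    mul_clo_mul_ne_zero hF hF (Finset.mem_singleton_self k)]
  constructor
  · intro h
    obtain h | ⟨x, y, h1, hx, hy, hxy, h2⟩ := via_iff.1 h
    · exact .inl h
    · refine .inr ⟨y, hy, ?_, h2⟩
      rcases hxy with rfl | hxy
      exacts [.single h1, .cons h1 hx hxy]
  · rintro (h | ⟨w, hw, h, h'⟩)
    exacts [.single h, h.trans hw (.single h')]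

end Implied

end SummaryGraph

end


theorem proposition6 {d : ℕ} (A : Matrix (Fin d) (Fin d) ℝ) (hA : SummaryGraph.IsParentMatrix A)
    (C M : Finset (Fin d)) (G : SummaryGraph.Graph (Fin d))
    (hG : SummaryGraph.Generated A C M G)
    (pos : Fin d → ℕ) (hpos : G.IsCompatible pos) :
    SummaryGraph.gaussianOver A ⊆ SummaryGraph.generatedOver A ∧
    ∀ P : Set (ProbabilityMeasure (Fin d → ℝ)),
      SummaryGraph.gaussianOver A ⊆ P → P ⊆ SummaryGraph.generatedOver A →
      -- (1) within `v`
      (∀ i ∈ G.v, ∀ β ⊆ G.v, i ∉ β →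
        (SummaryGraph.Implied P {i} β (C ∪ (G.v \ ({i} ∪ β))) ↔
          ∀ k ∈ β, G.S i k = 0)) ∧
      -- (2) `i` in `u`, `β` within `v`
      (∀ i ∈ G.u, ∀ β ⊆ G.v,
        (SummaryGraph.Implied P {i} β (C ∪ (G.v \ β)) ↔
          ∀ k ∈ β, SummaryGraph.margin (G.ancU i) G.H i k = 0)) ∧
      -- (3) `i` in `u`, `l` in the past of `i` within `u` and not an ancestor of `i`
      (∀ i ∈ G.u, ∀ l ∈ G.nonAnc pos i, ∀ e, e = G.ancU i ∪ G.ancU l →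
        (SummaryGraph.Implied P {i} {l} (C ∪ G.v ∪ e) ↔
          (G.W i l = 0 ∧
            (SummaryGraph.blk {i} e G.W * SummaryGraph.clo e G.W *
              SummaryGraph.blk e {l} G.W) i l = 0))) ∧
      -- (4) `i` in `u`, `β` within the ancestors of `i` in `u`
      (∀ i ∈ G.u, ∀ c, c = G.ancU i → ∀ β ⊆ c,
        (SummaryGraph.Implied P {i} β (C ∪ G.v ∪ (c \ β)) ↔
          ((∀ k ∈ β, G.H i k = 0) ∧
            ∀ k ∈ β, (SummaryGraph.blk {i} c G.W * SummaryGraph.clo c G.W *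
              SummaryGraph.blk c β G.H) i k = 0))) := by
  open SummaryGraph in
  have hE := not_transGen_arrow_self hA
  have hunit : UnitEntries A := fun i k => by
    rcases hA.1 i k with h | h <;> simp [h]
  have s : Represents (Arrow A) C M G :=
    hG.represents hunit (fun i => by rw [hA.2.1 i]; exact one_ne_zero) hE
  have hvC : ∀ {k}, k ∈ G.v → k ∉ C := fun hk => ((s.mem_v _).1 hk).2.1
  have huC : ∀ {k}, k ∈ G.u → k ∉ C := fun hk h =>
    ((s.mem_u _).1 hk).1 (subset_An _ (Finset.mem_coe.2 h))
  have hanc : ∀ {i x}, i ∈ G.u → (x ∈ G.ancU i ↔ x ∈ G.u ∧ Relation.TransGen (Arrow A) i x) :=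
    fun hi => s.mem_ancU hE hi
  have hself : ∀ {i}, i ∈ G.u → i ∉ G.ancU i := fun hi h => hE _ ((hanc hi).1 h).2
  refine ⟨gaussianOver_subset_generatedOver hA, fun P hP hP' => ⟨?_, ?_, ?_, ?_⟩⟩
  · intro i hi β hβ hiβ
    rw [implied_iff_not_conn hA hP hP' hiβ, s.conn_full hi hβ hiβ]
    · push Not
      rfl
    · simp [hvC hi]
    · refine Finset.disjoint_left.2 fun k hk h => ?_
      simp [hvC (hβ hk), hk] at h
  · intro i hi β hβ
    have hiv := s.not_mem_v hi
    rw [implied_iff_not_conn hA hP hP' fun h => hiv (hβ h), s.conn_arrow hE hi hβ]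
    · push Not
      rfl
    · simp [huC hi, hiv]
    · refine Finset.disjoint_left.2 fun k hk h => ?_
      simp [hvC (hβ hk), hk] at h
  · rintro i hi l hl e rfl
    simp only [Graph.nonAnc, Finset.mem_sdiff, Finset.mem_filter] at hl
    obtain ⟨⟨hl, hil⟩, hli⟩ := hl
    have hne : i ≠ l := by
      rintro rfl
      exact lt_irrefl _ hil
    have hie : i ∉ G.ancU i ∪ G.ancU l := by
      rw [Finset.mem_union, not_or]
      -- Compatibility of the ordering is used here: `i` comes before `l`, while every ancestor of
      -- `l` comes after it.
      exact ⟨hself hi, fun h => lt_asymm hil (hpos.2 l hl i h)⟩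
    have hle : l ∉ G.ancU i ∪ G.ancU l := by
      rw [Finset.mem_union, not_or]
      exact ⟨hli, hself hl⟩
    rw [implied_iff_not_conn hA hP hP' (by simpa using hne), ← not_via_iff s.unit_W,
      ← s.conn_dashed hi hl hne (e := G.ancU i ∪ G.ancU l) ?_ hie hle ?_]
    · simp
    · exact Finset.union_subset Finset.inter_subset_right Finset.inter_subset_right
    · intro x y hx hy hxy
      rw [Finset.mem_union, hanc hi, hanc hl]
      rcases hx with rfl | rfl | hx
      · exact .inl ⟨hy, hxy⟩
      · exact .inr ⟨hy, hxy⟩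
      · rw [Finset.mem_union, hanc hi, hanc hl] at hx
        exact hx.imp (fun h => ⟨hy, h.2.trans hxy⟩) (fun h => ⟨hy, h.2.trans hxy⟩)
    · simp only [Finset.mem_union] at hie ⊢
      have := huC hi
      have := s.not_mem_v hi
      tauto
    · rw [Finset.disjoint_singleton_left]
      simp only [Finset.mem_union] at hle ⊢
      have := huC hl
      have := s.not_mem_v hl
      tauto
  · rintro i hi c rfl β hβ
    have hc : G.ancU i ⊆ G.u := Finset.inter_subset_right
    rw [implied_iff_not_conn hA hP hP' (fun h => hself hi (hβ h)),
      s.conn_ancestor hi hc (hself hi) hβ ?_]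
    · push Not
      rw [← forall₂_and]
      refine forall₂_congr fun k hk => and_congr_right fun _ => ?_
      rw [← not_iff_not, ← Ne.eq_def _ (0 : ℝ), mul_clo_mul_ne_zero s.unit_W s.unit_H hk]
      push Not
      rfl
    · intro x y hx hy hxy
      rw [hanc hi]
      rcases hx with rfl | hx
      · exact ⟨hy, hxy⟩
      · exact ⟨hy, ((hanc hi).1 hx).2.trans hxy⟩
    · have := huC hi
      have := s.not_mem_v hi
      have := hself hi
      simp only [Finset.mem_union, Finset.mem_sdiff]
      tauto
    · refine Finset.disjoint_left.2 fun k hk h => ?_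
      have hku := hc (hβ hk)
      simp [huC hku, s.not_mem_v hku, hk] at h
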